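/- Write $e(z)=e^{2\pi i z}$, let $r_2(n)=\#\{(x,y)\in\mathbb{Z}^2: x^2+y^2=n\}$, let $\varphi$ be Euler's function, $\hat\Phi(\xi)=\int_{\mathbb{R}}\Phi(y)e(-\xi y)\,dy$, and for $k\in\mathbb{N}$, $h\in\mathbb{Z}$ let $$G_Q(k,h)=\sum_{x,y \bmod k} e\!\left(\frac{h(x^2+y^2)}{k}\right)$$ be the Gauss sum of $Q(x,y)=x^2+y^2$. Let $\varepsilon>0$, let $(C_j)_{j\ge 1}$ be a sequence of real numbers, and let $\Phi:\mathbb{R}\to\mathbb{R}_{\ge 0}$ be a smooth function, not identically zero, supported in $[-1,1]$. For $q\in\mathbb{N}$, $a\in\mathbb{Z}$ with $(2a,q)=1$, and $\beta$ with $1/3+6\varepsilon<\beta<1$, put $L=q^{\beta}$ and $X=Lq=q^{1+\beta}$, and let $w:\mathbb{R}\to\mathbb{R}_{\ge 0}$ be a smooth function supported in $[X,2X]$, with $w(x)=1$ for $x\in[5X/4,7X/4]$ and $|w^{(j)}(x)|\le C_jX^{-j}$ for all $j\ge 1$ and all $x\in\mathbb{R}$. Define $$S=\sum_{\substack{b\in\mathbb{Z}\\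 (b,q)=1}}\Phi\!\left(\frac bL\right)\sum_{\substack{n\in\mathbb{N}\\ na\equiv b \bmod q}} r_2(n)w(n).$$ Then, as $q\to\infty$, $$S=\frac{\pi\,\hat\Phi(0)\,L\,\varphi(q)}{q^2}\prod_{\substack{p\mid q\\ p\text{ prime}}}\left(1-\frac{G_Q(p,1)}{p^2}\right)\int_0^\infty w(x)\,dx\cdot\bigl(1+o(1)\bigr),$$ and for all sufficiently large $q$, $$\frac{XL}{q\log^2 q}\ll S\ll\frac{XL}{q}.$$ Here the rate of convergence of the $o(1)$, the implied constants and the meaning of "sufficiently large" depend only on $\varepsilon$, $\Phi$ and $(C_j)$; they are uniform in $a$, $\beta$ and $w$. -/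

import Mathlib

open scoped FourierTransform ContDiff

namespace TwoSquares

noncomputable section

/-- `r₂(n)`: the number of pairs `(x, y) ∈ ℤ²` with `x² + y² = n`. -/
def r2 (n : ℕ) : ℕ :=
  Set.ncard {v : ℤ × ℤ | v.1 ^ 2 + v.2 ^ 2 = (n : ℤ)}

/-- The Gauss sum `G_Q(k, h) = ∑_{x, y mod k} e(h Q(x, y) / k)` of the form `Q(x, y) = x² + y²`. -/
def gaussSumQ (k : ℕ) (h : ℤ) : ℂ :=
  ∑ x ∈ Finset.range k, ∑ y ∈ Finset.range k,
    Complex.exp (2 * Real.pi * Complex.I * (h * ((x : ℂ) ^ 2 + (y : ℂ) ^ 2)) / k)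

/-- `w` is a smooth nonnegative function supported in `[X, 2X]`, equal to `1` on `[5X/4, 7X/4]`,
whose derivatives satisfy `|w⁽ʲ⁾(x)| ≤ C j * X⁻ʲ` for all `j ≥ 1`. -/
structure IsWeight (C : ℕ → ℝ) (X : ℝ) (w : ℝ → ℝ) : Prop where
  smooth : ContDiff ℝ ∞ w
  nonneg : ∀ x, 0 ≤ w x
  support_subset : tsupport w ⊆ Set.Icc X (2 * X)
  eq_one : ∀ x ∈ Set.Icc (5 * X / 4) (7 * X / 4), w x = 1
  deriv_bound : ∀ j : ℕ, 1 ≤ j → ∀ x, |iteratedDeriv j w x| ≤ C j * (X ^ j)⁻¹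

open Classical in
/-- The sum `∑_{(b, q) = 1} Φ(b / L) ∑_{n a ≡ b mod q} r₂(n) w(n)`, over `b ∈ ℤ` and `n ∈ ℕ`. -/
def S (Φ w : ℝ → ℝ) (L : ℝ) (q : ℕ) (a : ℤ) : ℝ :=
  ∑' b : ℤ, if Int.gcd b q = 1 then
    Φ (b / L) * ∑' n : ℕ, if (n : ℤ) * a ≡ b [ZMOD q] then (r2 n : ℝ) * w n else 0
  else 0

/-- The main term
`π Φ̂(0) L φ(q) / q² * ∏_{p ∣ q} (1 - G_Q(p, 1) / p²) * ∫₀^∞ w(x) dx`. -/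
def mainTerm (Φ w : ℝ → ℝ) (L : ℝ) (q : ℕ) : ℂ :=
  Real.pi * 𝓕 (fun x : ℝ => (Φ x : ℂ)) 0 * L * Nat.totient q / (q : ℂ) ^ 2 *
    (∏ p ∈ q.primeFactors, (1 - gaussSumQ p 1 / (p : ℂ) ^ 2)) *
    ((∫ x in Set.Ioi (0 : ℝ), w x : ℝ) : ℂ)

end

end TwoSquares

/-! By Jacobi, `r₂(n) = 4 ∑_{d ∣ n} χ₄(d)`, so `S` is a signed count of factorisations `n = d e`
with `a d e ≡ b mod q`. A Lipschitz cutoff at `√X` splits the divisors `d`. One factor is then fixed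
as `k ≤ 2√X`: it is `d` itself when `d` is small, and the cofactor `e` when `d` is large. For each
`k` there remains a sum over `(m, b)` in the lattice `a k m ≡ b mod q`, of determinant `q`, of a
Lipschitz function living on a box with sides of order `X / k` and `L`. If `gcd(k, q) = 1`,
coprimality of `b` to `q` is the same as coprimality of `m`, and inclusion-exclusion turns it into
conditions `t ∣ m`; otherwise the sum is empty.

Equidistribution comes from the geometry of numbers instead of Poisson summation. The sums over two
cosets of one lattice differ by `O(1 / λ)`, where `λ ≤ 1` bounds from below the shortest nonzero
vector, measured relative to the box (`abs_cosetSum_sub_le`). Averaging over all cosets gives the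
expected value. When `d` is large the variable `m` carries the factor `χ₄(m)`; this is a difference
of two coset indicators, so no main term arises (`abs_sievedSum_chi_le`).

For a single `k` the minimum `λ_k` can be tiny, but not for many `k` (`exists_sum_inv_minimum_le`).
A short vector `(m, b)` gives `n = k m` with `a n ≡ b mod q`. The pair `b`, `⌊n / q⌋` determines
`n`, and `k` is one of its divisors. With the threshold `T = X^(1/4) / L` for "short", the total
error is `L X^(1/4) q^o(1)`. The main term has size `L²` up to powers of `log q`. It wins exactly
when `(1 + β) / 4 < β`, that is, when `β > 1/3`.

In the main term the small divisors produce `∑ χ₄(k) / k` over `k` prime to `q`, which Leibniz's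
series evaluates as `π/4 ∏ (1 - χ₄(p) / p)`. Since `G_Q(p, 1) = χ₄(p) p` for odd `p`, this is the
stated product. The order of magnitude follows from `∏_{p ∣ q} (1 - 1/p) ≥ 1 / (ω(q) + 1)`, used
twice, and from `(1 - 1/p)(1 + 1/p) ≤ 1`. -/

namespace TwoSquares

/-! ### Lattice points in a box -/

/-- The sup norm on `ℤ × ℤ` in which the box `[-E, E] × [-L, L]` is the unit ball. -/
noncomputable def boxNorm (E L : ℝ) (v : ℤ × ℤ) : ℝ :=
  max (|(v.1 : ℝ)| / E) (|(v.2 : ℝ)| / L)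

/-- The determinant of two integral vectors. -/
def wedge (u v : ℤ × ℤ) : ℤ := u.1 * v.2 - u.2 * v.1

section BoxNorm

variable {E L : ℝ}

lemma boxNorm_nonneg (hE : 0 < E) (v : ℤ × ℤ) : 0 ≤ boxNorm E L v :=
  le_max_of_le_left (by positivity)

lemma boxNorm_neg (v : ℤ × ℤ) : boxNorm E L (-v) = boxNorm E L v := by
  simp [boxNorm]

lemma boxNorm_sub_comm (u v : ℤ × ℤ) : boxNorm E L (u - v) = boxNorm E L (v - u) := by
  rw [← boxNorm_neg, neg_sub]

lemma boxNorm_lt_iff (hE : 0 < E) (hL : 0 < L) {v : ℤ × ℤ} {r : ℝ} :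
    boxNorm E L v < r ↔ |(v.1 : ℝ)| < r * E ∧ |(v.2 : ℝ)| < r * L := by
  rw [boxNorm, max_lt_iff, div_lt_iff₀ hE, div_lt_iff₀ hL]

lemma boxNorm_le_iff (hE : 0 < E) (hL : 0 < L) {v : ℤ × ℤ} {r : ℝ} :
    boxNorm E L v ≤ r ↔ |(v.1 : ℝ)| ≤ r * E ∧ |(v.2 : ℝ)| ≤ r * L := by
  rw [boxNorm, max_le_iff, div_le_iff₀ hE, div_le_iff₀ hL]

lemma boxNorm_pos (hE : 0 < E) (hL : 0 < L) {v : ℤ × ℤ} (hv : v ≠ 0) : 0 < boxNorm E L v := by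
  by_contra h
  rw [not_lt, boxNorm_le_iff hE hL, zero_mul, zero_mul, abs_nonpos_iff, abs_nonpos_iff] at h
  exact hv (Prod.ext (by exact_mod_cast h.1) (by exact_mod_cast h.2))

lemma finite_boxNorm_le (hE : 0 < E) (hL : 0 < L) (r : ℝ) :
    {v : ℤ × ℤ | boxNorm E L v ≤ r}.Finite := by
  refine ((Set.finite_Icc (-⌈r * E⌉) ⌈r * E⌉).prod (Set.finite_Icc (-⌈r * L⌉) ⌈r * L⌉)).subset ?_
  rintro v hv
  rw [Set.mem_ofPred_eq, boxNorm_le_iff hE hL, abs_le, abs_le] at hv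
  obtain ⟨⟨h1, h2⟩, h3, h4⟩ := hv
  have e1 := Int.le_ceil (r * E)
  have e2 := Int.le_ceil (r * L)
  simp only [Set.mem_prod, Set.mem_Icc]
  refine ⟨⟨?_, ?_⟩, ?_, ?_⟩ <;> (rify; linarith)

end BoxNorm

/-- A `lam`-separated set of reals of radius less than `rho` has at most `4 * rho / lam` points. -/
lemma card_le_of_separated {α : Type*} {P : Finset α} {g : α → ℝ} {p0 : α} {rho lam : ℝ}
    (hlam : 0 < lam) (hle : lam ≤ rho) (hnear : ∀ p ∈ P, |g p - g p0| < rho)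
    (hsep : ∀ p ∈ P, ∀ p' ∈ P, p ≠ p' → lam ≤ |g p - g p'|) :
    (P.card : ℝ) ≤ 4 * rho / lam := by
  have hone : 1 ≤ rho / lam := (one_le_div hlam).2 hle
  have hcard : P.card ≤ (Finset.Icc ⌊-(rho / lam)⌋ ⌊rho / lam⌋).card := by
    refine Finset.card_le_card_of_injOn (fun p => ⌊(g p - g p0) / lam⌋) ?_ ?_
    · intro p hp
      have := abs_lt.1 (hnear p hp)
      simp only [Finset.coe_Icc, Set.mem_Icc]
      constructor
      · apply Int.floor_mono
        rw [← neg_div]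
        gcongr
        exact this.1.le
      · apply Int.floor_mono
        gcongr
        exact this.2.le
    · intro p hp p' hp' h
      by_contra hne
      have h1 := hsep p hp p' hp' hne
      have h2 := Int.abs_sub_lt_one_of_floor_eq_floor h
      rw [← sub_div, abs_div, abs_of_pos hlam, div_lt_one hlam, sub_sub_sub_cancel_right] at h2
      linarith
  have h1 : (P.card : ℝ) ≤ ((⌊rho / lam⌋ + 1 - ⌊-(rho / lam)⌋).toNat : ℝ) := by
    rw [Int.card_Icc] at hcard
    exact_mod_cast hcard
  have hfl : ⌊-(rho / lam)⌋ ≤ ⌊rho / lam⌋ := Int.floor_mono (by linarith)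
  have h2 : ((⌊rho / lam⌋ + 1 - ⌊-(rho / lam)⌋).toNat : ℝ)
      = (⌊rho / lam⌋ + 1 - ⌊-(rho / lam)⌋ : ℝ) := by
    have : ((⌊rho / lam⌋ + 1 - ⌊-(rho / lam)⌋).toNat : ℤ) = ⌊rho / lam⌋ + 1 - ⌊-(rho / lam)⌋ :=
      Int.toNat_of_nonneg (by omega)
    exact_mod_cast this
  have h3 := Int.floor_le (rho / lam)
  have h4 := Int.lt_floor_add_one (-(rho / lam))
  rw [mul_div_assoc]
  linarith

/-- Parallel vectors share their dominant coordinate. On a line the box norm is therefore the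
absolute value of one fixed coordinate, and counting becomes one-dimensional. -/
lemma div_le_div_of_wedge_eq_zero {x y m b E L : ℝ} (hE : 0 < E) (hL : 0 < L)
    (hw : x * b = y * m) (hm : m ≠ 0) (h : |b| / L ≤ |m| / E) : |y| / L ≤ |x| / E := by
  have hm' : 0 < |m| := abs_pos.2 hm
  rw [div_le_div_iff₀ hL hE] at h ⊢
  have hw' : |x| * |b| = |y| * |m| := by rw [← abs_mul, ← abs_mul, hw]
  refine le_of_mul_le_mul_right ?_ hm'
  nlinarith [abs_nonneg x]

/-! ### Points of a lattice coset in the box -/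

section Counting

variable {E L rho lam : ℝ}

/-- Separated collinear points of small diameter are few. -/
lemma card_le_of_collinear (hE : 0 < E) (hL : 0 < L) (hlam : 0 < lam) (hle : lam ≤ rho)
    {P : Finset (ℤ × ℤ)} (hsep : ∀ p ∈ P, ∀ p' ∈ P, p ≠ p' → lam ≤ boxNorm E L (p - p'))
    (hnear : ∀ p ∈ P, ∀ p' ∈ P, boxNorm E L (p - p') < rho)
    (hcol : ∀ p ∈ P, ∀ p' ∈ P, ∀ p₀ ∈ P, wedge (p - p₀) (p' - p₀) = 0) :
    (P.card : ℝ) ≤ 4 * rho / lam := by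
  rcases le_or_gt P.card 1 with h1 | h1
  · have : 1 ≤ rho / lam := (one_le_div hlam).2 hle
    have : (P.card : ℝ) ≤ 1 := by exact_mod_cast h1
    rw [mul_div_assoc]
    linarith
  obtain ⟨p1, hp1, p0, hp0, hne⟩ := Finset.one_lt_card.1 h1
  have hwedge : ∀ p ∈ P, ∀ p' ∈ P, ((p.1 - p'.1 : ℤ) : ℝ) * ((p1.2 - p0.2 : ℤ) : ℝ)
      = ((p.2 - p'.2 : ℤ) : ℝ) * ((p1.1 - p0.1 : ℤ) : ℝ) := by
    intro p hp p' hp'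
    have e1 := hcol p hp p1 hp1 p0 hp0
    have e2 := hcol p' hp' p1 hp1 p0 hp0
    simp only [wedge, Prod.fst_sub, Prod.snd_sub] at e1 e2
    have : (p.1 - p'.1) * (p1.2 - p0.2) = (p.2 - p'.2) * (p1.1 - p0.1) := by linear_combination e1 - e2
    exact_mod_cast this
  have hpos := boxNorm_pos hE hL (sub_ne_zero.2 hne)
  have hdisj := le_total (|((p1.2 - p0.2 : ℤ) : ℝ)| / L) (|((p1.1 - p0.1 : ℤ) : ℝ)| / E)
  -- The coordinate dominating `p1 - p0` dominates every difference of points of `P`; scaled by the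
  -- box side, it makes `P` a separated set of reals of small diameter.
  rcases hdisj with hd | hd
  · have hm : ((p1.1 - p0.1 : ℤ) : ℝ) ≠ 0 := by
      intro h0
      rw [boxNorm, Prod.fst_sub, Prod.snd_sub, max_eq_left hd, h0] at hpos
      simp at hpos
    refine card_le_of_separated (g := fun p => (p.1 : ℝ) / E) (p0 := p0) hlam hle ?_ ?_
    · intro p hp
      have := lt_of_le_of_lt (le_max_left _ _) (hnear p hp p0 hp0)
      rw [← sub_div, abs_div, abs_of_pos hE]
      simpa using this
    · intro p hp p' hp' h
      have := hsep p hp p' hp' h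
      rw [boxNorm, Prod.fst_sub, Prod.snd_sub, max_eq_left
        (div_le_div_of_wedge_eq_zero hE hL (hwedge p hp p' hp') hm hd)] at this
      rw [← sub_div, abs_div, abs_of_pos hE]
      simpa using this
  · have hm : ((p1.2 - p0.2 : ℤ) : ℝ) ≠ 0 := by
      intro h0
      rw [boxNorm, Prod.fst_sub, Prod.snd_sub, max_eq_right hd, h0] at hpos
      simp at hpos
    refine card_le_of_separated (g := fun p => (p.2 : ℝ) / L) (p0 := p0) hlam hle ?_ ?_
    · intro p hp
      have := lt_of_le_of_lt (le_max_right _ _) (hnear p hp p0 hp0)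
      rw [← sub_div, abs_div, abs_of_pos hL]
      simpa using this
    · intro p hp p' hp' h
      have := hsep p hp p' hp' h
      rw [boxNorm, Prod.fst_sub, Prod.snd_sub, max_eq_right
        (div_le_div_of_wedge_eq_zero hL hE (hwedge p hp p' hp').symm hm hd)] at this
      rw [← sub_div, abs_div, abs_of_pos hL]
      simpa using this

lemma floor_mem_Icc_of_abs_le {x : ℝ} {r : ℝ} (h : |x| ≤ r) : ⌊x⌋ ∈ Finset.Icc ⌊-r⌋ ⌊r⌋ := by
  have := abs_le.1 h
  exact Finset.mem_Icc.2 ⟨Int.floor_mono this.1, Int.floor_mono this.2⟩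

lemma card_Icc_floor_le {r : ℝ} (hr : 1 ≤ r) : ((Finset.Icc ⌊-r⌋ ⌊r⌋).card : ℝ) ≤ 4 * r := by
  have hfl : ⌊-r⌋ ≤ ⌊r⌋ := Int.floor_mono (by linarith)
  have h2 : ((⌊r⌋ + 1 - ⌊-r⌋).toNat : ℝ) = (⌊r⌋ + 1 - ⌊-r⌋ : ℝ) := by
    have : ((⌊r⌋ + 1 - ⌊-r⌋).toNat : ℤ) = ⌊r⌋ + 1 - ⌊-r⌋ := Int.toNat_of_nonneg (by omega)
    exact_mod_cast this
  rw [Int.card_Icc, h2]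
  have h3 := Int.floor_le r
  have h4 := Int.lt_floor_add_one (-r)
  linarith

/-- If short vectors of `Λ` are pairwise collinear, a coset of `Λ` has few points in the box. -/
lemma card_coset_box_le (hE : 0 < E) (hL : 0 < L) (hlam : 0 < lam) (hle : lam ≤ rho)
    (hrho : rho ≤ 1) (Λ : AddSubgroup (ℤ × ℤ))
    (hmin : ∀ v ∈ Λ, v ≠ 0 → lam ≤ boxNorm E L v)
    (hcol : ∀ u ∈ Λ, ∀ v ∈ Λ, boxNorm E L u < rho → boxNorm E L v < rho → wedge u v = 0)
    {P : Finset (ℤ × ℤ)} (hbox : ∀ p ∈ P, boxNorm E L p ≤ 1)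
    (hP : ∀ p ∈ P, ∀ p' ∈ P, p - p' ∈ Λ) :
    (P.card : ℝ) ≤ 64 / (rho * lam) := by
  have hrho0 : 0 < rho := hlam.trans_le hle
  have hinv : 1 ≤ rho⁻¹ := (one_le_inv₀ hrho0).2 hrho
  set I := Finset.Icc ⌊-rho⁻¹⌋ ⌊rho⁻¹⌋ with hI
  -- The box is cut into cells of relative side `rho`. Points of one cell differ by vectors of norm
  -- below `rho`, hence are collinear and number at most `4 * rho / lam`. At most `(4 / rho) ^ 2`
  -- cells meet the box.
  set cell : ℤ × ℤ → ℤ × ℤ := fun p => (⌊(p.1 : ℝ) / (E * rho)⌋, ⌊(p.2 : ℝ) / (L * rho)⌋)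
  have hmaps : ∀ p ∈ P, cell p ∈ I ×ˢ I := by
    intro p hp
    obtain ⟨h1, h2⟩ := (boxNorm_le_iff hE hL).1 (hbox p hp)
    refine Finset.mem_product.2 ⟨floor_mem_Icc_of_abs_le ?_, floor_mem_Icc_of_abs_le ?_⟩
    · rw [abs_div, abs_of_pos (by positivity : 0 < E * rho), div_le_iff₀ (by positivity)]
      rw [mul_comm E, ← mul_assoc, inv_mul_cancel₀ hrho0.ne']
      exact h1
    · rw [abs_div, abs_of_pos (by positivity : 0 < L * rho), div_le_iff₀ (by positivity)]
      rw [mul_comm L, ← mul_assoc, inv_mul_cancel₀ hrho0.ne']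
      exact h2
  have hfib : ∀ c ∈ I ×ˢ I, (P.filter (fun p => cell p = c)).card ≤ ⌊4 * rho / lam⌋₊ := by
    intro c _
    apply Nat.le_floor
    have hn : ∀ p ∈ P.filter (fun p => cell p = c), ∀ p' ∈ P.filter (fun p => cell p = c),
        boxNorm E L (p - p') < rho := by
      intro p hp p' hp'
      have heq : cell p = cell p' :=
        (Finset.mem_filter.1 hp).2.trans (Finset.mem_filter.1 hp').2.symm
      have h1 := Int.abs_sub_lt_one_of_floor_eq_floor (congrArg Prod.fst heq)
      have h2 := Int.abs_sub_lt_one_of_floor_eq_floor (congrArg Prod.snd heq)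
      rw [← sub_div, abs_div, abs_of_pos (by positivity : 0 < E * rho),
        div_lt_one (by positivity)] at h1
      rw [← sub_div, abs_div, abs_of_pos (by positivity : 0 < L * rho),
        div_lt_one (by positivity)] at h2
      rw [boxNorm_lt_iff hE hL]
      constructor
      · simpa [mul_comm] using h1
      · simpa [mul_comm] using h2
    have hmem : ∀ p ∈ P.filter (fun p => cell p = c), p ∈ P := fun p hp => (Finset.mem_filter.1 hp).1
    refine card_le_of_collinear hE hL hlam hle ?_ hn ?_
    · intro p hp p' hp' hne
      exact hmin _ (hP p (hmem p hp) p' (hmem p' hp')) (sub_ne_zero.2 hne)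
    · intro p hp p' hp' p₀ hp₀
      exact hcol _ (hP _ (hmem _ hp) _ (hmem _ hp₀)) _ (hP _ (hmem _ hp') _ (hmem _ hp₀))
        (hn _ hp _ hp₀) (hn _ hp' _ hp₀)
  have hcard : P.card ≤ ⌊4 * rho / lam⌋₊ * (I ×ˢ I).card :=
    Finset.card_le_mul_card_image_of_maps_to hmaps _ hfib
  have hcI := card_Icc_floor_le hinv
  calc (P.card : ℝ) ≤ (⌊4 * rho / lam⌋₊ : ℝ) * ((I.card : ℝ) * I.card) := by
        rw [Finset.card_product] at hcard; exact_mod_cast hcard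
    _ ≤ (4 * rho / lam) * ((4 * rho⁻¹) * (4 * rho⁻¹)) := by
        gcongr
        exact Nat.floor_le (by positivity)
    _ = 64 / (rho * lam) := by field_simp; norm_num

end Counting

/-! ### Equidistribution over the cosets of a lattice -/

open Classical in
/-- The sum of `f` over the coset `v + Λ`. -/
noncomputable def cosetSum (Λ : AddSubgroup (ℤ × ℤ)) (f : ℤ × ℤ → ℝ) (v : ℤ × ℤ) : ℝ :=
  ∑' p : ℤ × ℤ, if p - v ∈ Λ then f p else 0

/-- `f` is bounded by `A`, `A`-Lipschitz for `boxNorm E L`, and supported in the unit box. -/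
structure IsBoxLipschitz (A E L : ℝ) (f : ℤ × ℤ → ℝ) : Prop where
  bound : ∀ p, |f p| ≤ A
  lipschitz : ∀ p p', |f p - f p'| ≤ A * boxNorm E L (p - p')
  support : ∀ p, f p ≠ 0 → boxNorm E L p ≤ 1

section Coset

variable {A E L : ℝ} {f : ℤ × ℤ → ℝ}

lemma IsBoxLipschitz.nonneg (hf : IsBoxLipschitz A E L f) : 0 ≤ A :=
  (abs_nonneg _).trans (hf.bound 0)

lemma IsBoxLipschitz.finite_support (hf : IsBoxLipschitz A E L f) (hE : 0 < E) (hL : 0 < L) :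
    f.support.Finite :=
  (finite_boxNorm_le hE hL 1).subset fun p hp => hf.support p hp

/-- Either all vectors of `Λ` in the unit box are collinear, or there are two independent ones. -/
lemma exists_covering_radius (hE : 0 < E) (hL : 0 < L) (Λ : AddSubgroup (ℤ × ℤ)) {lam : ℝ}
    (hle : lam ≤ 1) (hmin : ∀ v ∈ Λ, v ≠ 0 → lam ≤ boxNorm E L v) :
    ∃ rho : ℝ, lam ≤ rho ∧ rho ≤ 1 ∧
      (∀ u ∈ Λ, ∀ v ∈ Λ, boxNorm E L u < rho → boxNorm E L v < rho → wedge u v = 0) ∧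
      (rho = 1 ∨ ∀ z : ℤ × ℤ, ∃ u ∈ Λ, boxNorm E L (z - u) ≤ rho) := by
  -- `T` holds the longer members of independent pairs inside the unit box. The least norm on `T` is
  -- the second successive minimum, and serves as `rho` when `T` is nonempty.
  set T : Set (ℤ × ℤ) := {v | boxNorm E L v ≤ 1 ∧ v ∈ Λ ∧
    ∃ u ∈ Λ, boxNorm E L u ≤ boxNorm E L v ∧ wedge u v ≠ 0} with hT
  rcases T.eq_empty_or_nonempty with hemp | hne
  · refine ⟨1, hle, le_rfl, ?_, Or.inl rfl⟩
    intro u hu v hv hu1 hv1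
    by_contra hw
    rcases le_total (boxNorm E L u) (boxNorm E L v) with h | h
    · exact (hemp ▸ (⟨hv1.le, hv, u, hu, h, hw⟩ : v ∈ T) : v ∈ (∅ : Set (ℤ × ℤ)))
    · refine (hemp ▸ (⟨hu1.le, hu, v, hv, h, ?_⟩ : u ∈ T) : u ∈ (∅ : Set (ℤ × ℤ)))
      intro h0
      apply hw
      simp only [wedge] at h0 ⊢
      linarith
  · have hfin : T.Finite := (finite_boxNorm_le hE hL 1).subset fun v hv => hv.1
    obtain ⟨v, hv, hvmin⟩ := Set.exists_min_image T (boxNorm E L) hfin hne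
    obtain ⟨hv1, hvΛ, u, huΛ, huv, hw⟩ := hv
    have hv0 : v ≠ 0 := by
      rintro rfl
      simp [wedge] at hw
    refine ⟨boxNorm E L v, hmin v hvΛ hv0, hv1, ?_, Or.inr ?_⟩
    · intro u' hu' v' hv' hu1 hv1'
      by_contra hw'
      rcases le_total (boxNorm E L u') (boxNorm E L v') with h | h
      · exact absurd (hvmin v' ⟨by linarith, hv', u', hu', h, hw'⟩) (not_le.2 hv1')
      · refine absurd (hvmin u' ⟨by linarith, hu', v', hv', h, ?_⟩) (not_le.2 hu1)
        intro h0
        apply hw'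
        simp only [wedge] at h0 ⊢
        linarith
    · intro z
      have hw' : (u.1 * v.2 - u.2 * v.1 : ℝ) ≠ 0 := by
        have : ((wedge u v : ℤ) : ℝ) ≠ 0 := by exact_mod_cast hw
        simpa [wedge] using this
      set x : ℝ := (z.1 * v.2 - z.2 * v.1) / (u.1 * v.2 - u.2 * v.1) with hx
      set y : ℝ := (u.1 * z.2 - u.2 * z.1) / (u.1 * v.2 - u.2 * v.1) with hy
      have hz1 : (z.1 : ℝ) = x * u.1 + y * v.1 := by
        rw [hx, hy, div_mul_eq_mul_div, div_mul_eq_mul_div, ← add_div, eq_div_iff hw']; ring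
      have hz2 : (z.2 : ℝ) = x * u.2 + y * v.2 := by
        rw [hx, hy, div_mul_eq_mul_div, div_mul_eq_mul_div, ← add_div, eq_div_iff hw']; ring
      -- Rounding the real coordinates of `z` in the basis `u, v` leaves a combination with
      -- coefficients at most `1 / 2`, of norm at most that of the longer vector `v`.
      refine ⟨round x • u + round y • v, Λ.add_mem (Λ.zsmul_mem huΛ _) (Λ.zsmul_mem hvΛ _), ?_⟩
      have hux := (boxNorm_le_iff hE hL).1 huv
      have hvx := (boxNorm_le_iff hE hL (v := v)).1 le_rfl
      have rx := abs_sub_round x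
      have ry := abs_sub_round y
      have key : ∀ s t : ℤ, ∀ r : ℝ, |(s : ℝ)| ≤ r → |(t : ℝ)| ≤ r →
          |(x - round x) * s + (y - round y) * t| ≤ r := by
        intro s t r hs ht
        calc |(x - round x) * s + (y - round y) * t|
            ≤ |(x - round x)| * |(s : ℝ)| + |(y - round y)| * |(t : ℝ)| := by
              rw [← abs_mul, ← abs_mul]; exact abs_add_le _ _
          _ ≤ 1 / 2 * r + 1 / 2 * r := by gcongr
          _ = r := by ring
      rw [boxNorm_le_iff hE hL]
      constructor
      · convert key u.1 v.1 _ hux.1 hvx.1 using 2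
        simp only [Prod.fst_sub, Prod.fst_add, Prod.smul_fst, smul_eq_mul]
        push_cast
        rw [hz1]; ring
      · convert key u.2 v.2 _ hux.2 hvx.2 using 2
        simp only [Prod.snd_sub, Prod.snd_add, Prod.smul_snd, smul_eq_mul]
        push_cast
        rw [hz2]; ring

open Classical in
-- Take `rho` from `exists_covering_radius`. If `Λ` has covering radius at most `rho`, passing from
-- `v` to `v'` amounts to a translation by some `z` of norm at most `rho`. Each of the `O(1 / (rho *
-- lam))` relevant terms then changes by at most `A * rho`, and `rho` cancels. If `rho = 1`,
-- bounding the two sums separately gives the same estimate. Only the first minimum survives in the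
-- bound, and the lattice is arbitrary.
lemma abs_cosetSum_sub_le (hf : IsBoxLipschitz A E L f) (hE : 0 < E) (hL : 0 < L)
    (Λ : AddSubgroup (ℤ × ℤ)) {lam : ℝ} (hlam : 0 < lam) (hle : lam ≤ 1)
    (hmin : ∀ v ∈ Λ, v ≠ 0 → lam ≤ boxNorm E L v) (v v' : ℤ × ℤ) :
    |cosetSum Λ f v - cosetSum Λ f v'| ≤ 128 * A / lam := by
  obtain ⟨rho, hlr, hr1, hcol, hcov⟩ := exists_covering_radius hE hL Λ hle hmin
  have hr0 : 0 < rho := hlam.trans_le hlr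
  have hA := hf.nonneg
  have hfin := finite_boxNorm_le hE hL (1 : ℝ)
  set P : ℤ × ℤ → Finset (ℤ × ℤ) := fun v => hfin.toFinset.filter (fun p => p - v ∈ Λ) with hPdef
  have hPmem : ∀ v p, p ∈ P v ↔ boxNorm E L p ≤ 1 ∧ p - v ∈ Λ := by
    intro v p
    simp [hPdef]
  have hPcard : ∀ v, ((P v).card : ℝ) ≤ 64 / (rho * lam) := by
    intro v
    refine card_coset_box_le hE hL hlam hlr hr1 Λ hmin hcol (fun p hp => ((hPmem v p).1 hp).1) ?_
    intro p hp p' hp'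
    have := Λ.sub_mem ((hPmem v p).1 hp).2 ((hPmem v p').1 hp').2
    simpa using this
  rcases hcov with h1 | hcov
  · have hbound : ∀ v, |cosetSum Λ f v| ≤ 64 * A / lam := by
      intro v
      have hs : cosetSum Λ f v = ∑ p ∈ P v, f p := by
        rw [cosetSum, tsum_eq_sum (s := P v)]
        · exact Finset.sum_congr rfl fun p hp => if_pos ((hPmem v p).1 hp).2
        · intro p hp
          by_contra h
          rw [ite_eq_right_iff, Classical.not_imp] at h
          exact hp ((hPmem v p).2 ⟨hf.support p h.2, h.1⟩)
      rw [hs]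
      calc |∑ p ∈ P v, f p| ≤ ∑ p ∈ P v, |f p| := Finset.abs_sum_le_sum_abs _ _
        _ ≤ (P v).card • A := Finset.sum_le_card_nsmul _ _ _ fun p _ => hf.bound p
        _ = (P v).card * A := nsmul_eq_mul _ _
        _ ≤ (64 / (rho * lam)) * A := by gcongr; exact hPcard v
        _ = 64 * A / lam := by rw [h1]; ring
    calc |cosetSum Λ f v - cosetSum Λ f v'| ≤ |cosetSum Λ f v| + |cosetSum Λ f v'| := abs_sub _ _
      _ ≤ 64 * A / lam + 64 * A / lam := add_le_add (hbound v) (hbound v')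
      _ = 128 * A / lam := by ring
  · obtain ⟨u, hu, hzu⟩ := hcov (v' - v)
    set z := v' - v - u with hz
    have hfs := hf.finite_support hE hL
    have hsum : ∀ v, Summable fun p => if p - v ∈ Λ then f p else 0 := fun v =>
      summable_of_hasFiniteSupport (hfs.subset fun p hp => by
        simp only [Function.mem_support] at hp ⊢; intro h; simp [h] at hp)
    have hshift : cosetSum Λ f v' = ∑' p, if p - v ∈ Λ then f (p + z) else 0 := by
      rw [cosetSum, ← (Equiv.addRight z).tsum_eq]
      refine tsum_congr fun p => ?_
      have hiff : p + z - v' ∈ Λ ↔ p - v ∈ Λ := by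
        have : p + z - v' = (p - v) - u := by rw [hz]; abel
        rw [this]
        exact ⟨fun h => by simpa using Λ.add_mem h hu, fun h => Λ.sub_mem h hu⟩
      simp only [Equiv.coe_addRight, hiff]
    have hsum' : Summable fun p => if p - v ∈ Λ then f (p + z) else 0 := by
      refine summable_of_hasFiniteSupport ((hfs.preimage (add_left_injective z).injOn).subset
        fun p hp => ?_)
      simp only [Function.mem_support, Set.mem_preimage] at hp ⊢
      intro h
      simp [h] at hp
    have hdiff : cosetSum Λ f v - cosetSum Λ f v'
        = ∑' p, if p - v ∈ Λ then f p - f (p + z) else 0 := by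
      rw [hshift, cosetSum, ← (hsum v).tsum_sub hsum']
      refine tsum_congr fun p => ?_
      split_ifs <;> simp
    -- Outside `Q` both `f p` and `f (p + z)` vanish on the coset.
    set Q := P v ∪ (P v').image (fun p => p - z) with hQ
    have hQs : (∑' p, if p - v ∈ Λ then f p - f (p + z) else 0)
        = ∑ p ∈ Q, if p - v ∈ Λ then f p - f (p + z) else 0 := by
      refine tsum_eq_sum fun p hp => ?_
      rw [hQ, Finset.mem_union, not_or] at hp
      by_contra h
      rw [ite_eq_right_iff, Classical.not_imp] at h
      obtain ⟨hpv, hne⟩ := h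
      have h1 : f p = 0 := by
        by_contra h
        exact hp.1 ((hPmem v p).2 ⟨hf.support p h, hpv⟩)
      have h2 : f (p + z) = 0 := by
        by_contra h
        refine hp.2 (Finset.mem_image.2 ⟨p + z, (hPmem v' _).2 ⟨hf.support _ h, ?_⟩, by simp⟩)
        have : p + z - v' = (p - v) - u := by rw [hz]; abel
        rw [this]
        exact Λ.sub_mem hpv hu
      exact hne (by rw [h1, h2, sub_zero])
    have hQcard : (Q.card : ℝ) ≤ 64 / (rho * lam) + 64 / (rho * lam) := by
      have : Q.card ≤ (P v).card + (P v').card :=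
        (Finset.card_union_le _ _).trans (Nat.add_le_add_left Finset.card_image_le _)
      have : (Q.card : ℝ) ≤ (P v).card + (P v').card := by exact_mod_cast this
      linarith [hPcard v, hPcard v']
    rw [hdiff, hQs]
    calc |∑ p ∈ Q, if p - v ∈ Λ then f p - f (p + z) else 0|
        ≤ ∑ p ∈ Q, |if p - v ∈ Λ then f p - f (p + z) else 0| := Finset.abs_sum_le_sum_abs _ _
      _ ≤ Q.card • (A * rho) := by
          refine Finset.sum_le_card_nsmul _ _ _ fun p _ => ?_
          split_ifs
          · refine (hf.lipschitz _ _).trans ?_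
            rw [boxNorm_sub_comm, add_sub_cancel_left]
            gcongr
          · simpa using mul_nonneg hA hr0.le
      _ = Q.card * (A * rho) := nsmul_eq_mul _ _
      _ ≤ (64 / (rho * lam) + 64 / (rho * lam)) * (A * rho) := by gcongr
      _ = 128 * A / lam := by field_simp; ring

/-- The lattice of `(m, b)` with `t ∣ m` and `c m ≡ b mod q`. -/
def congLattice (t q : ℕ) (c : ℤ) : AddSubgroup (ℤ × ℤ) where
  carrier := {v | (t : ℤ) ∣ v.1 ∧ (q : ℤ) ∣ c * v.1 - v.2}
  zero_mem' := by simp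
  add_mem' := by
    rintro u v ⟨h1, h2⟩ ⟨h3, h4⟩
    refine ⟨dvd_add h1 h3, ?_⟩
    have : c * (u + v).1 - (u + v).2 = (c * u.1 - u.2) + (c * v.1 - v.2) := by
      simp only [Prod.fst_add, Prod.snd_add]; ring
    rw [this]
    exact dvd_add h2 h4
  neg_mem' := by
    rintro v ⟨h1, h2⟩
    refine ⟨by simpa using h1, ?_⟩
    have : c * (-v).1 - (-v).2 = -(c * v.1 - v.2) := by
      simp only [Prod.fst_neg, Prod.snd_neg]; ring
    rw [this]
    exact (dvd_neg).2 h2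

lemma mem_congLattice {t q : ℕ} {c : ℤ} {v : ℤ × ℤ} :
    v ∈ congLattice t q c ↔ (t : ℤ) ∣ v.1 ∧ (q : ℤ) ∣ c * v.1 - v.2 := Iff.rfl

lemma dvd_sub_natCast_iff {t : ℕ} (ht : 0 < t) (m : ℤ) {i : ℕ} (hi : i < t) :
    (t : ℤ) ∣ m - i ↔ i = (m % t).toNat := by
  have h1 := Int.emod_nonneg m (by exact_mod_cast ht.ne' : (t : ℤ) ≠ 0)
  have h2 : (i : ℤ) % t = i := Int.emod_eq_of_lt (by positivity) (by exact_mod_cast hi)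
  rw [← Int.modEq_iff_dvd, Int.ModEq, h2]
  omega

/-- The boxes `[0, t) × [0, q)` represent the cosets of `congLattice t q c` exactly once. -/
lemma sum_cosetSum_congLattice {t q : ℕ} (ht : 0 < t) (hq : 0 < q) (c : ℤ)
    (hfin : f.support.Finite) :
    ∑ u ∈ Finset.range t ×ˢ Finset.range q,
      cosetSum (congLattice t q c) f ((u.1 : ℤ), (u.2 : ℤ)) = ∑' p, f p := by
  classical
  unfold cosetSum
  rw [← Summable.tsum_finsetSum]
  · refine tsum_congr fun p => ?_
    set i₀ : ℕ := (p.1 % t).toNat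
    set j₀ : ℕ := ((p.2 - c * (p.1 - i₀)) % q).toNat
    have hi₀ : i₀ < t := by
      have := Int.emod_lt_of_pos p.1 (by exact_mod_cast ht : (0 : ℤ) < t)
      have := Int.emod_nonneg p.1 (by exact_mod_cast ht.ne' : (t : ℤ) ≠ 0)
      omega
    have hj₀ : j₀ < q := by
      have := Int.emod_lt_of_pos (p.2 - c * (p.1 - i₀)) (by exact_mod_cast hq : (0 : ℤ) < q)
      have := Int.emod_nonneg (p.2 - c * (p.1 - i₀)) (by exact_mod_cast hq.ne' : (q : ℤ) ≠ 0)
      omega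
    have hiff : ∀ u ∈ Finset.range t ×ˢ Finset.range q,
        (p - ((u.1 : ℤ), (u.2 : ℤ)) ∈ congLattice t q c ↔ (i₀, j₀) = u) := by
      rintro ⟨i, j⟩ hu
      simp only [Finset.mem_product, Finset.mem_range] at hu
      rw [mem_congLattice, Prod.fst_sub, Prod.snd_sub, dvd_sub_natCast_iff ht p.1 hu.1, Prod.mk.injEq]
      constructor
      · rintro ⟨h1, h2⟩
        refine ⟨h1.symm, ?_⟩
        have h3 : (q : ℤ) ∣ (p.2 - c * (p.1 - i)) - j := by
          obtain ⟨x, hx⟩ := h2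
          exact ⟨-x, by linear_combination -hx⟩
        rw [dvd_sub_natCast_iff hq _ hu.2] at h3
        rw [h3]
        rw [h1]
      · rintro ⟨h1, h2⟩
        refine ⟨h1.symm, ?_⟩
        rw [← h1]
        have h3 : (q : ℤ) ∣ (p.2 - c * (p.1 - i₀)) - j :=
          (dvd_sub_natCast_iff hq _ hu.2).2 h2.symm
        obtain ⟨x, hx⟩ := h3
        exact ⟨-x, by linear_combination -hx⟩
    rw [Finset.sum_congr rfl fun u hu => if_congr (hiff u hu) rfl rfl, Finset.sum_ite_eq,
      if_pos (by simp [hi₀, hj₀])]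
  · intro u _
    exact summable_of_hasFiniteSupport (hfin.subset fun p hp => by
        simp only [Function.mem_support] at hp ⊢; intro h; simp [h] at hp)

/-- Sums over cosets of `congLattice t q c` are close to their average. -/
lemma abs_cosetSum_congLattice_sub_le (hf : IsBoxLipschitz A E L f) (hE : 0 < E) (hL : 0 < L)
    {t q : ℕ} (ht : 0 < t) (hq : 0 < q) (c : ℤ) {lam : ℝ} (hlam : 0 < lam) (hle : lam ≤ 1)
    (hmin : ∀ v ∈ congLattice 1 q c, v ≠ 0 → lam ≤ boxNorm E L v) (v : ℤ × ℤ) :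
    |cosetSum (congLattice t q c) f v - (∑' p, f p) / (t * q)| ≤ 128 * A / lam := by
  have htq : (0 : ℝ) < t * q := by positivity
  -- Adding `t ∣ m` passes to a sublattice, so the minimum for `t = 1` serves every `t` at once.
  have hmin' : ∀ v ∈ congLattice t q c, v ≠ 0 → lam ≤ boxNorm E L v := fun v hv =>
    hmin v ⟨by simp, hv.2⟩
  -- The expected value is the mean of the sums over all `t * q` cosets, so the deviation is a mean
  -- of differences of two coset sums.
  have h1 : cosetSum (congLattice t q c) f v - (∑' p, f p) / (t * q)
      = (∑ u ∈ Finset.range t ×ˢ Finset.range q, (cosetSum (congLattice t q c) f v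
          - cosetSum (congLattice t q c) f ((u.1 : ℤ), (u.2 : ℤ)))) / (t * q) := by
    rw [Finset.sum_sub_distrib, sum_cosetSum_congLattice ht hq c (hf.finite_support hE hL)]
    simp only [Finset.sum_const, Finset.card_product, Finset.card_range, nsmul_eq_mul]
    push_cast
    field_simp
  rw [h1, abs_div, abs_of_pos htq, div_le_iff₀ htq]
  calc _ ≤ ∑ u ∈ Finset.range t ×ˢ Finset.range q, |cosetSum (congLattice t q c) f v
          - cosetSum (congLattice t q c) f ((u.1 : ℤ), (u.2 : ℤ))| := Finset.abs_sum_le_sum_abs _ _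
    _ ≤ (Finset.range t ×ˢ Finset.range q).card • (128 * A / lam) :=
        Finset.sum_le_card_nsmul _ _ _ fun u _ =>
          abs_cosetSum_sub_le hf hE hL _ hlam hle hmin' _ _
    _ = 128 * A / lam * (t * q) := by
        simp only [Finset.card_product, Finset.card_range, nsmul_eq_mul]
        push_cast
        ring

end Coset


/-! ### Jacobi's two-square formula -/

section Jacobi

open GaussianInt Zsqrtd

/-- The Gaussian integers of norm `n`. -/
def normSet (n : ℕ) : Set GaussianInt := {z | z.norm = n}

lemma mem_normSet {n : ℕ} {z : GaussianInt} : z ∈ normSet n ↔ z.norm = n := Iff.rfl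

lemma norm_eq_sq_add_sq (z : GaussianInt) : z.norm = z.re ^ 2 + z.im ^ 2 := by
  rw [Zsqrtd.norm_def]; ring

lemma finite_normSet (n : ℕ) : (normSet n).Finite := by
  have hf : ((fun v : ℤ × ℤ => (⟨v.1, v.2⟩ : GaussianInt)) ''
      (Set.Icc (-(n : ℤ)) n ×ˢ Set.Icc (-(n : ℤ)) n)).Finite :=
    ((Set.finite_Icc _ _).prod (Set.finite_Icc _ _)).image _
  refine hf.subset fun z hz => ⟨(z.re, z.im), ?_, rfl⟩
  rw [mem_normSet, norm_eq_sq_add_sq] at hz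
  simp only [Set.mem_prod, Set.mem_Icc]
  refine ⟨⟨?_, ?_⟩, ?_, ?_⟩ <;> nlinarith [sq_nonneg z.re, sq_nonneg z.im]

lemma r2_eq_ncard_normSet (n : ℕ) : r2 n = (normSet n).ncard := by
  rw [r2]
  have : normSet n = (fun v : ℤ × ℤ => (⟨v.1, v.2⟩ : GaussianInt)) ''
      {v : ℤ × ℤ | v.1 ^ 2 + v.2 ^ 2 = (n : ℤ)} := by
    ext z
    simp only [mem_normSet, norm_eq_sq_add_sq, Set.mem_image, Prod.exists]
    constructor
    · intro h
      exact ⟨z.re, z.im, h, rfl⟩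
    · rintro ⟨x, y, h, rfl⟩
      exact h
  rw [this, Set.ncard_image_of_injective]
  rintro ⟨a, b⟩ ⟨c, d⟩ h
  simpa [Zsqrtd.ext_iff] using h

lemma ncard_image_mul_normSet {c : GaussianInt} (hc : c ≠ 0) (n : ℕ) :
    ((c * ·) '' normSet n).ncard = (normSet n).ncard :=
  Set.ncard_image_of_injective _ (mul_right_injective₀ hc)

lemma image_mul_normSet {c : GaussianInt} {p : ℕ} (hp : 0 < p) (hc : c.norm = p) (n : ℕ) :
    (c * ·) '' normSet n = {z | z ∈ normSet (p * n) ∧ c ∣ z} := by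
  ext z
  constructor
  · rintro ⟨w, hw, rfl⟩
    refine ⟨?_, dvd_mul_right _ _⟩
    rw [mem_normSet] at hw ⊢
    rw [Zsqrtd.norm_mul, hc, hw]
    push_cast
    rfl
  · rintro ⟨hz, w, rfl⟩
    refine ⟨w, ?_, rfl⟩
    rw [mem_normSet, Zsqrtd.norm_mul, hc] at hz
    push_cast at hz
    exact mul_left_cancel₀ (by exact_mod_cast hp.ne') hz

/-- The value `F (n / p)`, read as `0` when `p ∤ n`. -/
noncomputable def quotCount (F : ℕ → ℤ) (p n : ℕ) : ℤ := if p ∣ n then F (n / p) else 0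

/-- Writing `z = p w`, the norm condition becomes `p * norm w = n`: it is solvable only if `p ∣ n`,
and then `w` runs over the elements of norm `n / p`. -/
lemma image_natCast_mul_normSet {p : ℕ} (hp : 0 < p) (n : ℕ) :
    (({z | z ∈ normSet (p * n) ∧ (p : GaussianInt) ∣ z}).ncard : ℤ)
      = quotCount (fun n => (normSet n).ncard) p n := by
  have hp0 : (p : ℤ) ≠ 0 := by exact_mod_cast hp.ne'
  have hpG : (p : GaussianInt) ≠ 0 := by exact_mod_cast hp.ne'
  have hnorm : ∀ w : GaussianInt, ((p : GaussianInt) * w).norm = p * (p * w.norm) := by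
    intro w
    rw [Zsqrtd.norm_mul, Zsqrtd.norm_natCast]
    ring
  rw [quotCount]
  split_ifs with h
  · obtain ⟨m, rfl⟩ := h
    rw [Nat.mul_div_cancel_left _ hp]
    congr 1
    rw [← ncard_image_mul_normSet hpG]
    congr 1
    ext z
    constructor
    · rintro ⟨hz, w, rfl⟩
      refine ⟨w, ?_, rfl⟩
      rw [mem_normSet, hnorm] at hz
      push_cast at hz
      exact mul_left_cancel₀ hp0 (mul_left_cancel₀ hp0 hz)
    · rintro ⟨w, hw, rfl⟩
      refine ⟨?_, dvd_mul_right _ _⟩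
      rw [mem_normSet] at hw ⊢
      rw [hnorm, hw]
      push_cast
      rfl
  · rw [Nat.cast_eq_zero, Set.ncard_eq_zero ((finite_normSet (p * n)).subset fun z hz => hz.1)]
    rw [Set.eq_empty_iff_forall_notMem]
    rintro z ⟨hz, w, rfl⟩
    rw [mem_normSet, hnorm] at hz
    push_cast at hz
    have := mul_left_cancel₀ hp0 hz
    exact h (by exact_mod_cast (Dvd.intro _ this : (p : ℤ) ∣ n))

lemma mul_star_eq_of_mem_normSet {n : ℕ} {z : GaussianInt} (hz : z ∈ normSet n) :
    z * star z = n := by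
  rw [← Zsqrtd.norm_eq_mul_conj, hz]
  simp

lemma prime_of_norm_eq_prime {c : GaussianInt} {p : ℕ} (hp : p.Prime) (hc : c.norm = p) :
    Prime c := by
  rw [← irreducible_iff_prime]
  have hunit : ∀ x : GaussianInt, IsUnit x ↔ x.norm.natAbs = 1 := fun x =>
    (Zsqrtd.norm_eq_one_iff).symm
  refine ⟨?_, ?_⟩
  · rw [hunit, hc]
    simpa using hp.one_lt.ne'
  · intro a b hab
    rw [hunit, hunit]
    have : a.norm.natAbs * b.norm.natAbs = p := by
      rw [← Int.natAbs_mul, ← Zsqrtd.norm_mul, ← hab, hc]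
      simp
    rcases (Nat.dvd_prime hp).1 (Dvd.intro _ this) with h | h
    · exact Or.inl h
    · right
      rw [h] at this
      exact Nat.eq_of_mul_eq_mul_left hp.pos (by simpa using this)

/-- The recursion for the number of Gaussian integers of given norm. -/
lemma ncard_normSet_prime_mul {p : ℕ} (hp : p.Prime) (n : ℕ) :
    ((normSet (p * n)).ncard : ℤ) = (1 + ZMod.χ₄ p) * (normSet n).ncard
      - ZMod.χ₄ p * quotCount (fun n => (normSet n).ncard) p n := by
  have := Fact.mk hp
  have hfin := finite_normSet (p * n)
  rw [← image_natCast_mul_normSet hp.pos]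
  rcases hp.eq_two_or_odd with rfl | hodd
  -- The ramified prime: an element of even norm has coordinates of equal parity, so it is divisible
  -- by `1 + i`, and division by `1 + i` is a bijection onto norm `n`.
  · have hχ : ZMod.χ₄ ((2 : ℕ) : ZMod 4) = 0 := by decide
    rw [hχ]
    have hc : (⟨1, 1⟩ : GaussianInt).norm = (2 : ℕ) := by simp [Zsqrtd.norm_def]
    have hc0 : (⟨1, 1⟩ : GaussianInt) ≠ 0 := by
      intro h
      simp [h] at hc
    have himg := image_mul_normSet (by norm_num : 0 < 2) hc n
    rw [← ncard_image_mul_normSet hc0 n, himg]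
    simp only [add_zero, one_mul, zero_mul, sub_zero, Nat.cast_inj]
    congr 1
    ext z
    simp only [Set.mem_ofPred_eq, iff_self_and]
    intro hz
    rw [mem_normSet, norm_eq_sq_add_sq] at hz
    have hpar : (z.re + z.im) % 2 = 0 := by
      have h2 : (z.re ^ 2 + z.im ^ 2) % 2 = 0 := by rw [hz]; push_cast; simp
      rw [← Int.even_iff] at h2 ⊢
      have : Even (z.re ^ 2 + z.im ^ 2) ↔ Even (z.re + z.im) := by
        rw [Int.even_add, Int.even_add, Int.even_pow' two_ne_zero, Int.even_pow' two_ne_zero]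
      exact this.1 h2
    refine ⟨⟨(z.re + z.im) / 2, (z.im - z.re) / 2⟩, ?_⟩
    rw [Zsqrtd.ext_iff]
    simp only [Zsqrtd.re_mul, Zsqrtd.im_mul]
    omega
  · rcases (by omega : p % 4 = 1 ∨ p % 4 = 3) with h1 | h3
    -- The split case `p = c * star c`: an element of norm `p * n` is divisible by one of the two
    -- factors, and by both exactly when `p` divides it. Counting the union gives the recursion.
    · rw [ZMod.χ₄_nat_one_mod_four h1]
      obtain ⟨a, b, hab⟩ := Nat.Prime.sq_add_sq (p := p) (by omega)
      set c : GaussianInt := ⟨a, b⟩ with hcdef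
      have hc : c.norm = p := by rw [norm_eq_sq_add_sq]; simp only [hcdef]; exact_mod_cast hab
      have hcs : (star c).norm = p := by rw [Zsqrtd.norm_conj, hc]
      have hcp := prime_of_norm_eq_prime hp hc
      have hcsp := prime_of_norm_eq_prime hp hcs
      have hmul : c * star c = p := mul_star_eq_of_mem_normSet hc
      -- If `star c ∣ c`, then `star c` divides `c + star c = 2 a`; taking norms gives `p ∣ 4 a²`,
      -- so `p ∣ a`, impossible when `a² + b² = p`.
      have hndvd : ¬ star c ∣ c := by
        intro h
        have h2 : star c ∣ ((2 * a : ℤ) : GaussianInt) := by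
          have : ((2 * a : ℤ) : GaussianInt) = c + star c := by
            rw [Zsqrtd.ext_iff]
            simp only [hcdef, Zsqrtd.re_intCast, Zsqrtd.im_intCast, Zsqrtd.re_add, Zsqrtd.im_add,
              Zsqrtd.re_star, Zsqrtd.im_star]
            constructor <;> ring
          rw [this]
          exact dvd_add h (dvd_refl _)
        obtain ⟨w, hw⟩ := h2
        have h3 := congrArg Zsqrtd.norm hw
        rw [Zsqrtd.norm_mul, hcs, Zsqrtd.norm_intCast] at h3
        have h4 : (p : ℤ) ∣ (2 * a) * (2 * a) := ⟨_, h3⟩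
        have h5 : p ∣ (2 * a) * (2 * a) := by exact_mod_cast h4
        have h6 : p ∣ 2 * a := by rcases (Nat.Prime.dvd_mul hp).1 h5 with h | h <;> exact h
        have h7 : p ∣ a := by
          rcases (Nat.Prime.dvd_mul hp).1 h6 with h | h
          · have := Nat.le_of_dvd (by norm_num) h
            have := hp.two_le
            omega
          · exact h
        rcases Nat.eq_zero_or_pos a with h0 | h0
        · rw [h0] at hab
          have hb : p ∣ b := hp.dvd_of_dvd_pow (Dvd.intro_left 1 (by rw [one_mul]; simpa using hab.symm))
          have := Nat.le_of_dvd (Nat.pos_of_ne_zero (by rintro rfl; simp at hab; exact hp.ne_zero hab.symm)) hb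
          nlinarith [hp.one_lt]
        · have := Nat.le_of_dvd h0 h7
          nlinarith [hp.one_lt]
      have hU : normSet (p * n) = (c * ·) '' normSet n ∪ (star c * ·) '' normSet n := by
        rw [image_mul_normSet hp.pos hc, image_mul_normSet hp.pos hcs]
        ext z
        simp only [Set.mem_union, Set.mem_ofPred_eq, ← and_or_left, iff_self_and]
        intro hz
        have h := mul_star_eq_of_mem_normSet hz
        have : c ∣ z * star z := by
          rw [h, Nat.cast_mul, ← hmul, mul_assoc]
          exact dvd_mul_right _ _
        rcases hcp.dvd_or_dvd this with h | ⟨w, hw⟩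
        · exact Or.inl h
        · right
          refine ⟨star w, ?_⟩
          rw [← star_star z, hw, star_mul, mul_comm]
      have hI : (c * ·) '' normSet n ∩ (star c * ·) '' normSet n
          = {z | z ∈ normSet (p * n) ∧ (p : GaussianInt) ∣ z} := by
        rw [image_mul_normSet hp.pos hc, image_mul_normSet hp.pos hcs]
        ext z
        simp only [Set.mem_inter_iff, Set.mem_ofPred_eq]
        constructor
        · rintro ⟨⟨hz, w, rfl⟩, -, hd⟩
          refine ⟨hz, ?_⟩
          rcases hcsp.dvd_or_dvd hd with h | ⟨v, rfl⟩
          · exact absurd h hndvd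
          · rw [← hmul, ← mul_assoc]
            exact dvd_mul_right _ _
        · rintro ⟨hz, hd⟩
          rw [← hmul] at hd
          exact ⟨⟨hz, (dvd_mul_right _ _).trans hd⟩, hz, (dvd_mul_left _ _).trans hd⟩
      have hcard := Set.ncard_union_add_ncard_inter ((c * ·) '' normSet n)
        ((star c * ·) '' normSet n) ((finite_normSet n).image _) ((finite_normSet n).image _)
      rw [← hU, hI, ncard_image_mul_normSet hcp.ne_zero, ncard_image_mul_normSet hcsp.ne_zero]
        at hcard
      have : ((normSet (p * n)).ncard : ℤ)
          + ({z | z ∈ normSet (p * n) ∧ (p : GaussianInt) ∣ z}.ncard : ℤ)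
          = (normSet n).ncard + (normSet n).ncard := by exact_mod_cast hcard
      linarith
    -- The inert case: `p` stays prime and divides `z * star z`, hence divides `z`, so only the
    -- multiples of `p` occur.
    · rw [ZMod.χ₄_nat_three_mod_four h3]
      have hpp := GaussianInt.prime_of_nat_prime_of_mod_four_eq_three p h3
      have : normSet (p * n) = {z | z ∈ normSet (p * n) ∧ (p : GaussianInt) ∣ z} := by
        ext z
        simp only [Set.mem_ofPred_eq, iff_self_and]
        intro hz
        have h := mul_star_eq_of_mem_normSet hz
        have : (p : GaussianInt) ∣ z * star z := by
          rw [h, Nat.cast_mul]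
          exact dvd_mul_right _ _
        rcases hpp.dvd_or_dvd this with h | ⟨w, hw⟩
        · exact h
        · refine ⟨star w, ?_⟩
          rw [← star_star z, hw, star_mul, mul_comm]
          simp
      rw [← this]
      ring

/-- The divisor sum of `χ₄`. -/
noncomputable def chiDivisorSum (n : ℕ) : ℤ := ∑ d ∈ n.divisors, ZMod.χ₄ d

/-- The divisors of `p n` are those of `n` together with their multiples by `p`; the overlap is `p`
times the divisors of `n / p`. Multiplicativity of `χ₄` yields the recursion already satisfied by
the norm counts. -/
lemma chiDivisorSum_prime_mul {p : ℕ} (hp : p.Prime) {n : ℕ} (hn : n ≠ 0) :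
    chiDivisorSum (p * n) = (1 + ZMod.χ₄ p) * chiDivisorSum n
      - ZMod.χ₄ p * quotCount chiDivisorSum p n := by
  have hinj : Function.Injective (p * · : ℕ → ℕ) := mul_right_injective₀ hp.ne_zero
  have hsum : ∀ m : ℕ, ∑ d ∈ m.divisors.image (p * ·), ZMod.χ₄ ((d : ℕ) : ZMod 4)
      = ZMod.χ₄ p * chiDivisorSum m := by
    intro m
    rw [Finset.sum_image hinj.injOn, chiDivisorSum, Finset.mul_sum]
    refine Finset.sum_congr rfl fun d _ => ?_
    rw [Nat.cast_mul, map_mul]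
  have hU : (p * n).divisors = n.divisors ∪ n.divisors.image (p * ·) := by
    ext d
    simp only [Nat.mem_divisors, Finset.mem_union, Finset.mem_image]
    constructor
    · rintro ⟨hd, -⟩
      by_cases hpd : p ∣ d
      · obtain ⟨e, rfl⟩ := hpd
        exact Or.inr ⟨e, ⟨Nat.dvd_of_mul_dvd_mul_left hp.pos hd, hn⟩, rfl⟩
      · exact Or.inl ⟨((hp.coprime_iff_not_dvd.2 hpd).symm).dvd_of_dvd_mul_left hd, hn⟩
    · rintro (⟨hd, -⟩ | ⟨e, ⟨he, -⟩, rfl⟩)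
      · exact ⟨hd.mul_left p, mul_ne_zero hp.ne_zero hn⟩
      · exact ⟨Nat.mul_dvd_mul_left p he, mul_ne_zero hp.ne_zero hn⟩
  have hI : ∑ d ∈ n.divisors ∩ n.divisors.image (p * ·), ZMod.χ₄ ((d : ℕ) : ZMod 4)
      = ZMod.χ₄ p * quotCount chiDivisorSum p n := by
    rw [quotCount]
    split_ifs with h
    · obtain ⟨m, rfl⟩ := h
      rw [Nat.mul_div_cancel_left _ hp.pos, ← hsum]
      congr 1
      ext d
      simp only [Nat.mem_divisors, Finset.mem_inter, Finset.mem_image]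
      constructor
      · rintro ⟨⟨h1, -⟩, e, ⟨-, h0⟩, rfl⟩
        exact ⟨e, ⟨Nat.dvd_of_mul_dvd_mul_left hp.pos h1, by aesop⟩, rfl⟩
      · rintro ⟨e, ⟨he, -⟩, rfl⟩
        exact ⟨⟨Nat.mul_dvd_mul_left p he, hn⟩, e, ⟨he.mul_left p, hn⟩, rfl⟩
    · rw [mul_zero]
      refine Finset.sum_eq_zero fun d hd => ?_
      simp only [Nat.mem_divisors, Finset.mem_inter, Finset.mem_image] at hd
      obtain ⟨⟨h1, -⟩, e, -, rfl⟩ := hd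
      exact absurd ((dvd_mul_right p e).trans h1) h
  have := Finset.sum_union_inter (s₁ := n.divisors) (s₂ := n.divisors.image (p * ·))
    (f := fun d : ℕ => ZMod.χ₄ (d : ZMod 4))
  rw [← hU, hI, hsum] at this
  simp only [chiDivisorSum] at this ⊢
  linarith

lemma ncard_normSet_one : (normSet 1).ncard = 4 := by
  have : normSet 1 = {⟨1, 0⟩, ⟨-1, 0⟩, ⟨0, 1⟩, ⟨0, -1⟩} := by
    ext z
    rw [mem_normSet, norm_eq_sq_add_sq]
    simp only [Set.mem_insert_iff, Set.mem_singleton_iff, Zsqrtd.ext_iff, Nat.cast_one]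
    constructor
    · intro h
      have h1 : z.re ≤ 1 := by nlinarith [sq_nonneg z.im]
      have h2 : -1 ≤ z.re := by nlinarith [sq_nonneg z.im]
      have h3 : z.im ≤ 1 := by nlinarith [sq_nonneg z.re]
      have h4 : -1 ≤ z.im := by nlinarith [sq_nonneg z.re]
      generalize z.re = x at *
      generalize z.im = y at *
      interval_cases x <;> interval_cases y <;> simp_all
    · rintro (⟨h1, h2⟩ | ⟨h1, h2⟩ | ⟨h1, h2⟩ | ⟨h1, h2⟩) <;> rw [h1, h2] <;> norm_num
  rw [this]
  rw [Set.ncard_insert_of_notMem, Set.ncard_insert_of_notMem, Set.ncard_pair] <;>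
    simp [Zsqrtd.ext_iff]

/-- **Jacobi's two-square theorem.** -/
theorem r2_eq_four_mul_sum (n : ℕ) (hn : n ≠ 0) :
    (r2 n : ℤ) = 4 * ∑ d ∈ n.divisors, ZMod.χ₄ d := by
  rw [r2_eq_ncard_normSet]
  change _ = 4 * chiDivisorSum n
  -- Both sides obey one recursion in `p * m`, involving the values at `m` and `m / p`, so strong
  -- induction on stripping the least prime factor suffices.
  induction n using Nat.strong_induction_on with
  | _ n ih =>
    rcases Nat.eq_zero_or_pos (n - 1) with h1 | h1
    · have : n = 1 := by omega
      subst this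
      rw [ncard_normSet_one]
      simp [chiDivisorSum]
    · have hp := Nat.minFac_prime (by omega : n ≠ 1)
      obtain ⟨m, hm⟩ := n.minFac_dvd
      set p := n.minFac
      have hm0 : m ≠ 0 := by rintro rfl; simp at hm; exact hn hm
      have hmn : m < n := by
        rw [hm]
        nlinarith [hp.two_le, Nat.pos_of_ne_zero hm0]
      have hquot : quotCount (fun n => ((normSet n).ncard : ℤ)) p m
          = 4 * quotCount chiDivisorSum p m := by
        rw [quotCount, quotCount]
        split_ifs with h
        · exact ih _ ((Nat.div_le_self _ _).trans_lt hmn)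
            (Nat.div_pos (Nat.le_of_dvd (Nat.pos_of_ne_zero hm0) h) hp.pos).ne'
        · simp
      rw [hm, ncard_normSet_prime_mul hp, chiDivisorSum_prime_mul hp hm0, hquot, ih m hmn hm0]
      ring

end Jacobi


/-! ### The Gauss sum of `x² + y²` -/

lemma sum_range_eq_sum_zmod {p : ℕ} [NeZero p] (F : ZMod p → ℂ) :
    ∑ x ∈ Finset.range p, F (x : ZMod p) = ∑ x : ZMod p, F x := by
  refine Finset.sum_nbij' (fun x => (x : ZMod p)) (fun x => x.val) ?_ ?_ ?_ ?_ ?_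
  · simp
  · intro x _
    simpa using ZMod.val_lt x
  · intro x hx
    exact ZMod.val_cast_of_lt (Finset.mem_range.1 hx)
  · intro x _
    exact ZMod.natCast_zmod_val x
  · intro x _
    rfl

/-- The quadratic exponential sum modulo an odd prime is the Gauss sum of the quadratic character. -/
lemma sum_addChar_sq {p : ℕ} [Fact p.Prime] (hp2 : p ≠ 2) (ψ : AddChar (ZMod p) ℂ) (hψ : ψ ≠ 1) :
    ∑ x : ZMod p, ψ (x ^ 2)
      = gaussSum ((quadraticChar (ZMod p)).ringHomComp (Int.castRingHom ℂ)) ψ := by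
  have hchar : ringChar (ZMod p) ≠ 2 := by rwa [ZMod.ringChar_zmod_n]
  have h1 : ∑ x : ZMod p, ψ (x ^ 2)
      = ∑ y : ZMod p, ∑ x : ZMod p with x ^ 2 = y, ψ (x ^ 2) :=
    (Finset.sum_fiberwise _ _ _).symm
  -- The number of square roots of `y` is `1 + quadraticChar y`; the contribution of the `1` is a
  -- complete character sum and vanishes.
  have h2 : ∀ y : ZMod p, ∑ x : ZMod p with x ^ 2 = y, ψ (x ^ 2)
      = ((quadraticChar (ZMod p) y : ℤ) : ℂ) * ψ y + ψ y := by
    intro y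
    rw [Finset.sum_congr rfl fun x hx => by rw [(Finset.mem_filter.1 hx).2], Finset.sum_const,
      nsmul_eq_mul]
    have h3 := quadraticChar_card_sqrts hchar y
    have h4 : (Finset.univ.filter fun x : ZMod p => x ^ 2 = y) = {x : ZMod p | x ^ 2 = y}.toFinset := by
      ext x; simp
    rw [h4]
    have h5 : (({x : ZMod p | x ^ 2 = y}.toFinset.card : ℤ) : ℂ)
        = ((quadraticChar (ZMod p) y + 1 : ℤ) : ℂ) := congrArg _ h3
    push_cast at h5
    rw [h5]
    ring
  rw [h1, Finset.sum_congr rfl fun y _ => h2 y, Finset.sum_add_distrib,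
    AddChar.sum_eq_zero_of_ne_one hψ, add_zero]
  rfl

/-- The double sum is the square of the one-variable quadratic Gauss sum, which equals `χ(-1) p` for
the quadratic character `χ`, and `χ(-1) = χ₄(p)`. Hence the Euler factor in the main term is `1 -
χ₄(p) / p`. -/
theorem gaussSumQ_prime {p : ℕ} (hp : p.Prime) (hp2 : p ≠ 2) :
    gaussSumQ p 1 = (ZMod.χ₄ p : ℂ) * p := by
  have := Fact.mk hp
  have hchar : ringChar (ZMod p) ≠ 2 := by rwa [ZMod.ringChar_zmod_n]
  set ψ := ZMod.stdAddChar (N := p) with hψ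
  have hprim : ψ.IsPrimitive := ZMod.isPrimitive_stdAddChar p
  have hψ1 : ψ ≠ 1 := by
    have := hprim one_ne_zero
    rwa [AddChar.mulShift_one] at this
  have hterm : ∀ x y : ℕ,
      Complex.exp (2 * Real.pi * Complex.I * (((1 : ℤ) : ℂ) * ((x : ℂ) ^ 2 + (y : ℂ) ^ 2)) / p)
        = ψ ((x : ZMod p) ^ 2) * ψ ((y : ZMod p) ^ 2) := by
    intro x y
    rw [← AddChar.map_add_eq_mul]
    have : ((x : ZMod p) ^ 2 + (y : ZMod p) ^ 2) = (((x : ℤ) ^ 2 + (y : ℤ) ^ 2 : ℤ) : ZMod p) := by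
      push_cast; rfl
    rw [this, hψ, ZMod.stdAddChar_coe]
    push_cast
    rw [one_mul]
  rw [gaussSumQ, Finset.sum_congr rfl fun x _ => Finset.sum_congr rfl fun y _ => hterm x y,
    ← Finset.sum_mul_sum, sum_range_eq_sum_zmod (fun x => ψ (x ^ 2)), sum_addChar_sq hp2 ψ hψ1,
    ← sq]
  have hne : (quadraticChar (ZMod p)).ringHomComp (Int.castRingHom ℂ) ≠ 1 := by
    rw [MulChar.ringHomComp_ne_one_iff (RingHom.injective_int _)]
    exact quadraticChar_ne_one hchar
  rw [gaussSum_sq hne ((quadraticChar_isQuadratic (ZMod p)).comp _) hprim, ZMod.card]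
  congr 1
  simp only [MulChar.ringHomComp_apply, quadraticChar_neg_one hchar, ZMod.card]
  rfl


/-! ### The divisor bound -/

/-- The local factor of the divisor bound. Once `p ^ η ≥ 2`, `e + 1 ≤ 2 ^ e` needs no constant. For
smaller `p`, `exp x ≥ 1 + x` makes `p ^ (e η)` at least linear in `e`, and `M` corrects the slope.
-/
lemma succ_le_mul_pow_rpow {η M : ℝ} (hη : 0 < η) (hM : 1 ≤ M) (hM' : 1 ≤ M * (η * Real.log 2))
    {p : ℕ} (hp : 2 ≤ p) (e : ℕ) :
    (e : ℝ) + 1 ≤ (if (p : ℝ) < 2 ^ (1 / η) then M else 1) * ((p : ℝ) ^ e) ^ η := by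
  have hp0 : (0 : ℝ) ≤ p := by positivity
  have hp2 : (2 : ℝ) ≤ p := by exact_mod_cast hp
  rw [← Real.rpow_natCast, ← Real.rpow_mul hp0]
  split_ifs with h
  · have h1 : (1 : ℝ) + e * η * Real.log 2 ≤ (p : ℝ) ^ ((e : ℝ) * η) := by
      calc (1 : ℝ) + e * η * Real.log 2 ≤ Real.exp (Real.log 2 * (e * η)) := by
            rw [add_comm]
            convert Real.add_one_le_exp (Real.log 2 * (e * η)) using 2
            ring
        _ = 2 ^ ((e : ℝ) * η) := by rw [Real.rpow_def_of_pos two_pos]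
        _ ≤ (p : ℝ) ^ ((e : ℝ) * η) := by gcongr
    have he : (0 : ℝ) ≤ e := by positivity
    nlinarith [mul_le_mul_of_nonneg_left h1 (by linarith : (0 : ℝ) ≤ M),
      mul_le_mul_of_nonneg_left hM' he]
  · rw [not_lt] at h
    have h2 : (2 : ℝ) ≤ (p : ℝ) ^ η := by
      calc (2 : ℝ) = (2 ^ (1 / η)) ^ η := by
            rw [← Real.rpow_mul (by norm_num), one_div, inv_mul_cancel₀ hη.ne', Real.rpow_one]
        _ ≤ (p : ℝ) ^ η := by gcongr
    rw [one_mul, mul_comm, Real.rpow_mul hp0, Real.rpow_natCast]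
    calc (e : ℝ) + 1 ≤ 2 ^ e := by exact_mod_cast Nat.lt_two_pow_self
      _ ≤ ((p : ℝ) ^ η) ^ e := by gcongr

/-- **The divisor bound** `d(n) ≪ n ^ η`. -/
theorem exists_card_divisors_le {η : ℝ} (hη : 0 < η) :
    ∃ C : ℝ, 1 ≤ C ∧ ∀ n : ℕ, n ≠ 0 → (n.divisors.card : ℝ) ≤ C * (n : ℝ) ^ η := by
  have hlog : 0 < Real.log 2 := Real.log_pos one_lt_two
  set M : ℝ := max 1 (1 / (η * Real.log 2)) with hMdef
  have hM : 1 ≤ M := le_max_left _ _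
  have hM' : 1 ≤ M * (η * Real.log 2) := by
    rw [← div_le_iff₀ (by positivity)]
    exact le_max_right _ _
  -- Only the primes below `2 ^ (1 / η)` cost a factor `M`, and there are at most `P` of them
  -- whatever `n` is.
  set P := ⌈(2 : ℝ) ^ (1 / η)⌉₊
  refine ⟨M ^ P, one_le_pow₀ hM, fun n hn => ?_⟩
  have hpr : (n : ℝ) ^ η = ∏ p ∈ n.primeFactors, ((p : ℝ) ^ n.factorization p) ^ η := by
    rw [Real.finsetProd_rpow _ _ fun p _ => by positivity]
    congr 1
    conv_lhs => rw [← Nat.prod_factorization_pow_eq_self hn]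
    rw [Finsupp.prod, Nat.support_factorization]
    push_cast
    rfl
  rw [Nat.card_divisors hn, hpr]
  push_cast
  calc ∏ p ∈ n.primeFactors, ((n.factorization p : ℝ) + 1)
      ≤ ∏ p ∈ n.primeFactors, ((if (p : ℝ) < 2 ^ (1 / η) then M else 1)
          * ((p : ℝ) ^ n.factorization p) ^ η) :=
        Finset.prod_le_prod (fun p _ => by positivity) fun p hp =>
          succ_le_mul_pow_rpow hη hM hM' (Nat.prime_of_mem_primeFactors hp).two_le _
    _ = (∏ p ∈ n.primeFactors, (if (p : ℝ) < 2 ^ (1 / η) then M else 1))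
          * ∏ p ∈ n.primeFactors, ((p : ℝ) ^ n.factorization p) ^ η := Finset.prod_mul_distrib
    _ ≤ _ := by
        gcongr
        rw [Finset.prod_ite, Finset.prod_const, Finset.prod_const_one, mul_one]
        refine pow_le_pow_right₀ hM ?_
        calc _ ≤ (Finset.range P).card := by
              refine Finset.card_le_card fun p hp => ?_
              rw [Finset.mem_filter] at hp
              rw [Finset.mem_range]
              exact Nat.lt_ceil.2 hp.2
          _ = P := Finset.card_range P

lemma two_pow_card_primeFactors_le {q : ℕ} (hq : q ≠ 0) :
    2 ^ q.primeFactors.card ≤ q.divisors.card := by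
  rw [Nat.card_divisors hq, ← Finset.prod_const]
  refine Finset.prod_le_prod' fun p hp => ?_
  have := (Nat.prime_of_mem_primeFactors hp).factorization_pos_of_dvd hq
    (Nat.dvd_of_mem_primeFactors hp)
  omega

/-! ### Products over prime factors -/

/-- The worst set of given size is `{2, …, card + 1}`, whose product telescopes. In the induction
the largest element, being at least `card + 2`, is added last. This elementary bound replaces
Mertens' theorem. -/
lemma inv_card_add_one_le_prod (s : Finset ℕ) (hs : ∀ p ∈ s, 2 ≤ p) :
    ((s.card : ℝ) + 1)⁻¹ ≤ ∏ p ∈ s, (1 - 1 / (p : ℝ)) := by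
  induction s using Finset.induction_on_max with
  | empty => simp
  | insert a s hlt ih =>
    have ha : a ∉ s := fun h => lt_irrefl _ (hlt a h)
    have hcard : s.card + 2 ≤ a := by
      have hsub : s ⊆ Finset.Ico 2 a := fun p hp =>
        Finset.mem_Ico.2 ⟨hs p (Finset.mem_insert_of_mem hp), hlt p hp⟩
      have h1 := Finset.card_le_card hsub
      have h2 := hs a (Finset.mem_insert_self _ _)
      rw [Nat.card_Ico] at h1
      omega
    have hcard' : (s.card : ℝ) + 2 ≤ a := by exact_mod_cast hcard
    rw [Finset.prod_insert ha, Finset.card_insert_of_notMem ha]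
    have ih' := ih fun p hp => hs p (Finset.mem_insert_of_mem hp)
    have hn : (0 : ℝ) ≤ s.card := by positivity
    calc (((s.card + 1 : ℕ) : ℝ) + 1)⁻¹
        = (1 - 1 / ((s.card : ℝ) + 2)) * ((s.card : ℝ) + 1)⁻¹ := by
          push_cast
          have : (s.card : ℝ) + 2 ≠ 0 := by positivity
          have : (s.card : ℝ) + 1 ≠ 0 := by positivity
          field_simp
          ring
      _ ≤ (1 - 1 / (a : ℝ)) * ∏ p ∈ s, (1 - 1 / (p : ℝ)) := by
          have : (1 : ℝ) / a ≤ 1 / ((s.card : ℝ) + 2) := by gcongr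
          have : 1 / ((s.card : ℝ) + 2) ≤ 1 := by
            rw [div_le_one (by positivity)]; linarith
          gcongr
          linarith

lemma prod_one_sub_eq_sum (P : Finset ℕ) (f : ℕ → ℝ) :
    ∏ p ∈ P, (1 - f p) = ∑ s ∈ P.powerset, (-1) ^ s.card * ∏ p ∈ s, f p := by
  simp only [sub_eq_add_neg]
  rw [Finset.prod_one_add]
  refine Finset.sum_congr rfl fun s _ => ?_
  rw [← Finset.prod_const, ← Finset.prod_mul_distrib]
  simp

lemma prod_dvd_int_iff {P : Finset ℕ} (hP : ∀ p ∈ P, p.Prime) (m : ℤ) :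
    ((∏ p ∈ P, p : ℕ) : ℤ) ∣ m ↔ ∀ p ∈ P, (p : ℤ) ∣ m := by
  constructor
  · intro h p hp
    exact (Int.natCast_dvd_natCast.2 (Finset.dvd_prod_of_mem _ hp)).trans h
  · intro h
    rw [Int.natCast_dvd]
    refine Finset.prod_primes_dvd _ (fun p hp => (hP p hp).prime) fun p hp => ?_
    exact Int.natCast_dvd.1 (h p hp)

/-- Inclusion-exclusion for the condition `gcd(m, q) = 1`. -/
lemma ite_gcd_eq_one {q : ℕ} (hq : q ≠ 0) (m : ℤ) :
    (if Int.gcd m q = 1 then (1 : ℝ) else 0)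
      = ∑ s ∈ q.primeFactors.powerset,
          (-1) ^ s.card * (if ((∏ p ∈ s, p : ℕ) : ℤ) ∣ m then 1 else 0) := by
  have h1 : ∀ s ∈ q.primeFactors.powerset,
      (-1 : ℝ) ^ s.card * (if ((∏ p ∈ s, p : ℕ) : ℤ) ∣ m then 1 else 0)
        = (-1) ^ s.card * ∏ p ∈ s, (if (p : ℤ) ∣ m then 1 else 0) := by
    intro s hs
    rw [Finset.prod_ite_zero, Finset.prod_const_one]
    have := prod_dvd_int_iff (P := s) (fun p hp =>
      Nat.prime_of_mem_primeFactors (Finset.mem_powerset.1 hs hp)) m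
    simp only [this]
  rw [Finset.sum_congr rfl h1, ← prod_one_sub_eq_sum]
  split_ifs with h
  · refine (Finset.prod_eq_one fun p hp => ?_).symm
    have : ¬ (p : ℤ) ∣ m := by
      intro hpm
      have h2 : p ∣ Int.gcd m q := by
        rw [Int.gcd_eq_natAbs]
        exact Nat.dvd_gcd (Int.natCast_dvd.1 hpm) (by simpa using Nat.dvd_of_mem_primeFactors hp)
      rw [h] at h2
      exact (Nat.prime_of_mem_primeFactors hp).one_lt.ne' (Nat.dvd_one.1 h2)
    simp [this]
  · obtain ⟨p, hp, hpd⟩ := Nat.exists_prime_and_dvd h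
    have hpq : p ∣ q := hpd.trans (by simpa using Int.gcd_dvd_natAbs_right m q)
    have hpm : (p : ℤ) ∣ m := (Int.natCast_dvd_natCast.2 hpd).trans (Int.gcd_dvd_left m q)
    refine (Finset.prod_eq_zero (Nat.mem_primeFactors.2 ⟨hp, hpq, hq⟩) ?_).symm
    simp [hpm]

/-! ### Sums of `1 / max(|b|, j)` -/

/-- Splitting by which entry is larger, each nonzero `b` or `j` contributes `O(1)`, so the double
sum is linear in `R`, without a logarithm. The pair `(0, 0)` contributes `0⁻¹ = 0`. -/
lemma sum_inv_max_le (R : ℕ) :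
    ∑ b ∈ Finset.Icc (-(R : ℤ)) R, ∑ j ∈ Finset.range (R + 1),
      (max (b.natAbs : ℝ) (j : ℝ))⁻¹ ≤ 9 * R := by
  have hpt : ∀ b ∈ Finset.Icc (-(R : ℤ)) R, ∀ j ∈ Finset.range (R + 1),
      (max (b.natAbs : ℝ) (j : ℝ))⁻¹ ≤ (if j ≤ b.natAbs then (b.natAbs : ℝ)⁻¹ else 0)
        + (if b.natAbs ≤ j then (j : ℝ)⁻¹ else 0) := by
    intro b _ j _
    rcases le_total j b.natAbs with h | h
    · rw [max_eq_left (by exact_mod_cast h), if_pos h]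
      have : (0 : ℝ) ≤ if b.natAbs ≤ j then (j : ℝ)⁻¹ else 0 := by split_ifs <;> positivity
      linarith
    · rw [max_eq_right (by exact_mod_cast h), if_pos h]
      have : (0 : ℝ) ≤ if j ≤ b.natAbs then (b.natAbs : ℝ)⁻¹ else 0 := by split_ifs <;> positivity
      linarith
  have hfirst : ∀ b ∈ Finset.Icc (-(R : ℤ)) R,
      ∑ j ∈ Finset.range (R + 1), (if j ≤ b.natAbs then (b.natAbs : ℝ)⁻¹ else 0)
        ≤ if b = 0 then 0 else 2 := by
    intro b _
    split_ifs with h0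
    · subst h0; simp
    · have hb : (1 : ℝ) ≤ b.natAbs := by exact_mod_cast Int.natAbs_pos.2 h0
      rw [← Finset.sum_filter, Finset.sum_const, nsmul_eq_mul, ← div_eq_mul_inv,
        div_le_iff₀ (by linarith)]
      have : ((Finset.range (R + 1)).filter (· ≤ b.natAbs)).card ≤ b.natAbs + 1 := by
        calc _ ≤ (Finset.range (b.natAbs + 1)).card := Finset.card_le_card fun j hj => by
                simp only [Finset.mem_filter, Finset.mem_range] at hj ⊢; omega
          _ = _ := Finset.card_range _
      have : (((Finset.range (R + 1)).filter (· ≤ b.natAbs)).card : ℝ) ≤ b.natAbs + 1 := by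
        exact_mod_cast this
      linarith
  have hsecond : ∀ j ∈ Finset.range (R + 1),
      ∑ b ∈ Finset.Icc (-(R : ℤ)) R, (if b.natAbs ≤ j then (j : ℝ)⁻¹ else 0)
        ≤ if j = 0 then 0 else 3 := by
    intro j _
    split_ifs with h0
    · subst h0; simp
    · have hj : (1 : ℝ) ≤ j := by exact_mod_cast Nat.pos_of_ne_zero h0
      rw [← Finset.sum_filter, Finset.sum_const, nsmul_eq_mul, ← div_eq_mul_inv,
        div_le_iff₀ (by linarith)]
      have : ((Finset.Icc (-(R : ℤ)) R).filter (fun b => b.natAbs ≤ j)).card ≤ 2 * j + 1 := by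
        calc _ ≤ (Finset.Icc (-(j : ℤ)) j).card := Finset.card_le_card fun b hb => by
                simp only [Finset.mem_filter, Finset.mem_Icc] at hb ⊢; omega
          _ = _ := by rw [Int.card_Icc]; omega
      have : (((Finset.Icc (-(R : ℤ)) R).filter (fun b => b.natAbs ≤ j)).card : ℝ)
          ≤ 2 * j + 1 := by exact_mod_cast this
      linarith
  have hA : ∑ b ∈ Finset.Icc (-(R : ℤ)) R, (if b = 0 then (0 : ℝ) else 2) ≤ 4 * R := by
    have hmem : (0 : ℤ) ∈ Finset.Icc (-(R : ℤ)) R := by simp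
    have h : ∑ b ∈ Finset.Icc (-(R : ℤ)) R, (if b = 0 then (0 : ℝ) else 2)
        = ∑ b ∈ Finset.Icc (-(R : ℤ)) R, ((2 : ℝ) - if b = 0 then 2 else 0) := by
      refine Finset.sum_congr rfl fun b _ => ?_
      split_ifs <;> norm_num
    rw [h, Finset.sum_sub_distrib, Finset.sum_ite_eq', if_pos hmem, Finset.sum_const,
      Int.card_Icc, nsmul_eq_mul]
    have : (((R : ℤ) + 1 - -(R : ℤ)).toNat : ℝ) = 2 * R + 1 := by
      have : ((R : ℤ) + 1 - -(R : ℤ)).toNat = 2 * R + 1 := by omega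
      rw [this]; push_cast; ring
    rw [this]
    linarith
  have hB : ∑ j ∈ Finset.range (R + 1), (if j = 0 then (0 : ℝ) else 3) = 3 * R := by
    rw [Finset.sum_range_succ']
    simp [mul_comm]
  calc _ ≤ ∑ b ∈ Finset.Icc (-(R : ℤ)) R, ∑ j ∈ Finset.range (R + 1),
        ((if j ≤ b.natAbs then (b.natAbs : ℝ)⁻¹ else 0) + (if b.natAbs ≤ j then (j : ℝ)⁻¹ else 0)) :=
        Finset.sum_le_sum fun b hb => Finset.sum_le_sum fun j hj => hpt b hb j hj
    _ = ∑ b ∈ Finset.Icc (-(R : ℤ)) R, ∑ j ∈ Finset.range (R + 1),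
          (if j ≤ b.natAbs then (b.natAbs : ℝ)⁻¹ else 0)
        + ∑ j ∈ Finset.range (R + 1), ∑ b ∈ Finset.Icc (-(R : ℤ)) R,
          (if b.natAbs ≤ j then (j : ℝ)⁻¹ else 0) := by
        rw [Finset.sum_comm (s := Finset.range (R + 1)), ← Finset.sum_add_distrib]
        exact Finset.sum_congr rfl fun b _ => Finset.sum_add_distrib
    _ ≤ 4 * R + 3 * R :=
        add_le_add ((Finset.sum_le_sum hfirst).trans hA) ((Finset.sum_le_sum hsecond).trans hB.le)
    _ ≤ 9 * R := by
        have : (0 : ℝ) ≤ R := by positivity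
        linarith

/-! ### Short vectors on average -/

/-- A shortest nonzero vector of `congLattice 1 q c`, with nonnegative first coordinate. -/
lemma exists_shortest {q : ℕ} (hq : 0 < q) (c : ℤ) {E L : ℝ} (hE : 0 < E) (hL : 0 < L) :
    ∃ v ∈ congLattice 1 q c, v ≠ 0 ∧ 0 ≤ v.1 ∧
      ∀ u ∈ congLattice 1 q c, u ≠ 0 → boxNorm E L v ≤ boxNorm E L u := by
  set v₀ : ℤ × ℤ := ((q : ℤ), 0)
  have hv₀ : v₀ ∈ congLattice 1 q c := ⟨by simp, by simp [v₀]⟩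
  have hv₀0 : v₀ ≠ 0 := by
    intro h
    have := congrArg Prod.fst h
    simp [v₀] at this
    omega
  set T : Set (ℤ × ℤ) := {v | boxNorm E L v ≤ boxNorm E L v₀ ∧ v ∈ congLattice 1 q c ∧ v ≠ 0}
  have hfin : T.Finite := (finite_boxNorm_le hE hL _).subset fun v hv => hv.1
  obtain ⟨v, ⟨hvle, hvm, hv0⟩, hmin⟩ :=
    Set.exists_min_image T (boxNorm E L) hfin ⟨v₀, le_rfl, hv₀, hv₀0⟩
  have hmin' : ∀ u ∈ congLattice 1 q c, u ≠ 0 → boxNorm E L v ≤ boxNorm E L u := by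
    intro u hu hu0
    rcases le_total (boxNorm E L u) (boxNorm E L v₀) with h | h
    · exact hmin u ⟨h, hu, hu0⟩
    · exact hvle.trans h
  rcases le_total 0 v.1 with h | h
  · exact ⟨v, hvm, hv0, h, hmin'⟩
  · exact ⟨-v, neg_mem hvm, neg_ne_zero.2 hv0, by simpa using h, fun u hu hu0 => by
      rw [boxNorm_neg]; exact hmin' u hu hu0⟩

/-- On average over `k`, the shortest vector of `{(m, b) : a k m ≡ b mod q}` is not short. -/
theorem exists_sum_inv_minimum_le {q : ℕ} (hq : 0 < q) {a : ℤ} (ha : Int.gcd a q = 1) {L T D : ℝ}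
    (hL : 0 < L) (hLq : L < q) (hT : 0 < T) (hT1 : T ≤ 1) (K : ℕ) (hD0 : 0 ≤ D)
    (hD : ∀ n : ℕ, n ≠ 0 → (n : ℝ) ≤ 2 * (L * q) → (n.divisors.card : ℝ) ≤ D) :
    ∃ lam : ℕ → ℝ, (∀ k : ℕ, k ≠ 0 → 0 < lam k ∧ lam k ≤ 1 ∧
        ∀ v ∈ congLattice 1 q (a * k), v ≠ 0 → lam k ≤ boxNorm (2 * (L * q) / k) L v) ∧
      ∑ k ∈ Finset.Icc 1 K, (lam k)⁻¹ ≤ K / T + 36 * (D * T * L ^ 2) := by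
  classical
  have hq' : (0 : ℝ) < q := by exact_mod_cast hq
  have hE : ∀ k : ℕ, k ≠ 0 → 0 < 2 * (L * q) / k := fun k hk => by
    have : (0 : ℝ) < k := by exact_mod_cast Nat.pos_of_ne_zero hk
    positivity
  have hex : ∀ k : ℕ, ∃ v : ℤ × ℤ, k ≠ 0 → v ∈ congLattice 1 q (a * k) ∧ v ≠ 0 ∧ 0 ≤ v.1 ∧
      ∀ u ∈ congLattice 1 q (a * k), u ≠ 0 →
        boxNorm (2 * (L * q) / k) L v ≤ boxNorm (2 * (L * q) / k) L u := by
    intro k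
    by_cases hk : k = 0
    · exact ⟨0, fun h => absurd hk h⟩
    · obtain ⟨v, h1, h2, h3, h4⟩ := exists_shortest hq (a * k) (hE k hk) hL
      exact ⟨v, fun _ => ⟨h1, h2, h3, h4⟩⟩
  choose v hv using hex
  set N : ℕ → ℝ := fun k => boxNorm (2 * (L * q) / k) L (v k) with hN
  have hNpos : ∀ k, k ≠ 0 → 0 < N k := fun k hk => boxNorm_pos (hE k hk) hL (hv k hk).2.1
  refine ⟨fun k => min 1 (N k), fun k hk => ⟨lt_min one_pos (hNpos k hk), min_le_left _ _,
    fun u hu hu0 => (min_le_right _ _).trans ((hv k hk).2.2.2 u hu hu0)⟩, ?_⟩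
  -- For the shortest vector `(m, b)` at `k`, the product `n = k m` satisfies `a n ≡ b mod q`, a
  -- condition in which `k` no longer appears.
  set n : ℕ → ℕ := fun k => k * (v k).1.toNat with hn
  set R : ℕ := ⌊2 * T * L⌋₊ with hR
  set short := (Finset.Icc 1 K).filter (fun k => N k < T) with hshort
  have hkey : ∀ k ∈ short, n k ≠ 0 ∧ (n k : ℝ) ≤ 2 * (L * q) ∧ ((q : ℤ) ∣ a * n k - (v k).2) ∧
      (v k).2 ∈ Finset.Icc (-(R : ℤ)) R ∧ n k / q ∈ Finset.range (R + 1) ∧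
      (min 1 (N k))⁻¹ ≤ 2 * L * (max ((v k).2.natAbs : ℝ) ((n k / q : ℕ) : ℝ))⁻¹ := by
    intro k hk
    rw [hshort, Finset.mem_filter, Finset.mem_Icc] at hk
    obtain ⟨⟨hk1, -⟩, hNT⟩ := hk
    have hk0 : k ≠ 0 := by omega
    have hkR : (0 : ℝ) < k := by exact_mod_cast hk1
    obtain ⟨⟨-, hdvd⟩, hne, hpos, -⟩ := hv k hk0
    have hNle := (boxNorm_le_iff (hE k hk0) hL (v := v k) (r := N k)).1 le_rfl
    have hnZ : (n k : ℤ) = k * (v k).1 := by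
      simp only [hn]
      push_cast
      rw [Int.toNat_of_nonneg hpos]
    have hnR : (n k : ℝ) = k * ((v k).1 : ℝ) := by exact_mod_cast hnZ
    have hposR : (0 : ℝ) ≤ (v k).1 := by exact_mod_cast hpos
    have hdvd' : (q : ℤ) ∣ a * n k - (v k).2 := by
      rw [hnZ, ← mul_assoc]; exact hdvd
    have hn_le : (n k : ℝ) ≤ N k * (2 * (L * q)) := by
      have h1 := hNle.1
      rw [abs_of_nonneg hposR] at h1
      rw [hnR]
      calc (k : ℝ) * (v k).1 ≤ k * (N k * (2 * (L * q) / k)) := by gcongr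
        _ = N k * (2 * (L * q)) := by field_simp
    have hb_le : |((v k).2 : ℝ)| ≤ N k * L := hNle.2
    have habs : ((v k).2.natAbs : ℝ) = |((v k).2 : ℝ)| := by
      rw [Nat.cast_natAbs, Int.cast_abs]
    have hbq : (v k).2.natAbs < q := by
      have : ((v k).2.natAbs : ℝ) < q := by
        rw [habs]
        nlinarith
      exact_mod_cast this
    have hbzero : (q : ℤ) ∣ (v k).2 → (v k).2 = 0 := by
      intro h
      by_contra h0
      have := Nat.le_of_dvd (Int.natAbs_pos.2 h0) (Int.natCast_dvd.1 h)
      omega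
    have hn0 : n k ≠ 0 := by
      intro h0
      have h1 : (v k).2 = 0 := by
        apply hbzero
        rw [h0] at hdvd'
        simpa using hdvd'
      have h2 : (v k).1 = 0 := by
        rw [h0] at hnZ
        rcases mul_eq_zero.1 hnZ.symm with h | h
        · omega
        · exact h
      exact hne (Prod.ext h2 h1)
    have hjle : ((n k / q : ℕ) : ℝ) ≤ N k * (2 * L) := by
      calc ((n k / q : ℕ) : ℝ) ≤ (n k : ℝ) / q := Nat.cast_div_le
        _ ≤ N k * (2 * L) := by rw [div_le_iff₀ hq']; linarith
    -- If `b = 0`, then `q ∣ n` because `a` is invertible, and `n > 0` forces `n / q ≥ 1`. So no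
    -- short vector falls on the pair `(0, 0)`.
    have hmaxpos : (0 : ℝ) < max ((v k).2.natAbs : ℝ) ((n k / q : ℕ) : ℝ) := by
      by_cases hb0 : (v k).2 = 0
      · apply lt_max_of_lt_right
        have : q ∣ n k := by
          rw [hb0, sub_zero] at hdvd'
          have hcop : IsCoprime (q : ℤ) a := by
            rw [Int.isCoprime_iff_gcd_eq_one, Int.gcd_comm]; exact ha
          exact_mod_cast hcop.dvd_of_dvd_mul_left hdvd'
        exact_mod_cast Nat.div_pos (Nat.le_of_dvd (Nat.pos_of_ne_zero hn0) this) hq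
      · apply lt_max_of_lt_left
        exact_mod_cast Int.natAbs_pos.2 hb0
    refine ⟨hn0, ?_, hdvd', ?_, ?_, ?_⟩
    · nlinarith [mul_pos hL hq']
    · have : (v k).2.natAbs ≤ R := by
        rw [hR]
        apply Nat.le_floor
        rw [habs]
        nlinarith
      rw [Finset.mem_Icc]; omega
    · have : n k / q ≤ R := by
        rw [hR]
        apply Nat.le_floor
        nlinarith
      rw [Finset.mem_range]; omega
    · rw [min_eq_right (by linarith), ← div_eq_mul_inv, ← one_div,
        div_le_div_iff₀ (hNpos k hk0) hmaxpos, one_mul]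
      apply max_le
      · rw [habs]
        nlinarith [hNpos k hk0]
      · linarith
  -- The value `b` fixes `n` mod `q`, and with `⌊n / q⌋ = j` it fixes `n`. All `k` in the fibre
  -- divide this one `n`.
  have hfib : ∀ b j, ((short.filter (fun k => ((v k).2, n k / q) = (b, j))).card : ℝ) ≤ D := by
    intro b j
    rcases (short.filter (fun k => ((v k).2, n k / q) = (b, j))).eq_empty_or_nonempty with h | ⟨k₀, hk₀⟩
    · rw [h]; simpa using hD0
    · rw [Finset.mem_filter] at hk₀
      obtain ⟨hn0, hnle, hd0, -⟩ := hkey k₀ hk₀.1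
      refine le_trans ?_ (hD (n k₀) hn0 hnle)
      norm_cast
      refine Finset.card_le_card fun k hk => ?_
      rw [Finset.mem_filter] at hk
      obtain ⟨-, -, hd, -⟩ := hkey k hk.1
      have heq := hk.2.trans hk₀.2.symm
      rw [Prod.mk.injEq] at heq
      have hmod : n k % q = n k₀ % q := by
        have h1 : (q : ℤ) ∣ a * ((n k₀ : ℤ) - n k) := by
          have := dvd_sub hd0 hd
          rw [heq.1] at this
          obtain ⟨x, hx⟩ := this
          exact ⟨x, by linear_combination hx⟩
        have hcop : IsCoprime (q : ℤ) a := by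
          rw [Int.isCoprime_iff_gcd_eq_one, Int.gcd_comm]; exact ha
        exact (Nat.modEq_iff_dvd.2 (hcop.dvd_of_dvd_mul_left h1))
      have hnn : n k = n k₀ := by
        rw [← Nat.div_add_mod (n k) q, ← Nat.div_add_mod (n k₀) q, hmod, heq.2]
      rw [Nat.mem_divisors, ← hnn]
      exact ⟨Dvd.intro _ rfl, by rw [hnn]; exact hn0⟩
  have hlong : ∀ k ∈ (Finset.Icc 1 K).filter (fun k => ¬ N k < T), (min 1 (N k))⁻¹ ≤ T⁻¹ := by
    intro k hk
    rw [Finset.mem_filter, not_lt] at hk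
    exact inv_anti₀ hT (le_min hT1 hk.2)
  have hlong' : ∑ k ∈ (Finset.Icc 1 K).filter (fun k => ¬ N k < T), (min 1 (N k))⁻¹ ≤ K / T := by
    calc _ ≤ ((Finset.Icc 1 K).filter (fun k => ¬ N k < T)).card • T⁻¹ :=
          Finset.sum_le_card_nsmul _ _ _ hlong
      _ ≤ K • T⁻¹ := by
          refine nsmul_le_nsmul_left (by positivity) ?_
          simpa using Finset.card_filter_le (Finset.Icc 1 K) (fun k => ¬ N k < T)
      _ = K / T := by rw [nsmul_eq_mul, div_eq_mul_inv]
  have hshort' : ∑ k ∈ short, (min 1 (N k))⁻¹ ≤ 36 * (D * T * L ^ 2) := by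
    set Box := Finset.Icc (-(R : ℤ)) R ×ˢ Finset.range (R + 1)
    have hmaps : ∀ k ∈ short, ((v k).2, n k / q) ∈ Box := fun k hk =>
      Finset.mem_product.2 ⟨(hkey k hk).2.2.2.1, (hkey k hk).2.2.2.2.1⟩
    calc ∑ k ∈ short, (min 1 (N k))⁻¹
        ≤ ∑ k ∈ short, 2 * L * (max ((v k).2.natAbs : ℝ) ((n k / q : ℕ) : ℝ))⁻¹ :=
          Finset.sum_le_sum fun k hk => (hkey k hk).2.2.2.2.2
      _ = ∑ x ∈ Box, ∑ k ∈ short with ((v k).2, n k / q) = x,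
            2 * L * (max ((v k).2.natAbs : ℝ) ((n k / q : ℕ) : ℝ))⁻¹ :=
          (Finset.sum_fiberwise_of_maps_to hmaps _).symm
      _ ≤ ∑ x ∈ Box, D * (2 * L * (max (x.1.natAbs : ℝ) (x.2 : ℝ))⁻¹) := by
          refine Finset.sum_le_sum fun x _ => ?_
          rw [Finset.sum_congr rfl (g := fun _ => 2 * L * (max (x.1.natAbs : ℝ) (x.2 : ℝ))⁻¹)
            fun k hk => by rw [← (Finset.mem_filter.1 hk).2], Finset.sum_const, nsmul_eq_mul]
          gcongr
          exact hfib x.1 x.2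
      _ = D * (2 * L) * ∑ b ∈ Finset.Icc (-(R : ℤ)) R, ∑ j ∈ Finset.range (R + 1),
            (max (b.natAbs : ℝ) (j : ℝ))⁻¹ := by
          rw [Finset.sum_product, Finset.mul_sum]
          refine Finset.sum_congr rfl fun b _ => ?_
          rw [Finset.mul_sum]
          exact Finset.sum_congr rfl fun j _ => by ring
      _ ≤ D * (2 * L) * (9 * (2 * T * L)) := by
          gcongr
          refine (sum_inv_max_le R).trans ?_
          gcongr
          exact Nat.floor_le (by positivity)
      _ = 36 * (D * T * L ^ 2) := by ring
  rw [← Finset.sum_filter_add_sum_filter_not (Finset.Icc 1 K) (fun k => N k < T)]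
  linarith


/-! ### Leibniz's series with a smooth cutoff and a coprimality condition -/

lemma alternating_sum_mem_Icc {a : ℕ → ℝ} (ha : Antitone a) (h0 : ∀ i, 0 ≤ a i) (d m : ℕ) :
    ∑ i ∈ Finset.range d, (-1) ^ i * a (m + i) ∈ Set.Icc 0 (a m) := by
  induction d generalizing m with
  | zero => simp [h0]
  | succ d ih =>
    have h := ih (m + 1)
    have hs : ∑ i ∈ Finset.range (d + 1), (-1) ^ i * a (m + i)
        = a m - ∑ i ∈ Finset.range d, (-1) ^ i * a (m + 1 + i) := by
      rw [Finset.sum_range_succ', add_comm, sub_eq_add_neg, ← Finset.sum_neg_distrib]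
      congr 1
      · simp
      · refine Finset.sum_congr rfl fun i _ => ?_
        rw [pow_succ, show m + (i + 1) = m + 1 + i by ring]
        ring
    rw [hs]
    exact ⟨by linarith [h.2, ha (Nat.le_succ m)], by linarith [h.1]⟩

lemma sum_range_two_mul_chi (F : ℕ → ℝ) (n : ℕ) :
    ∑ k ∈ Finset.range (2 * n), (ZMod.χ₄ k : ℝ) * F k
      = ∑ i ∈ Finset.range n, (-1) ^ i * F (2 * i + 1) := by
  induction n with
  | zero => simp
  | succ n ih =>
    rw [show 2 * (n + 1) = 2 * n + 1 + 1 by ring, Finset.sum_range_succ, Finset.sum_range_succ, ih,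
      Finset.sum_range_succ]
    have h1 : ZMod.χ₄ ((2 * n : ℕ) : ZMod 4) = 0 := by
      rw [ZMod.χ₄_nat_eq_if_mod_four, if_pos (by omega)]
    have h2 : ZMod.χ₄ ((2 * n + 1 : ℕ) : ZMod 4) = (-1) ^ n := by
      rw [ZMod.χ₄_eq_neg_one_pow (by omega)]
      congr 1
      omega
    rw [h1, h2]
    push_cast
    ring

/-- The terms agree with Leibniz's series up to `Y`. Beyond that both tails alternate with
decreasing size, so each lies between `0` and its first term, up to a common sign, and that term is
at most `1 / Y`. -/
lemma abs_sum_chi_sub_pi_div_four_le {U : ℕ → ℝ} (hU : Antitone U) (h0 : ∀ k, 0 ≤ U k)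
    (h1 : ∀ k, U k ≤ 1) {Y : ℝ} (hY : 0 < Y) (hY1 : ∀ k : ℕ, (k : ℝ) ≤ Y → U k = 1) {M : ℕ}
    (hM : ∀ k, M ≤ k → U k = 0) :
    |∑ k ∈ Finset.range M, (ZMod.χ₄ k : ℝ) * (U k / k) - Real.pi / 4| ≤ 2 / Y := by
  -- Chosen so that `2 m + 1` is the first odd number exceeding `Y`.
  set m := ⌊(Y + 1) / 2⌋₊ with hm
  have hm1 : Y < 2 * m + 1 := by
    have := Nat.lt_floor_add_one ((Y + 1) / 2)
    rw [← hm] at this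
    linarith
  have hm2 : (m : ℝ) ≤ (Y + 1) / 2 := Nat.floor_le (by positivity)
  set f : ℕ → ℝ := fun i => U (2 * i + 1) / (2 * i + 1) with hf
  set g : ℕ → ℝ := fun i => 1 / (2 * i + 1) with hg
  have hf_anti : Antitone f := by
    intro i j hij
    simp only [hf]
    have : U (2 * j + 1) ≤ U (2 * i + 1) := hU (by omega)
    have hij' : (i : ℝ) ≤ j := by exact_mod_cast hij
    have := h0 (2 * i + 1)
    gcongr
  have hg_anti : Antitone g := by
    intro i j hij
    simp only [hg]
    gcongr
  have hf0 : ∀ i, 0 ≤ f i := fun i => div_nonneg (h0 _) (by positivity)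
  have hg0 : ∀ i, 0 ≤ g i := fun i => by positivity
  have hgm : g m ≤ 1 / Y := by
    simp only [hg]
    gcongr
  have hfm : f m ≤ 1 / Y := by
    refine le_trans ?_ hgm
    simp only [hf, hg]
    gcongr
    exact h1 _
  have heq : ∀ i < m, f i = g i := by
    intro i hi
    have hi' : (i : ℝ) + 1 ≤ m := by exact_mod_cast hi
    simp only [hf, hg]
    rw [hY1]
    push_cast
    linarith
  have hlim := Real.tendsto_sum_pi_div_four
  have hev : ∀ᶠ n in Filter.atTop, |∑ k ∈ Finset.range M, (ZMod.χ₄ k : ℝ) * (U k / k)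
      - ∑ i ∈ Finset.range n, (-1 : ℝ) ^ i / (2 * i + 1)| ≤ 2 / Y := by
    filter_upwards [Filter.eventually_ge_atTop (M + m)] with n hn
    have hL : ∑ k ∈ Finset.range M, (ZMod.χ₄ k : ℝ) * (U k / k)
        = ∑ i ∈ Finset.range n, (-1) ^ i * f i := by
      have hsub : Finset.range M ⊆ Finset.range (2 * n) := by
        intro k hk
        rw [Finset.mem_range] at hk ⊢
        omega
      rw [Finset.sum_subset hsub, sum_range_two_mul_chi]
      · refine Finset.sum_congr rfl fun i _ => ?_
        simp only [hf]
        push_cast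
        rfl
      · intro k _ hk
        rw [Finset.mem_range, not_lt] at hk
        rw [hM k hk]
        simp
    have hR : ∑ i ∈ Finset.range n, (-1 : ℝ) ^ i / (2 * i + 1)
        = ∑ i ∈ Finset.range n, (-1) ^ i * g i :=
      Finset.sum_congr rfl fun i _ => by simp only [hg]; ring
    obtain ⟨d, rfl⟩ : ∃ d, n = m + d := ⟨n - m, by omega⟩
    rw [hL, hR, Finset.sum_range_add, Finset.sum_range_add,
      Finset.sum_congr rfl fun i hi => by rw [heq i (Finset.mem_range.1 hi)],
      add_sub_add_left_eq_sub]
    have hshift : ∀ a : ℕ → ℝ, ∑ i ∈ Finset.range d, (-1 : ℝ) ^ (m + i) * a (m + i)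
        = (-1) ^ m * ∑ i ∈ Finset.range d, (-1) ^ i * a (m + i) := by
      intro a
      rw [Finset.mul_sum]
      exact Finset.sum_congr rfl fun i _ => by rw [pow_add]; ring
    rw [hshift, hshift, ← mul_sub, abs_mul, abs_pow, abs_neg, abs_one, one_pow, one_mul]
    have e1 := alternating_sum_mem_Icc hf_anti hf0 d m
    have e2 := alternating_sum_mem_Icc hg_anti hg0 d m
    have : 2 / Y = 1 / Y + 1 / Y := by ring
    rw [abs_le]
    constructor <;> linarith [e1.1, e1.2, e2.1, e2.2, hg0 m, hf0 m]
  exact le_of_tendsto ((tendsto_const_nhds.sub hlim).abs) hev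

lemma sum_range_dvd (F : ℕ → ℝ) {M g : ℕ} (hg : 0 < g) (hF : ∀ k, M ≤ k → F k = 0) :
    ∑ k ∈ Finset.range M, (if g ∣ k then F k else 0) = ∑ k ∈ Finset.range M, F (g * k) := by
  rw [← Finset.sum_filter]
  symm
  have hinj : Set.InjOn (g * · : ℕ → ℕ) (Finset.range M) := (mul_right_injective₀ hg.ne').injOn
  rw [← Finset.sum_image (f := F) hinj]
  symm
  refine Finset.sum_subset_zero_on_sdiff ?_ ?_ fun _ _ => rfl
  · intro k hk
    rw [Finset.mem_filter, Finset.mem_range] at hk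
    obtain ⟨hk, c, rfl⟩ := hk
    exact Finset.mem_image.2 ⟨c, Finset.mem_range.2 (by nlinarith), rfl⟩
  · intro k hk
    rw [Finset.mem_sdiff, Finset.mem_image] at hk
    obtain ⟨⟨c, -, rfl⟩, h⟩ := hk
    apply hF
    by_contra hlt
    exact h (Finset.mem_filter.2 ⟨Finset.mem_range.2 (not_le.1 hlt), dvd_mul_right _ _⟩)

lemma abs_chi_le_one (k : ℕ) : |(ZMod.χ₄ k : ℝ)| ≤ 1 := by
  rcases ZMod.isQuadratic_χ₄ (k : ZMod 4) with h | h | h <;> rw [h] <;> simp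

/-- The truncated series for `L(1, χ₄)` restricted to integers prime to `q`. -/
theorem abs_sum_coprime_chi_sub_le {u : ℕ → ℝ} (hu : Antitone u) (h0 : ∀ k, 0 ≤ u k)
    (h1 : ∀ k, u k ≤ 1) {D : ℝ} (hD : 0 < D) (hD1 : ∀ k : ℕ, (k : ℝ) ≤ D → u k = 1) {M : ℕ}
    (hM : ∀ k, M ≤ k → u k = 0) {q : ℕ} (hq : q ≠ 0) :
    |∑ k ∈ Finset.range M, (if Int.gcd k q = 1 then (ZMod.χ₄ k : ℝ) * (u k / k) else 0)
      - Real.pi / 4 * ∏ p ∈ q.primeFactors, (1 - (ZMod.χ₄ p : ℝ) / p)|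
      ≤ 2 ^ q.primeFactors.card * (2 / D) := by
  set P := q.primeFactors
  set g : Finset ℕ → ℕ := fun s => ∏ p ∈ s, p with hg
  have hgpos : ∀ s ∈ P.powerset, 0 < g s := fun s hs => Finset.prod_pos fun p hp =>
    (Nat.prime_of_mem_primeFactors (Finset.mem_powerset.1 hs hp)).pos
  have hsum : ∑ k ∈ Finset.range M, (if Int.gcd k q = 1 then (ZMod.χ₄ k : ℝ) * (u k / k) else 0)
      = ∑ s ∈ P.powerset, (-1) ^ s.card * ((ZMod.χ₄ (g s) : ℝ) / g s *
          ∑ k ∈ Finset.range M, (ZMod.χ₄ k : ℝ) * (u (g s * k) / k)) := by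
    calc _ = ∑ k ∈ Finset.range M, ∑ s ∈ P.powerset,
          (-1) ^ s.card * (if g s ∣ k then (ZMod.χ₄ k : ℝ) * (u k / k) else 0) := by
          refine Finset.sum_congr rfl fun k _ => ?_
          have h := ite_gcd_eq_one hq (k : ℤ)
          rw [← mul_boole, mul_comm, h, Finset.sum_mul]
          refine Finset.sum_congr rfl fun s _ => ?_
          simp only [Int.natCast_dvd_natCast]
          rw [mul_assoc, boole_mul]
      _ = _ := by
          rw [Finset.sum_comm]
          refine Finset.sum_congr rfl fun s hs => ?_
          rw [← Finset.mul_sum, sum_range_dvd (fun k => (ZMod.χ₄ k : ℝ) * (u k / k)) (hgpos s hs)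
            (fun k hk => by rw [hM k hk]; simp), Finset.mul_sum (a := (ZMod.χ₄ (g s) : ℝ) / g s)]
          congr 1
          refine Finset.sum_congr rfl fun k _ => ?_
          push_cast
          rw [map_mul]
          push_cast
          ring
  have hprod : ∏ p ∈ P, (1 - (ZMod.χ₄ p : ℝ) / p)
      = ∑ s ∈ P.powerset, (-1) ^ s.card * ((ZMod.χ₄ (g s) : ℝ) / g s) := by
    rw [prod_one_sub_eq_sum]
    refine Finset.sum_congr rfl fun s _ => ?_
    rw [Finset.prod_div_distrib]
    congr 2
    · simp only [hg]
      push_cast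
      rw [map_prod]
      push_cast
      rfl
    · simp only [hg]
      push_cast
      rfl
  rw [hsum, hprod, Finset.mul_sum, ← Finset.sum_sub_distrib]
  calc _ ≤ ∑ s ∈ P.powerset, |(-1) ^ s.card * ((ZMod.χ₄ (g s) : ℝ) / g s *
          ∑ k ∈ Finset.range M, (ZMod.χ₄ k : ℝ) * (u (g s * k) / k))
          - Real.pi / 4 * ((-1) ^ s.card * ((ZMod.χ₄ (g s) : ℝ) / g s))| :=
        Finset.abs_sum_le_sum_abs _ _
    _ ≤ P.powerset.card • (2 / D) := by
        refine Finset.sum_le_card_nsmul _ _ _ fun s hs => ?_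
        have hgs : (0 : ℝ) < g s := by exact_mod_cast hgpos s hs
        -- Restricting to multiples of `g` scales the cutoff to `D / g`; the loss of `g` in the
        -- error is repaid by the factor `1 / g` in front.
        have hU := abs_sum_chi_sub_pi_div_four_le (U := fun k => u (g s * k))
          (fun i j hij => hu (Nat.mul_le_mul_left _ hij)) (fun k => h0 _) (fun k => h1 _)
          (Y := D / g s) (by positivity) (fun k hk => hD1 _ (by
            rw [le_div_iff₀ hgs] at hk
            push_cast
            linarith)) (M := M) (fun k hk => hM _ (by nlinarith [hgpos s hs]))
        rw [show ∀ x : ℝ, (-1) ^ s.card * ((ZMod.χ₄ (g s) : ℝ) / g s * x)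
            - Real.pi / 4 * ((-1) ^ s.card * ((ZMod.χ₄ (g s) : ℝ) / g s))
            = (-1) ^ s.card * ((ZMod.χ₄ (g s) : ℝ) / g s) * (x - Real.pi / 4) from fun x => by ring,
          abs_mul, abs_mul, abs_pow, abs_neg, abs_one, one_pow, one_mul, abs_div,
          abs_of_pos hgs]
        calc _ ≤ 1 / (g s : ℝ) * (2 / (D / g s)) := by
              gcongr
              exact abs_chi_le_one _
          _ = 2 / D := by field_simp
    _ = 2 ^ P.card * (2 / D) := by
        rw [Finset.card_powerset, nsmul_eq_mul]
        push_cast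
        rfl

/-! ### Riemann sums of Lipschitz functions -/

lemma abs_sum_range_sub_integral_le {f : ℝ → ℝ} {l : ℝ} (hc : Continuous f)
    (hf : ∀ x y, |f x - f y| ≤ l * |x - y|) (n : ℕ) :
    |∑ i ∈ Finset.range n, f i - ∫ x in (0 : ℝ)..n, f x| ≤ n * l := by
  have hl : 0 ≤ l := by
    have := (abs_nonneg _).trans (hf 1 0)
    simpa using this
  have h := intervalIntegral.sum_integral_adjacent_intervals (μ := MeasureTheory.volume) (f := f)
    (a := fun i : ℕ => (i : ℝ)) (n := n) fun k _ => hc.intervalIntegrable _ _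
  simp only [Nat.cast_zero] at h
  rw [← h, ← Finset.sum_sub_distrib]
  calc _ ≤ ∑ i ∈ Finset.range n, |f i - ∫ x in (i : ℝ)..((i + 1 : ℕ) : ℝ), f x| :=
        Finset.abs_sum_le_sum_abs _ _
    _ ≤ (Finset.range n).card • l := by
        refine Finset.sum_le_card_nsmul _ _ _ fun i _ => ?_
        have hconst : f i = ∫ x in (i : ℝ)..((i + 1 : ℕ) : ℝ), f i := by simp
        rw [hconst, ← intervalIntegral.integral_sub (by simp) (hc.intervalIntegrable _ _)]
        have := intervalIntegral.norm_integral_le_of_norm_le_const (a := (i : ℝ))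
          (b := ((i + 1 : ℕ) : ℝ)) (f := fun x => f i - f x) (C := l) fun x hx => by
            rw [Set.uIoc_of_le (by push_cast; linarith)] at hx
            push_cast at hx
            rw [Real.norm_eq_abs]
            refine (hf _ _).trans ?_
            have : |(i : ℝ) - x| ≤ 1 := by
              rw [abs_le]; constructor <;> linarith [hx.1, hx.2]
            nlinarith
        simpa using this
    _ = n * l := by rw [Finset.card_range, nsmul_eq_mul]

/-- The sum over `ℤ` of a compactly supported Lipschitz function is close to its integral. -/
theorem abs_tsum_sub_integral_le {f : ℝ → ℝ} {l R : ℝ} (hR : 0 ≤ R)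
    (hf : ∀ x y, |f x - f y| ≤ l * |x - y|) (hs : ∀ x, R < |x| → f x = 0) :
    |∑' m : ℤ, f m - ∫ x, f x| ≤ (2 * R + 4) * l := by
  have hl : 0 ≤ l := by
    have := (abs_nonneg _).trans (hf 1 0)
    simpa using this
  have hc : Continuous f :=
    (LipschitzWith.of_dist_le_mul (K := l.toNNReal) fun x y => by
      rw [Real.dist_eq, Real.dist_eq, Real.coe_toNNReal _ hl]; exact hf x y).continuous
  set N := ⌈R⌉₊ + 1 with hN
  have hNR : R < N := by
    have := Nat.le_ceil R
    rw [hN]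
    push_cast
    linarith
  have hNR' : (N : ℝ) < R + 2 := by
    have := Nat.ceil_lt_add_one hR
    rw [hN]
    push_cast
    linarith
  have hsum : ∑' m : ℤ, f m = ∑ i ∈ Finset.range (2 * N), f ((i : ℝ) - N) := by
    rw [tsum_eq_sum (s := (Finset.range (2 * N)).image (fun i : ℕ => (i : ℤ) - N))]
    · rw [Finset.sum_image (fun i _ j _ h => by simpa using h)]
      exact Finset.sum_congr rfl fun i _ => by push_cast; rfl
    · intro m hm
      apply hs
      by_contra h
      rw [not_lt] at h
      have h2 : |(m : ℝ)| < N := h.trans_lt hNR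
      rw [abs_lt] at h2
      have h3 : -(N : ℤ) < m := by exact_mod_cast h2.1
      have h4 : m < N := by exact_mod_cast h2.2
      exact hm (Finset.mem_image.2 ⟨(m + N).toNat, Finset.mem_range.2 (by omega), by omega⟩)
  have hintegral : ∫ x, f x = ∫ x in (0 : ℝ)..((2 * N : ℕ) : ℝ), f (x - N) := by
    rw [intervalIntegral.integral_comp_sub_right]
    symm
    apply intervalIntegral.integral_eq_integral_of_support_subset
    intro x hx
    rw [Function.mem_support] at hx
    have : |x| ≤ R := by
      by_contra h
      exact hx (hs x (not_le.1 h))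
    rw [abs_le] at this
    push_cast
    constructor <;> linarith
  rw [hsum, hintegral]
  have := abs_sum_range_sub_integral_le (f := fun x => f (x - N)) (l := l) (by fun_prop)
    (fun x y => by simpa using hf (x - N) (y - N)) (2 * N)
  refine this.trans ?_
  push_cast
  nlinarith


/-! ### Sieved lattice sums -/

open Classical in
/-- The sum of `f(m, b)` over `c m ≡ b mod q` with `gcd(b, q) = 1`. -/
noncomputable def sievedSum (q : ℕ) (c : ℤ) (f : ℤ × ℤ → ℝ) : ℝ :=
  ∑' p : ℤ × ℤ, if Int.gcd p.2 q = 1 ∧ (q : ℤ) ∣ c * p.1 - p.2 then f p else 0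

/-- A common factor of `c` and `q` divides every admissible `b`, contradicting coprimality. This is
how the condition `gcd(k, q) = 1` enters the main term. -/
lemma sievedSum_eq_zero {q : ℕ} {c : ℤ} (hc : Int.gcd c q ≠ 1) (f : ℤ × ℤ → ℝ) :
    sievedSum q c f = 0 := by
  classical
  have : ∀ p : ℤ × ℤ, ¬ (Int.gcd p.2 q = 1 ∧ (q : ℤ) ∣ c * p.1 - p.2) := by
    rintro p ⟨h1, h2⟩
    apply hc
    have h3 : (Int.gcd c q : ℤ) ∣ p.2 := by
      have h4 : (Int.gcd c q : ℤ) ∣ c * p.1 - p.2 := (Int.gcd_dvd_right c q).trans h2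
      exact (dvd_sub_right ((Int.gcd_dvd_left c q).mul_right _)).1 h4
    have h5 : (Int.gcd c q : ℤ) ∣ (Int.gcd p.2 q : ℤ) := Int.dvd_coe_gcd h3 (Int.gcd_dvd_right c q)
    rw [h1] at h5
    exact Nat.dvd_one.1 (by exact_mod_cast h5)
  simp [sievedSum, this]

/-- Transfers the sieve from `b` to `m`, where inclusion-exclusion only changes the modulus `t` of
the lattice. -/
lemma gcd_eq_one_iff_of_dvd_sub {q : ℕ} {c m b : ℤ} (hc : Int.gcd c q = 1)
    (h : (q : ℤ) ∣ c * m - b) : Int.gcd b q = 1 ↔ Int.gcd m q = 1 := by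
  rw [← Int.isCoprime_iff_gcd_eq_one] at hc
  rw [← Int.isCoprime_iff_gcd_eq_one, ← Int.isCoprime_iff_gcd_eq_one]
  obtain ⟨x, hx⟩ := h
  have hb : b = c * m + q * (-x) := by linear_combination -hx
  rw [hb, IsCoprime.add_mul_left_left_iff]
  exact ⟨fun h => h.of_mul_left_right, fun h => hc.mul_left h⟩

/-- Inclusion-exclusion for sieved lattice sums. -/
lemma sievedSum_eq_sum {q : ℕ} (hq : q ≠ 0) {c : ℤ} (hc : Int.gcd c q = 1) {f : ℤ × ℤ → ℝ}
    (hf : f.support.Finite) :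
    sievedSum q c f = ∑ s ∈ q.primeFactors.powerset,
      (-1) ^ s.card * cosetSum (congLattice (∏ p ∈ s, p) q c) f 0 := by
  classical
  unfold sievedSum cosetSum
  simp only [← tsum_mul_left]
  rw [← Summable.tsum_finsetSum]
  · refine tsum_congr fun p => ?_
    simp only [sub_zero, mem_congLattice]
    by_cases h : (q : ℤ) ∣ c * p.1 - p.2
    · simp only [h, and_true, gcd_eq_one_iff_of_dvd_sub hc h]
      have h1 := ite_gcd_eq_one hq p.1
      rw [← mul_boole, mul_comm, h1, Finset.sum_mul]
      refine Finset.sum_congr rfl fun s _ => ?_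
      rw [mul_assoc, boole_mul]
    · simp [h]
  · intro s _
    exact summable_of_hasFiniteSupport (hf.subset fun p hp => by
        simp only [Function.mem_support] at hp ⊢; intro h; simp [h] at hp)

lemma prod_primeFactors_one_sub_inv {q : ℕ} (hq : q ≠ 0) :
    ∏ p ∈ q.primeFactors, (1 - 1 / (p : ℝ)) = (q.totient : ℝ) / q := by
  have h := Nat.totient_eq_mul_prod_factors q
  have h' : ((q.totient : ℚ) : ℝ) = ((q * ∏ p ∈ q.primeFactors, (1 - (p : ℚ)⁻¹) : ℚ) : ℝ) :=
    congrArg _ h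
  push_cast at h'
  have hq' : (q : ℝ) ≠ 0 := by exact_mod_cast hq
  rw [h', mul_div_cancel_left₀ _ hq']
  simp [one_div]

/-! ### Expected values and `χ₄`-twists of sieved sums -/

section Sieved

variable {A E L lam : ℝ} {q : ℕ} {c : ℤ} {f : ℤ × ℤ → ℝ}

lemma prod_pos_of_mem_powerset {s : Finset ℕ} (hs : s ∈ q.primeFactors.powerset) :
    0 < ∏ p ∈ s, p :=
  Finset.prod_pos fun _ hp => (Nat.prime_of_mem_primeFactors (Finset.mem_powerset.1 hs hp)).pos

/-- A sieved lattice sum is close to its expected value. -/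
theorem abs_sievedSum_sub_le (hf : IsBoxLipschitz A E L f) (hE : 0 < E) (hL : 0 < L)
    (hq : q ≠ 0) (hc : Int.gcd c q = 1) (hlam : 0 < lam) (hle : lam ≤ 1)
    (hmin : ∀ v ∈ congLattice 1 q c, v ≠ 0 → lam ≤ boxNorm E L v) :
    |sievedSum q c f - (q.totient : ℝ) / q ^ 2 * ∑' p, f p|
      ≤ 2 ^ q.primeFactors.card * (128 * A / lam) := by
  have hq0 : (q : ℝ) ≠ 0 := by exact_mod_cast hq
  -- Expanding `φ(q) / q` as `∑ (-1) ^ |s| / ∏ s` matches the coset averages term by term, so each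
  -- of the `2 ^ ω(q)` sets costs one coset error.
  have hmain : (q.totient : ℝ) / q ^ 2 * ∑' p, f p = ∑ s ∈ q.primeFactors.powerset,
      (-1) ^ s.card * ((∑' p, f p) / (((∏ p ∈ s, p : ℕ) : ℝ) * q)) := by
    have h1 : (q.totient : ℝ) / q ^ 2 = (∏ p ∈ q.primeFactors, (1 - 1 / (p : ℝ))) / q := by
      rw [prod_primeFactors_one_sub_inv hq]
      field_simp
    rw [h1, prod_one_sub_eq_sum, Finset.sum_div, Finset.sum_mul]
    refine Finset.sum_congr rfl fun s _ => ?_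
    rw [Finset.prod_div_distrib, Finset.prod_const_one]
    push_cast
    ring
  rw [sievedSum_eq_sum hq hc (hf.finite_support hE hL), hmain, ← Finset.sum_sub_distrib]
  refine (Finset.abs_sum_le_sum_abs _ _).trans ?_
  calc _ ≤ q.primeFactors.powerset.card • (128 * A / lam) := by
        refine Finset.sum_le_card_nsmul _ _ _ fun s hs => ?_
        rw [← mul_sub, abs_mul, abs_pow, abs_neg, abs_one, one_pow, one_mul]
        exact abs_cosetSum_congLattice_sub_le hf hE hL (prod_pos_of_mem_powerset hs)
          (Nat.pos_of_ne_zero hq) c hlam hle hmin 0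
    _ = _ := by
        rw [Finset.card_powerset, nsmul_eq_mul]
        push_cast
        rfl

/-- For odd `g`, `g²` is `1` mod `4` and `0` mod `g`; so by the Chinese remainder theorem the
classes of `±g²` mod `4 g` are the multiples of `g` on which `χ₄ = ±1`. -/
lemma chi_mul_ite_dvd {g : ℕ} (hg : Odd g) (m : ℤ) :
    (if (g : ℤ) ∣ m then (ZMod.χ₄ m : ℝ) else 0)
      = (if ((4 * g : ℕ) : ℤ) ∣ m - (g : ℤ) ^ 2 then 1 else 0)
        - (if ((4 * g : ℕ) : ℤ) ∣ m + (g : ℤ) ^ 2 then 1 else 0) := by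
  have hsq : (g : ℤ) ^ 2 % 4 = 1 := by
    obtain ⟨j, rfl⟩ := hg
    have : ((2 * j + 1 : ℕ) : ℤ) ^ 2 = 4 * ((j : ℤ) ^ 2 + j) + 1 := by push_cast; ring
    omega
  have hcop : IsCoprime (4 : ℤ) g := by
    have : Nat.Coprime 4 g := (Nat.Coprime.pow_left 2 (Nat.coprime_two_left.2 hg) : _)
    exact_mod_cast Nat.isCoprime_iff_coprime.2 this
  have hsplit : ∀ x : ℤ, ((4 * g : ℕ) : ℤ) ∣ x ↔ (4 : ℤ) ∣ x ∧ (g : ℤ) ∣ x := by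
    intro x
    push_cast
    exact ⟨fun h => ⟨(dvd_mul_right _ _).trans h, (dvd_mul_left _ _).trans h⟩,
      fun h => hcop.mul_dvd h.1 h.2⟩
  have hg2 : (g : ℤ) ∣ (g : ℤ) ^ 2 := dvd_pow_self _ two_ne_zero
  simp only [hsplit, dvd_sub_left hg2, dvd_add_left hg2]
  by_cases h : (g : ℤ) ∣ m
  · simp only [h, and_true, if_true]
    rw [ZMod.χ₄_int_eq_if_mod_four]
    have h4 : m % 4 = 0 ∨ m % 4 = 1 ∨ m % 4 = 2 ∨ m % 4 = 3 := by omega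
    rcases h4 with h4 | h4 | h4 | h4
    · rw [if_pos (by omega), if_neg (by omega), if_neg (by omega)]; simp
    · rw [if_neg (by omega), if_pos (by omega), if_pos (by omega), if_neg (by omega)]; simp
    · rw [if_pos (by omega), if_neg (by omega), if_neg (by omega)]; simp
    · rw [if_neg (by omega), if_neg (by omega), if_neg (by omega), if_pos (by omega)]; simp
  · simp [h]

/-- Twisting by `χ₄` in the first variable removes the main term. -/
theorem abs_sievedSum_chi_le (hf : IsBoxLipschitz A E L f) (hE : 0 < E) (hL : 0 < L)
    (hq : Odd q) (hc : Int.gcd c q = 1) (hlam : 0 < lam) (hle : lam ≤ 1)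
    (hmin : ∀ v ∈ congLattice 1 q c, v ≠ 0 → lam ≤ boxNorm E L v) :
    |sievedSum q c (fun p => (ZMod.χ₄ p.1 : ℝ) * f p)|
      ≤ 2 ^ q.primeFactors.card * (128 * A / lam) := by
  classical
  have hq0 : q ≠ 0 := by rintro rfl; simp at hq
  have hfin := hf.finite_support hE hL
  rw [sievedSum_eq_sum hq0 hc (hfin.subset fun p hp => by
    simp only [Function.mem_support] at hp ⊢; intro h; simp [h] at hp)]
  refine (Finset.abs_sum_le_sum_abs _ _).trans ?_
  calc _ ≤ q.primeFactors.powerset.card • (128 * A / lam) := by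
        refine Finset.sum_le_card_nsmul _ _ _ fun s hs => ?_
        rw [abs_mul, abs_pow, abs_neg, abs_one, one_pow, one_mul]
        set g := ∏ p ∈ s, p with hg
        have hgodd : Odd g := by
          have : g ∣ q := (Finset.prod_dvd_prod_of_subset _ _ _ (Finset.mem_powerset.1 hs)).trans
            (Nat.prod_primeFactors_dvd q)
          exact hq.of_dvd_nat this
        -- The second coordinate makes `v` satisfy the congruence mod `q`, so the cosets of `±v`
        -- differ from the lattice only in the condition mod `4 g`. The twisted sum is then a
        -- difference of two coset sums, with equal expected values.
        set v : ℤ × ℤ := ((g : ℤ) ^ 2, c * (g : ℤ) ^ 2) with hv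
        have hsum : ∀ v, Summable fun p => if p - v ∈ congLattice (4 * g) q c then f p else 0 :=
          fun v => summable_of_hasFiniteSupport (hfin.subset fun p hp => by
            simp only [Function.mem_support] at hp ⊢; intro h; simp [h] at hp)
        have heq : cosetSum (congLattice g q c) (fun p => (ZMod.χ₄ p.1 : ℝ) * f p) 0
            = cosetSum (congLattice (4 * g) q c) f v - cosetSum (congLattice (4 * g) q c) f (-v) := by
          unfold cosetSum
          rw [← (hsum v).tsum_sub (hsum (-v))]
          refine tsum_congr fun p => ?_
          have h1 : p - v ∈ congLattice (4 * g) q c ↔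
              ((4 * g : ℕ) : ℤ) ∣ p.1 - (g : ℤ) ^ 2 ∧ (q : ℤ) ∣ c * p.1 - p.2 := by
            rw [mem_congLattice]
            simp only [hv, Prod.fst_sub, Prod.snd_sub]
            rw [show c * (p.1 - (g : ℤ) ^ 2) - (p.2 - c * (g : ℤ) ^ 2) = c * p.1 - p.2 by ring]
          have h2 : p - -v ∈ congLattice (4 * g) q c ↔
              ((4 * g : ℕ) : ℤ) ∣ p.1 + (g : ℤ) ^ 2 ∧ (q : ℤ) ∣ c * p.1 - p.2 := by
            rw [mem_congLattice]
            simp only [hv, sub_neg_eq_add, Prod.fst_add, Prod.snd_add]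
            rw [show c * (p.1 + (g : ℤ) ^ 2) - (p.2 + c * (g : ℤ) ^ 2) = c * p.1 - p.2 by ring]
          simp only [h1, h2, sub_zero, mem_congLattice]
          by_cases h : (q : ℤ) ∣ c * p.1 - p.2
          · simp only [h, and_true]
            have := congrArg (· * f p) (chi_mul_ite_dvd hgodd p.1)
            simp only [ite_mul, zero_mul, sub_mul, one_mul] at this
            exact this
          · simp [h]
        rw [heq]
        exact abs_cosetSum_sub_le hf hE hL (congLattice (4 * g) q c) hlam hle
          (fun v hv => hmin v ⟨by simp, hv.2⟩) _ _
    _ = _ := by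
        rw [Finset.card_powerset, nsmul_eq_mul]
        push_cast
        rfl

end Sieved


/-! ### The weights -/

/-- The part of `IsWeight` that is used: support, boundedness and a Lipschitz bound. -/
structure IsLipWeight (c X : ℝ) (w : ℝ → ℝ) : Prop where
  support : ∀ x, w x ≠ 0 → X ≤ x ∧ x ≤ 2 * X
  bound : ∀ x, |w x| ≤ 2 * c
  lipschitz : ∀ x y, |w x - w y| ≤ c / X * |x - y|

/-- A bounded Lipschitz function supported in `[-1, 1]`. -/
structure IsLipBump (B : ℝ) (Φ : ℝ → ℝ) : Prop where
  support : ∀ x, Φ x ≠ 0 → |x| ≤ 1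
  bound : ∀ x, |Φ x| ≤ B
  lipschitz : ∀ x y, |Φ x - Φ y| ≤ B * |x - y|

/-- The piecewise linear cutoff equal to `1` on `(-∞, D]` and to `0` on `[2 D, ∞)`. -/
noncomputable def cutoff (D x : ℝ) : ℝ := max 0 (min 1 (2 - x / D))

lemma cutoff_nonneg (D x : ℝ) : 0 ≤ cutoff D x := le_max_left _ _

lemma cutoff_le_one (D x : ℝ) : cutoff D x ≤ 1 := max_le zero_le_one (min_le_left _ _)

lemma cutoff_antitone {D : ℝ} (hD : 0 < D) : Antitone (cutoff D) := by
  intro x y h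
  unfold cutoff
  gcongr

lemma cutoff_eq_one {D x : ℝ} (hD : 0 < D) (h : x ≤ D) : cutoff D x = 1 := by
  have : x / D ≤ 1 := (div_le_one hD).2 h
  rw [cutoff, min_eq_left (by linarith), max_eq_right zero_le_one]

lemma cutoff_eq_zero {D x : ℝ} (hD : 0 < D) (h : 2 * D ≤ x) : cutoff D x = 0 := by
  have : 2 ≤ x / D := (le_div_iff₀ hD).2 h
  rw [cutoff, max_eq_left]
  exact (min_le_right _ _).trans (by linarith)

lemma abs_cutoff_sub_le {D : ℝ} (hD : 0 < D) (x y : ℝ) :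
    |cutoff D x - cutoff D y| ≤ |x - y| / D := by
  unfold cutoff
  calc |max 0 (min 1 (2 - x / D)) - max 0 (min 1 (2 - y / D))|
      ≤ |min 1 (2 - x / D) - min 1 (2 - y / D)| := by
        simpa using abs_max_sub_max_le_max 0 (min 1 (2 - x / D)) 0 (min 1 (2 - y / D))
    _ ≤ |(2 - x / D) - (2 - y / D)| := by
        simpa using abs_min_sub_min_le_max 1 (2 - x / D) 1 (2 - y / D)
    _ = |x - y| / D := by
        rw [show (2 - x / D) - (2 - y / D) = -((x - y) / D) by ring, abs_neg, abs_div,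
          abs_of_pos hD]

section Weights

variable {c X B L : ℝ} {w Φ : ℝ → ℝ}

lemma IsLipWeight.const_nonneg (hw : IsLipWeight c X w) : 0 ≤ c := by
  have := (abs_nonneg _).trans (hw.bound 0)
  linarith

lemma IsLipBump.const_nonneg (hΦ : IsLipBump B Φ) : 0 ≤ B := (abs_nonneg _).trans (hΦ.bound 0)

/-- Products of weights are Lipschitz on the box of size `2 X / k` by `L`. -/
lemma isBoxLipschitz_mul (hc : 0 ≤ c) (hΦ : IsLipBump B Φ) (hX : 0 < X) (hL : 0 < L) {k : ℕ}
    (hk : k ≠ 0) {F : ℤ → ℝ} (hFb : ∀ m, |F m| ≤ 2 * c)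
    (hFs : ∀ m, F m ≠ 0 → 0 ≤ m ∧ (k : ℝ) * m ≤ 2 * X)
    (hFl : ∀ m m' : ℤ, |F m - F m'| ≤ 5 * c * (k / X) * |(m : ℝ) - m'|) :
    IsBoxLipschitz (12 * (c * B)) (2 * X / k) L (fun p => F p.1 * Φ (p.2 / L)) := by
  have hB := hΦ.const_nonneg
  have hk0 : (0 : ℝ) < k := by exact_mod_cast Nat.pos_of_ne_zero hk
  have hcB : 0 ≤ c * B := mul_nonneg hc hB
  refine ⟨fun p => ?_, fun p p' => ?_, fun p hp => ?_⟩
  · rw [abs_mul]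
    calc |F p.1| * |Φ (p.2 / L)| ≤ 2 * c * B :=
          mul_le_mul (hFb _) (hΦ.bound _) (abs_nonneg _) (by positivity)
      _ ≤ 12 * (c * B) := by nlinarith
  · set N := boxNorm (2 * X / k) L (p - p') with hN
    obtain ⟨h1, h2⟩ := (boxNorm_le_iff (by positivity : 0 < 2 * X / k) hL (v := p - p')
      (r := N)).1 le_rfl
    simp only [Prod.fst_sub, Prod.snd_sub, Int.cast_sub] at h1 h2
    have e1 : |F p.1 - F p'.1| ≤ 10 * c * N := by
      calc _ ≤ 5 * c * (k / X) * |(p.1 : ℝ) - p'.1| := hFl _ _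
        _ ≤ 5 * c * (k / X) * (N * (2 * X / k)) := by gcongr
        _ = 10 * c * N := by field_simp; ring
    have e2 : |Φ (p.2 / L) - Φ (p'.2 / L)| ≤ B * N := by
      refine (hΦ.lipschitz _ _).trans ?_
      gcongr
      rw [← sub_div, abs_div, abs_of_pos hL, div_le_iff₀ hL]
      exact h2
    have hN0 : 0 ≤ N := boxNorm_nonneg (by positivity) _
    calc |F p.1 * Φ (p.2 / L) - F p'.1 * Φ (p'.2 / L)|
        = |F p.1 * (Φ (p.2 / L) - Φ (p'.2 / L)) + (F p.1 - F p'.1) * Φ (p'.2 / L)| := by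
          congr 1; ring
      _ ≤ |F p.1| * |Φ (p.2 / L) - Φ (p'.2 / L)| + |F p.1 - F p'.1| * |Φ (p'.2 / L)| := by
          rw [← abs_mul, ← abs_mul]; exact abs_add_le _ _
      -- The slope `5 c k / X` over a side of length `2 X / k` gives `10 c`; with the bound `2 c` on
      -- `F` this explains the constant `12`.
      _ ≤ 2 * c * (B * N) + 10 * c * N * B := by
          gcongr
          · exact hFb _
          · exact hΦ.bound _
      _ = 12 * (c * B) * N := by ring
  · have hF : F p.1 ≠ 0 := fun h => hp (by simp [h])
    have hP : Φ (p.2 / L) ≠ 0 := fun h => hp (by simp [h])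
    obtain ⟨h1, h2⟩ := hFs _ hF
    have h3 := hΦ.support _ hP
    rw [boxNorm_le_iff (by positivity) hL, one_mul, one_mul]
    constructor
    · rw [abs_of_nonneg (by exact_mod_cast h1), le_div_iff₀ hk0]
      linarith
    · rw [abs_div, abs_of_pos hL, div_le_one hL] at h3
      exact h3

lemma IsLipWeight.isBoxLipschitz (hw : IsLipWeight c X w) (hΦ : IsLipBump B Φ) (hX : 0 < X)
    (hL : 0 < L) {k : ℕ} (hk : k ≠ 0) :
    IsBoxLipschitz (12 * (c * B)) (2 * X / k) L (fun p => w (k * p.1) * Φ (p.2 / L)) := by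
  have hk0 : (0 : ℝ) < k := by exact_mod_cast Nat.pos_of_ne_zero hk
  have hc := hw.const_nonneg
  refine isBoxLipschitz_mul (F := fun m => w (k * m)) hc hΦ hX hL hk (fun m => hw.bound _)
    (fun m hm => ?_) fun m m' => ?_
  · obtain ⟨h1, h2⟩ := hw.support _ hm
    refine ⟨?_, h2⟩
    have : (0 : ℝ) < m := by
      by_contra h
      nlinarith
    exact_mod_cast this.le
  · refine (hw.lipschitz _ _).trans ?_
    rw [← mul_sub, abs_mul, abs_of_pos hk0]
    have : 0 ≤ c * (k / X) * |(m : ℝ) - m'| := by positivity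
    calc c / X * (k * |(m : ℝ) - m'|) = c * (k / X) * |(m : ℝ) - m'| := by ring
      _ ≤ _ := by linarith

lemma IsLipWeight.isBoxLipschitz_cutoff (hw : IsLipWeight c X w) (hΦ : IsLipBump B Φ) (hX : 0 < X)
    (hL : 0 < L) {k : ℕ} (hk : k ≠ 0) {D : ℝ} (hD : 0 < D) :
    IsBoxLipschitz (12 * (c * B)) (2 * X / k) L
      (fun p => ((1 - cutoff D p.1) * w (k * p.1)) * Φ (p.2 / L)) := by
  have hk0 : (0 : ℝ) < k := by exact_mod_cast Nat.pos_of_ne_zero hk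
  have hc := hw.const_nonneg
  have hcut : ∀ x, |1 - cutoff D x| ≤ 1 := fun x => by
    rw [abs_le]; constructor <;> linarith [cutoff_nonneg D x, cutoff_le_one D x]
  refine isBoxLipschitz_mul (F := fun m => (1 - cutoff D m) * w (k * m)) hc hΦ hX hL hk
    (fun m => ?_) (fun m hm => ?_) fun m m' => ?_
  · rw [abs_mul]
    calc _ ≤ 1 * (2 * c) := mul_le_mul (hcut _) (hw.bound _) (abs_nonneg _) zero_le_one
      _ = 2 * c := one_mul _
  · obtain ⟨h1, h2⟩ := hw.support (k * m) (fun h => hm (by simp [h]))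
    refine ⟨?_, h2⟩
    have : (0 : ℝ) < m := by
      by_contra h
      nlinarith
    exact_mod_cast this.le
  · have hwl : |w (k * m) - w (k * m')| ≤ c * (k / X) * |(m : ℝ) - m'| := by
      refine (hw.lipschitz _ _).trans_eq ?_
      rw [← mul_sub, abs_mul, abs_of_pos hk0]
      ring
    have h0 : 0 ≤ c * (k / X) * |(m : ℝ) - m'| := by positivity
    -- If `2 D k ≤ X`, then `w (k m) ≠ 0` forces `m ≥ 2 D`, where the cutoff is already `0` and has
    -- no effect. Otherwise its slope `1 / D` is below `2 k / X`, compatible with the box.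
    rcases le_or_gt (2 * D * k) X with h | h
    · have hone : ∀ m : ℤ, (1 - cutoff D m) * w (k * m) = w (k * m) := by
        intro m
        by_cases hm : w (k * m) = 0
        · rw [hm, mul_zero]
        · have := (hw.support _ hm).1
          rw [cutoff_eq_zero hD, sub_zero, one_mul]
          refine le_of_mul_le_mul_right ?_ hk0
          linarith
      rw [hone, hone]
      linarith
    · have hDk : 1 / D ≤ 2 * (k / X) := by
        rw [div_le_iff₀ hD, ← mul_div_assoc, div_mul_eq_mul_div, le_div_iff₀ hX]
        linarith
      have hcl : |(1 - cutoff D m) - (1 - cutoff D m')| ≤ 2 * (k / X) * |(m : ℝ) - m'| := by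
        rw [sub_sub_sub_cancel_left, abs_sub_comm]
        refine (abs_cutoff_sub_le hD _ _).trans ?_
        rw [div_eq_mul_one_div, mul_comm]
        gcongr
      calc |(1 - cutoff D m) * w (k * m) - (1 - cutoff D m') * w (k * m')|
          = |(1 - cutoff D m) * (w (k * m) - w (k * m'))
              + ((1 - cutoff D m) - (1 - cutoff D m')) * w (k * m')| := by congr 1; ring
        _ ≤ |1 - cutoff D m| * |w (k * m) - w (k * m')|
              + |(1 - cutoff D m) - (1 - cutoff D m')| * |w (k * m')| := by
            rw [← abs_mul, ← abs_mul]; exact abs_add_le _ _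
        _ ≤ 1 * (c * (k / X) * |(m : ℝ) - m'|) + 2 * (k / X) * |(m : ℝ) - m'| * (2 * c) := by
            gcongr
            · exact hcut _
            · exact hw.bound _
        _ = 5 * c * (k / X) * |(m : ℝ) - m'| := by ring

end Weights

/-! ### Decomposition of `S` -/

section Decomposition

variable {c X B L : ℝ} {w Φ : ℝ → ℝ}

/-- Summing over the divisors of all `n ≤ M` is summing over pairs with product at most `M`. -/
lemma sum_Icc_sum_divisors (M : ℕ) (H : ℕ → ℕ → ℝ) (hH : ∀ d e, M < d * e → H d e = 0) :
    ∑ n ∈ Finset.Icc 1 M, ∑ d ∈ n.divisors, H d (n / d)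
      = ∑ d ∈ Finset.Icc 1 M, ∑ e ∈ Finset.Icc 1 M, H d e := by
  rw [← Finset.sum_product']
  have h1 : ∑ x ∈ Finset.Icc 1 M ×ˢ Finset.Icc 1 M, H x.1 x.2
      = ∑ x ∈ (Finset.Icc 1 M ×ˢ Finset.Icc 1 M).filter (fun x => x.1 * x.2 ≤ M), H x.1 x.2 := by
    rw [Finset.sum_filter]
    refine Finset.sum_congr rfl fun x _ => ?_
    split_ifs with h
    · rfl
    · exact hH _ _ (not_le.1 h)
  rw [h1, ← Finset.sum_fiberwise_of_maps_to (t := Finset.Icc 1 M) 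
    (g := fun x : ℕ × ℕ => x.1 * x.2)]
  · refine Finset.sum_congr rfl fun n hn => ?_
    rw [Finset.mem_Icc] at hn
    rw [← Nat.sum_divisorsAntidiagonal (f := fun d e => H d e)]
    refine Finset.sum_congr ?_ fun _ _ => rfl
    ext ⟨d, e⟩
    simp only [Nat.mem_divisorsAntidiagonal, Finset.mem_filter, Finset.mem_product, Finset.mem_Icc]
    constructor
    · rintro ⟨rfl, h0⟩
      have hd : 0 < d := Nat.pos_of_ne_zero (by rintro rfl; simp at h0)
      have he : 0 < e := Nat.pos_of_ne_zero (by rintro rfl; simp at h0)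
      refine ⟨⟨⟨⟨hd, ?_⟩, he, ?_⟩, hn.2⟩, rfl⟩ <;> nlinarith
    · rintro ⟨-, rfl⟩
      exact ⟨rfl, by omega⟩
  · intro x hx
    simp only [Finset.mem_filter, Finset.mem_product, Finset.mem_Icc] at hx ⊢
    exact ⟨Nat.mul_pos hx.1.1.1 hx.1.2.1, hx.2⟩

lemma tsum_int_prod_eq_sum (M : ℕ) (T : Finset ℤ) (F : ℤ × ℤ → ℝ)
    (hF : ∀ p, F p ≠ 0 → 1 ≤ p.1 ∧ p.1 ≤ M ∧ p.2 ∈ T) :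
    ∑' p, F p = ∑ m ∈ Finset.Icc 1 M, ∑ b ∈ T, F ((m : ℤ), b) := by
  rw [← Finset.sum_product', tsum_eq_sum
    (s := (Finset.Icc 1 M ×ˢ T).image fun x : ℕ × ℤ => ((x.1 : ℤ), x.2))]
  · rw [Finset.sum_image]
    rintro ⟨a, b⟩ _ ⟨a', b'⟩ _ h
    simpa using h
  · intro p hp
    by_contra h
    obtain ⟨h1, h2, h3⟩ := hF p h
    refine hp (Finset.mem_image.2 ⟨(p.1.toNat, p.2), ?_, ?_⟩)
    · simp only [Finset.mem_product, Finset.mem_Icc]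
      exact ⟨⟨by omega, by omega⟩, h3⟩
    · ext
      · simp; omega
      · rfl

/-- `S` as a sum of sieved lattice sums, by Jacobi's formula and a hyperbola argument. -/
theorem S_eq_sum_sievedSum (hw : IsLipWeight c X w) (hΦ : IsLipBump B Φ) (hX : 0 < X)
    (hL : 0 < L) (q : ℕ) (a : ℤ) (D : ℝ) :
    S Φ w L q a = 4 * ∑ k ∈ Finset.Icc 1 ⌊2 * X⌋₊,
      ((ZMod.χ₄ k : ℝ) * cutoff D k * sievedSum q (a * k) (fun p => w (k * p.1) * Φ (p.2 / L))
        + sievedSum q (a * k)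
          (fun p => (ZMod.χ₄ p.1 : ℝ) * (((1 - cutoff D p.1) * w (k * p.1)) * Φ (p.2 / L)))) := by
  classical
  set M := ⌊2 * X⌋₊ with hM
  set T : Finset ℤ := Finset.Icc (-⌈L⌉) ⌈L⌉ with hT
  have hΦT : ∀ b : ℤ, Φ (b / L) ≠ 0 → b ∈ T := by
    intro b hb
    have := hΦ.support _ hb
    rw [abs_div, abs_of_pos hL, div_le_one hL, abs_le] at this
    have h2 := Int.le_ceil L
    rw [hT, Finset.mem_Icc]
    constructor <;> (rify; linarith [this.1, this.2])
  have hwM : ∀ n : ℕ, w n ≠ 0 → 1 ≤ n ∧ n ≤ M := by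
    intro n hn
    obtain ⟨h1, h2⟩ := hw.support _ hn
    refine ⟨?_, Nat.le_floor h2⟩
    have : (0 : ℝ) < n := by linarith
    exact_mod_cast this
  -- `H d e` depends only on the product `d e`, hence is symmetric; this lets either factor be the
  -- one held fixed.
  set H : ℕ → ℕ → ℝ := fun d e => ∑ b ∈ T,
    if Int.gcd b q = 1 ∧ (q : ℤ) ∣ a * (d * e) - b then w (d * e) * Φ (b / L) else 0 with hH
  have hH0 : ∀ d e, M < d * e → H d e = 0 := by
    intro d e h
    refine Finset.sum_eq_zero fun b _ => ?_
    have : w ((d * e : ℕ) : ℝ) = 0 := by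
      by_contra h'
      have := (hwM _ h').2
      omega
    push_cast at this
    rw [this]; simp
  have hS : S Φ w L q a = 4 * ∑ d ∈ Finset.Icc 1 M, ∑ e ∈ Finset.Icc 1 M, (ZMod.χ₄ d : ℝ) * H d e := by
    have h1 : S Φ w L q a = ∑ b ∈ T, ∑ n ∈ Finset.Icc 1 M,
        if Int.gcd b q = 1 ∧ (q : ℤ) ∣ a * n - b then (r2 n : ℝ) * w n * Φ (b / L) else 0 := by
      unfold S
      rw [tsum_eq_sum (s := T)]
      · refine Finset.sum_congr rfl fun b _ => ?_
        split_ifs with hb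
        · rw [tsum_eq_sum (s := Finset.Icc 1 M), Finset.mul_sum]
          · refine Finset.sum_congr rfl fun n _ => ?_
            have hiff : (n : ℤ) * a ≡ b [ZMOD q] ↔ (q : ℤ) ∣ a * n - b := by
              rw [Int.modEq_comm, Int.modEq_iff_dvd, mul_comm]
            simp only [hiff, hb, true_and]
            split_ifs
            · ring
            · simp
          · intro n hn
            have : w n = 0 := by
              by_contra h
              exact hn (Finset.mem_Icc.2 (hwM n h))
            simp [this]
        · simp [hb]
      · intro b hb
        have : Φ (b / L) = 0 := by
          by_contra h
          exact hb (hΦT b h)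
        simp [this]
    rw [h1, Finset.sum_comm]
    have h2 : ∀ n ∈ Finset.Icc 1 M, (∑ b ∈ T, if Int.gcd b q = 1 ∧ (q : ℤ) ∣ a * n - b then
        (r2 n : ℝ) * w n * Φ (b / L) else 0)
        = 4 * ∑ d ∈ n.divisors, (ZMod.χ₄ d : ℝ) * H d (n / d) := by
      intro n hn
      rw [Finset.mem_Icc] at hn
      have hr : (r2 n : ℝ) = 4 * ∑ d ∈ n.divisors, (ZMod.χ₄ d : ℝ) := by
        have := r2_eq_four_mul_sum n (by omega)
        exact_mod_cast this
      have hHd : ∀ d ∈ n.divisors, H d (n / d) = ∑ b ∈ T,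
          if Int.gcd b q = 1 ∧ (q : ℤ) ∣ a * n - b then w n * Φ (b / L) else 0 := by
        intro d hd
        have hdn : d * (n / d) = n := Nat.mul_div_cancel' (Nat.dvd_of_mem_divisors hd)
        have h3 : (d : ℤ) * ((n / d : ℕ) : ℤ) = n := by exact_mod_cast hdn
        have h4 : (d : ℝ) * ((n / d : ℕ) : ℝ) = n := by exact_mod_cast hdn
        simp only [hH, h3, h4]
      rw [Finset.sum_congr (s₁ := n.divisors) rfl fun d hd => by rw [hHd d hd], ← Finset.sum_mul, ← mul_assoc, ← hr,
        Finset.mul_sum]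
      refine Finset.sum_congr rfl fun b _ => ?_
      split_ifs
      · ring
      · simp
    rw [Finset.sum_congr rfl h2, ← Finset.mul_sum,
      sum_Icc_sum_divisors M (fun d e => (ZMod.χ₄ d : ℝ) * H d e)
        fun d e h => by rw [hH0 d e h, mul_zero]]
  have hpos : ∀ k : ℕ, k ∈ Finset.Icc 1 M → ∀ m : ℤ, w (k * m) ≠ 0 → 1 ≤ m ∧ m ≤ M := by
    intro k hk m hm
    rw [Finset.mem_Icc] at hk
    have hk0 : (1 : ℝ) ≤ k := by exact_mod_cast hk.1
    obtain ⟨h1, h2⟩ := hw.support _ hm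
    have hm0 : (0 : ℝ) < m := by
      by_contra h
      nlinarith
    have hm0' : 0 < m := by exact_mod_cast hm0
    obtain ⟨n, rfl⟩ := Int.eq_ofNat_of_zero_le hm0'.le
    refine ⟨hm0', ?_⟩
    have : n ≤ M := by
      apply Nat.le_floor
      push_cast at h2 hm0
      nlinarith
    exact_mod_cast this
  have hp1 : ∀ k ∈ Finset.Icc 1 M, sievedSum q (a * k) (fun p => w (k * p.1) * Φ (p.2 / L))
      = ∑ e ∈ Finset.Icc 1 M, H k e := by
    intro k hk
    unfold sievedSum
    rw [tsum_int_prod_eq_sum M T]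
    · refine Finset.sum_congr rfl fun e _ => Finset.sum_congr rfl fun b _ => ?_
      simp only [mul_assoc, Int.cast_natCast]
    · intro p hp
      rw [ne_eq, ite_eq_right_iff, Classical.not_imp] at hp
      obtain ⟨-, hp⟩ := hp
      have h1 : w (k * p.1) ≠ 0 := fun h => hp (by simp [h])
      have h2 : Φ (p.2 / L) ≠ 0 := fun h => hp (by simp [h])
      exact ⟨(hpos k hk _ h1).1, (hpos k hk _ h1).2, hΦT _ h2⟩
  have hp2 : ∀ k ∈ Finset.Icc 1 M, sievedSum q (a * k)
      (fun p => (ZMod.χ₄ p.1 : ℝ) * (((1 - cutoff D p.1) * w (k * p.1)) * Φ (p.2 / L)))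
      = ∑ d ∈ Finset.Icc 1 M, (ZMod.χ₄ d : ℝ) * (1 - cutoff D d) * H d k := by
    intro k hk
    unfold sievedSum
    rw [tsum_int_prod_eq_sum M T]
    · refine Finset.sum_congr rfl fun d _ => ?_
      simp only [hH, Finset.mul_sum]
      refine Finset.sum_congr rfl fun b _ => ?_
      simp only [Int.cast_natCast, mul_assoc, mul_comm (d : ℤ) (k : ℤ), mul_comm (d : ℝ) (k : ℝ)]
      split_ifs
      · rfl
      · simp
    · intro p hp
      rw [ne_eq, ite_eq_right_iff, Classical.not_imp] at hp
      obtain ⟨-, hp⟩ := hp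
      have h1 : w (k * p.1) ≠ 0 := fun h => hp (by simp [h])
      have h2 : Φ (p.2 / L) ≠ 0 := fun h => hp (by simp [h])
      exact ⟨(hpos k hk _ h1).1, (hpos k hk _ h1).2, hΦT _ h2⟩
  -- Split `1 = cutoff D d + (1 - cutoff D d)`. The first part fixes `k = d`; in the second the
  -- order of summation is exchanged and `k` is the cofactor of `d`.
  rw [hS, Finset.sum_add_distrib, Finset.sum_congr (s₁ := Finset.Icc 1 M) rfl hp2,
    Finset.sum_comm (s := Finset.Icc 1 M) (t := Finset.Icc 1 M)
      (f := fun k d => (ZMod.χ₄ d : ℝ) * (1 - cutoff D d) * H d k),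
    ← Finset.sum_add_distrib]
  congr 1
  refine Finset.sum_congr rfl fun k hk => ?_
  rw [hp1 k hk, Finset.mul_sum, ← Finset.sum_add_distrib]
  exact Finset.sum_congr rfl fun e _ => by ring

end Decomposition


/-! ### The asymptotic formula with an explicit error term -/

section Core

open MeasureTheory

variable {c X B L : ℝ} {w Φ : ℝ → ℝ}

lemma abs_integral_le_of_support {f : ℝ → ℝ} {a b C : ℝ} (hab : a ≤ b)
    (hs : ∀ x, f x ≠ 0 → x ∈ Set.Icc a b) (hb : ∀ x, |f x| ≤ C) :
    |∫ x, f x| ≤ C * (b - a) := by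
  rw [← setIntegral_eq_integral_of_forall_compl_eq_zero (s := Set.Icc a b) fun x hx => by
    by_contra h; exact hx (hs x h)]
  have := norm_setIntegral_le_of_norm_le_const (μ := volume) (s := Set.Icc a b) (f := f) (C := C)
    (by simp) fun x _ => hb x
  rwa [Real.norm_eq_abs, Measure.real, Real.volume_Icc, ENNReal.toReal_ofReal (by linarith)]
    at this

lemma IsLipWeight.abs_integral_le (hw : IsLipWeight c X w) (hX : 0 < X) :
    |∫ x, w x| ≤ 2 * c * X := by
  have := abs_integral_le_of_support (by linarith : X ≤ 2 * X) (fun x hx => hw.support x hx) hw.bound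
  linarith

lemma IsLipBump.abs_integral_le (hΦ : IsLipBump B Φ) : |∫ x, Φ x| ≤ 2 * B := by
  have := abs_integral_le_of_support (by norm_num : (-1 : ℝ) ≤ 1)
    (fun x hx => abs_le.1 (hΦ.support x hx)) hΦ.bound
  linarith

lemma IsLipWeight.abs_tsum_sub_le (hw : IsLipWeight c X w) (hX : 0 < X) {k : ℕ} (hk : k ≠ 0)
    (hkX : (k : ℝ) ≤ X) : |∑' m : ℤ, w (k * m) - (∫ x, w x) / k| ≤ 8 * c := by
  have hk0 : (0 : ℝ) < k := by exact_mod_cast Nat.pos_of_ne_zero hk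
  have hc := hw.const_nonneg
  have h := abs_tsum_sub_integral_le (f := fun x => w (k * x)) (l := c * k / X) (R := 2 * X / k)
    (by positivity) (fun x y => by
      refine (hw.lipschitz _ _).trans_eq ?_
      rw [← mul_sub, abs_mul, abs_of_pos hk0]
      ring) (fun x hx => by
      by_contra h
      obtain ⟨h1, h2⟩ := hw.support _ h
      rw [div_lt_iff₀ hk0] at hx
      have hx0 : 0 < x := by
        by_contra h'
        nlinarith
      rw [abs_of_pos hx0] at hx
      linarith)
  rw [Measure.integral_comp_mul_left, abs_of_pos (by positivity : (0 : ℝ) < (k : ℝ)⁻¹),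
    smul_eq_mul] at h
  rw [div_eq_inv_mul (∫ x, w x)]
  refine h.trans ?_
  -- The error is support length times slope, of order `(X / k) (c k / X) = c`; the additive `4` is
  -- harmless because `k ≤ X`.
  have : (2 * (2 * X / k) + 4) * (c * k / X) = 4 * c + 4 * c * (k / X) := by
    field_simp
    ring
  rw [this]
  have : (k : ℝ) / X ≤ 1 := (div_le_one hX).2 hkX
  nlinarith

lemma IsLipBump.abs_tsum_sub_le (hΦ : IsLipBump B Φ) (hL : 1 ≤ L) :
    |∑' b : ℤ, Φ (b / L) - L * ∫ x, Φ x| ≤ 6 * B := by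
  have hL0 : 0 < L := by linarith
  have hB := hΦ.const_nonneg
  have h := abs_tsum_sub_integral_le (f := fun x => Φ (x / L)) (l := B / L) (R := L) hL0.le
    (fun x y => by
      refine (hΦ.lipschitz _ _).trans_eq ?_
      rw [← sub_div, abs_div, abs_of_pos hL0]
      ring) (fun x hx => by
      by_contra h
      have := hΦ.support _ h
      rw [abs_div, abs_of_pos hL0, div_le_one hL0] at this
      linarith)
  rw [Measure.integral_comp_div, abs_of_pos hL0, smul_eq_mul] at h
  refine h.trans ?_
  rw [mul_div_assoc', div_le_iff₀ hL0]
  nlinarith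

lemma tsum_weight_mul_bump (hw : IsLipWeight c X w) (hΦ : IsLipBump B Φ) (hX : 0 < X)
    (hL : 0 < L) {k : ℕ} (hk : k ≠ 0) :
    ∑' p : ℤ × ℤ, w (k * p.1) * Φ (p.2 / L) = (∑' m : ℤ, w (k * m)) * ∑' b : ℤ, Φ (b / L) := by
  have hk0 : (0 : ℝ) < k := by exact_mod_cast Nat.pos_of_ne_zero hk
  have h1 : (Function.support fun m : ℤ => w (k * m)).Finite := by
    refine (Set.finite_Icc (0 : ℤ) ⌈2 * X / k⌉).subset fun m hm => ?_
    obtain ⟨h1, h2⟩ := hw.support _ hm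
    have h3 : (m : ℝ) ≤ 2 * X / k := by
      rw [le_div_iff₀ hk0]; linarith
    have h4 : (0 : ℝ) < m := by
      by_contra h
      nlinarith
    exact ⟨by exact_mod_cast h4.le, by exact_mod_cast h3.trans (Int.le_ceil _)⟩
  have h2 : (Function.support fun b : ℤ => Φ (b / L)).Finite := by
    refine (Set.finite_Icc (-⌈L⌉ : ℤ) ⌈L⌉).subset fun b hb => ?_
    have h3 := hΦ.support _ hb
    rw [abs_div, abs_of_pos hL, div_le_one hL, abs_le] at h3
    have h2 := Int.le_ceil L
    constructor <;> (rify; linarith [h3.1, h3.2])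
  symm
  refine tsum_mul_tsum_of_summable_norm (f := fun m : ℤ => w (k * m))
    (g := fun b : ℤ => Φ (b / L)) ?_ ?_
  · exact summable_of_hasFiniteSupport (h1.subset fun m hm => by simpa using hm)
  · exact summable_of_hasFiniteSupport (h2.subset fun m hm => by simpa using hm)

lemma abs_prod_one_sub_chi_le (P : Finset ℕ) :
    |∏ p ∈ P, (1 - (ZMod.χ₄ p : ℝ) / p)| ≤ 2 ^ P.card := by
  rw [Finset.abs_prod, ← Finset.prod_const]
  refine Finset.prod_le_prod (fun _ _ => abs_nonneg _) fun p _ => ?_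
  have h1 := abs_chi_le_one p
  have h2 : |(ZMod.χ₄ p : ℝ) / p| ≤ 1 := by
    rw [abs_div, Nat.abs_cast]
    rcases Nat.eq_zero_or_pos p with rfl | hp
    · simp
    · have : (1 : ℝ) ≤ p := by exact_mod_cast hp
      exact div_le_one_of_le₀ (h1.trans this) (by positivity)
  rw [abs_le] at h2 ⊢
  constructor <;> linarith [h2.1, h2.2]

/-- The sum over the small divisors, weighted by `w`. -/
lemma abs_sum_chi_cutoff_sub_le (hw : IsLipWeight c X w) (hX : 4 ≤ X) {q : ℕ} (hq : q ≠ 0) :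
    |∑ k ∈ Finset.Icc 1 ⌊2 * √X⌋₊, (if Int.gcd k q = 1 then
        (ZMod.χ₄ k : ℝ) * cutoff √X k * ∑' m : ℤ, w (k * m) else 0)
      - (∫ x, w x) * (Real.pi / 4 * ∏ p ∈ q.primeFactors, (1 - (ZMod.χ₄ p : ℝ) / p))|
      ≤ 20 * c * √X * 2 ^ q.primeFactors.card := by
  have hX0 : 0 < X := by linarith
  have hD : 0 < √X := Real.sqrt_pos.2 hX0
  have hDsq : √X * √X = X := Real.mul_self_sqrt hX0.le
  have hD2 : 2 ≤ √X := Real.le_sqrt_of_sq_le (by linarith)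
  have hc := hw.const_nonneg
  set K := ⌊2 * √X⌋₊ with hK
  have hKle : (K : ℝ) ≤ 2 * √X := Nat.floor_le (by positivity)
  set W := ∫ x, w x with hW
  have hWle := hw.abs_integral_le hX0
  have hpow : (1 : ℝ) ≤ 2 ^ q.primeFactors.card := one_le_pow₀ (by norm_num)
  have h1 := abs_sum_coprime_chi_sub_le (u := fun k : ℕ => cutoff √X k)
    (fun i j hij => cutoff_antitone hD (by exact_mod_cast hij)) (fun k => cutoff_nonneg _ _)
    (fun k => cutoff_le_one _ _) hD (fun k hk => cutoff_eq_one hD hk) (M := K + 1)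
    (fun k hk => cutoff_eq_zero hD (Nat.lt_of_floor_lt (by omega)).le) hq
  have hrange : ∑ k ∈ Finset.range (K + 1),
      (if Int.gcd k q = 1 then (ZMod.χ₄ k : ℝ) * (cutoff √X k / k) else 0)
      = ∑ k ∈ Finset.Icc 1 K,
        (if Int.gcd k q = 1 then (ZMod.χ₄ k : ℝ) * (cutoff √X k / k) else 0) := by
    -- The extra term `k = 0` vanishes since division by zero gives `0`.
    rw [Finset.range_eq_Ico, Finset.sum_eq_sum_Ico_succ_bot (by omega)]
    simp only [Nat.cast_zero, div_zero, mul_zero, ite_self, zero_add]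
    rfl
  rw [hrange] at h1
  have h2 : |∑ k ∈ Finset.Icc 1 K, (if Int.gcd k q = 1 then
        (ZMod.χ₄ k : ℝ) * cutoff √X k * ∑' m : ℤ, w (k * m) else 0)
      - W * ∑ k ∈ Finset.Icc 1 K,
        (if Int.gcd k q = 1 then (ZMod.χ₄ k : ℝ) * (cutoff √X k / k) else 0)| ≤ 16 * c * √X := by
    rw [Finset.mul_sum, ← Finset.sum_sub_distrib]
    calc _ ≤ ∑ k ∈ Finset.Icc 1 K, |(if Int.gcd k q = 1 then
            (ZMod.χ₄ k : ℝ) * cutoff √X k * ∑' m : ℤ, w (k * m) else 0)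
          - W * (if Int.gcd k q = 1 then (ZMod.χ₄ k : ℝ) * (cutoff √X k / k) else 0)| :=
          Finset.abs_sum_le_sum_abs _ _
      _ ≤ (Finset.Icc 1 K).card • (8 * c) := by
          refine Finset.sum_le_card_nsmul _ _ _ fun k hk => ?_
          rw [Finset.mem_Icc] at hk
          have hkK : (k : ℝ) ≤ K := by exact_mod_cast hk.2
          split_ifs
          · have e := hw.abs_tsum_sub_le hX0 (k := k) (by omega) (by nlinarith)
            rw [show (ZMod.χ₄ k : ℝ) * cutoff √X k * ∑' m : ℤ, w (k * m)
                - W * ((ZMod.χ₄ k : ℝ) * (cutoff √X k / k))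
                = (ZMod.χ₄ k : ℝ) * (cutoff √X k * (∑' m : ℤ, w (k * m) - W / k)) by ring,
              abs_mul, abs_mul, abs_of_nonneg (cutoff_nonneg _ _)]
            calc _ ≤ 1 * (1 * (8 * c)) := by
                  gcongr
                  · exact mul_nonneg (cutoff_nonneg _ _) (abs_nonneg _)
                  · exact abs_chi_le_one k
                  · exact cutoff_le_one _ _
              _ = 8 * c := by ring
          · simpa using hc
      _ = K * (8 * c) := by rw [Nat.card_Icc, nsmul_eq_mul]; simp
      _ ≤ 2 * √X * (8 * c) := by gcongr
      _ = 16 * c * √X := by ring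
  have h3 := mul_le_mul hWle h1 (abs_nonneg _) (by positivity)
  rw [← abs_mul, mul_sub] at h3
  have h4 : 2 * c * X * (2 ^ q.primeFactors.card * (2 / √X)) = 4 * c * √X * 2 ^ q.primeFactors.card := by
    rw [show 2 * c * X * (2 ^ q.primeFactors.card * (2 / √X))
      = 4 * c * (X / √X) * 2 ^ q.primeFactors.card by ring, Real.div_sqrt]
  rw [h4] at h3
  have h5 := (abs_sub_le _ _ _).trans (add_le_add h2 h3)
  refine h5.trans ?_
  have : 0 ≤ c * √X := by positivity
  nlinarith

/-- `S` is close to its average over the cosets of the lattices involved. -/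
theorem abs_S_sub_average_le (hw : IsLipWeight c X w) (hΦ : IsLipBump B Φ) {q : ℕ} (hq : Odd q)
    {a : ℤ} (ha : Int.gcd a q = 1) (hL : 1 ≤ L) (hLq : L < q) (hX : X = L * q) (hX4 : 4 ≤ X)
    (hroot : √(√X) ≤ L) {D : ℝ} (hD1 : 1 ≤ D)
    (hD : ∀ n : ℕ, n ≠ 0 → (n : ℝ) ≤ 2 * X → (n.divisors.card : ℝ) ≤ D) :
    |S Φ w L q a - 4 * ((q.totient : ℝ) / q ^ 2 * (∑' b : ℤ, Φ (b / L)) *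
        ∑ k ∈ Finset.Icc 1 ⌊2 * √X⌋₊, (if Int.gcd k q = 1 then
          (ZMod.χ₄ k : ℝ) * cutoff √X k * ∑' m : ℤ, w (k * m) else 0))|
      ≤ 466944 * (c * B) * 2 ^ q.primeFactors.card * (D * (L * √(√X))) := by
  have hq0 : q ≠ 0 := by rintro rfl; simp at hq
  have hqpos : (0 : ℝ) < q := by exact_mod_cast Nat.pos_of_ne_zero hq0
  have hL0 : 0 < L := by linarith
  have hX0 : 0 < X := by linarith
  have hc := hw.const_nonneg
  have hB := hΦ.const_nonneg
  set Y := √X with hYdef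
  have hY : 0 < Y := Real.sqrt_pos.2 hX0
  have hYsq : Y * Y = X := Real.mul_self_sqrt hX0.le
  have hY2 : 2 ≤ Y := Real.le_sqrt_of_sq_le (by linarith)
  set r := √Y with hrdef
  have hr : 0 < r := Real.sqrt_pos.2 hY
  have hrsq : r * r = Y := Real.mul_self_sqrt hY.le
  set K := ⌊2 * Y⌋₊ with hK
  have hKle : (K : ℝ) ≤ 2 * Y := Nat.floor_le (by positivity)
  set ω2 : ℝ := 2 ^ q.primeFactors.card with hω
  have hω1 : 1 ≤ ω2 := one_le_pow₀ (by norm_num)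
  set F1 : ℕ → ℤ × ℤ → ℝ := fun k p => w (k * p.1) * Φ (p.2 / L) with hF1
  set F2 : ℕ → ℤ × ℤ → ℝ := fun k p => ((1 - cutoff Y p.1) * w (k * p.1)) * Φ (p.2 / L) with hF2
  set Φs := ∑' b : ℤ, Φ (b / L) with hΦs
  set φ2 : ℝ := (q.totient : ℝ) / q ^ 2 with hφ2
  -- truncation to `k ≤ K`
  have hS : S Φ w L q a = 4 * ∑ k ∈ Finset.Icc 1 K,
      ((ZMod.χ₄ k : ℝ) * cutoff Y k * sievedSum q (a * k) (F1 k)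
        + sievedSum q (a * k) (fun p => (ZMod.χ₄ p.1 : ℝ) * F2 k p)) := by
    rw [S_eq_sum_sievedSum hw hΦ hX0 hL0 q a Y]
    congr 1
    symm
    -- For `k > 2 √X` the cutoff at `k` is `0`, and `w (k m) ≠ 0` gives `m ≤ 2 X / k ≤ √X`, where `1
    -- - cutoff` is `0`. Both halves vanish.
    refine Finset.sum_subset (Finset.Icc_subset_Icc le_rfl (Nat.floor_mono ?_)) fun k hk hk' => ?_
    · nlinarith
    · rw [Finset.mem_Icc] at hk
      have hkK : 2 * Y < k := by
        apply Nat.lt_of_floor_lt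
        rw [Finset.mem_Icc, not_and, not_le] at hk'
        exact hk' hk.1
      have hz : ∀ p : ℤ × ℤ, (1 - cutoff Y p.1) * w (k * p.1) = 0 := by
        intro p
        by_cases h : w (k * p.1) = 0
        · rw [h, mul_zero]
        · have := (hw.support _ h).2
          rw [cutoff_eq_one hY, sub_self, zero_mul]
          by_contra hlt
          rw [not_le] at hlt
          nlinarith
      have hz' : ∀ p : ℤ × ℤ, F2 k p = 0 := fun p => by
        simp only [hF2]
        rw [hz, zero_mul]
      rw [cutoff_eq_zero hY hkK.le]
      simp only [hz', mul_zero, zero_mul, zero_add]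
      simp [sievedSum]
  -- equidistribution for each `k`
  have hT1 : r / L ≤ 1 := (div_le_one hL0).2 hroot
  obtain ⟨lam, hlam, hsum⟩ := exists_sum_inv_minimum_le (Nat.pos_of_ne_zero hq0) ha hL0 hLq
    (by positivity : 0 < r / L) hT1 K (by linarith : 0 ≤ D) (by rw [← hX]; exact hD)
  rw [← hX] at hlam
  have hsum' : ∑ k ∈ Finset.Icc 1 K, (lam k)⁻¹ ≤ 38 * (D * (L * r)) := by
    refine hsum.trans ?_
    have e1 : (K : ℝ) / (r / L) ≤ 2 * (L * r) := by
      rw [div_le_iff₀ (by positivity)]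
      calc (K : ℝ) ≤ 2 * (r * r) := by rw [hrsq]; exact hKle
        _ = 2 * (L * r) * (r / L) := by field_simp
    have e2 : D * (r / L) * L ^ 2 = D * (L * r) := by field_simp
    rw [e2]
    have : L * r ≤ D * (L * r) := le_mul_of_one_le_left (by positivity) hD1
    linarith
  set G : ℕ → ℝ := fun k => if Int.gcd k q = 1 then
    (ZMod.χ₄ k : ℝ) * cutoff Y k * ∑' m : ℤ, w (k * m) else 0 with hG
  have hk : ∀ k ∈ Finset.Icc 1 K, |((ZMod.χ₄ k : ℝ) * cutoff Y k * sievedSum q (a * k) (F1 k)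
        + sievedSum q (a * k) (fun p => (ZMod.χ₄ p.1 : ℝ) * F2 k p)) - φ2 * Φs * G k|
      ≤ 3072 * (c * B) * ω2 * (lam k)⁻¹ := by
    intro k hk
    rw [Finset.mem_Icc] at hk
    have hk0 : k ≠ 0 := by omega
    have hkR : (0 : ℝ) < k := by exact_mod_cast hk.1
    obtain ⟨hl0, hl1, hmin⟩ := hlam k hk0
    have hbd : 0 ≤ 3072 * (c * B) * ω2 * (lam k)⁻¹ := by positivity
    by_cases hg : Int.gcd k q = 1
    · have hak : Int.gcd (a * k) q = 1 := by
        rw [← Int.isCoprime_iff_gcd_eq_one] at ha hg ⊢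
        exact ha.mul_left hg
      have hE : 0 < 2 * X / k := by positivity
      have e1 := abs_sievedSum_sub_le (hw.isBoxLipschitz hΦ hX0 hL0 hk0) hE hL0 hq0 hak hl0 hl1 hmin
      have e2 := abs_sievedSum_chi_le (hw.isBoxLipschitz_cutoff hΦ hX0 hL0 hk0 hY) hE hL0 hq hak hl0
        hl1 hmin
      rw [tsum_weight_mul_bump hw hΦ hX0 hL0 hk0] at e1
      have hrw : ((ZMod.χ₄ k : ℝ) * cutoff Y k * sievedSum q (a * k) (F1 k)
          + sievedSum q (a * k) (fun p => (ZMod.χ₄ p.1 : ℝ) * F2 k p)) - φ2 * Φs * G k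
          = (ZMod.χ₄ k : ℝ) * (cutoff Y k * (sievedSum q (a * k) (F1 k)
              - φ2 * ((∑' m : ℤ, w (k * m)) * Φs)))
            + sievedSum q (a * k) (fun p => (ZMod.χ₄ p.1 : ℝ) * F2 k p) := by
        simp only [hG, hg, if_true]
        ring
      rw [hrw]
      refine (abs_add_le _ _).trans ?_
      rw [abs_mul, abs_mul, abs_of_nonneg (cutoff_nonneg _ _)]
      have e3 : |(ZMod.χ₄ k : ℝ)| * (cutoff Y k * |sievedSum q (a * k) (F1 k)
              - φ2 * ((∑' m : ℤ, w (k * m)) * Φs)|) ≤ 1 * (1 * (ω2 * (128 * (12 * (c * B)) / lam k))) := by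
        gcongr
        · exact mul_nonneg (cutoff_nonneg _ _) (abs_nonneg _)
        · exact abs_chi_le_one k
        · exact cutoff_le_one _ _
      refine (add_le_add e3 e2).trans_eq ?_
      rw [← hω, div_eq_mul_inv]
      ring
    -- When `k` shares a factor with `q`, both sieved sums are empty and the model term is `0` by
    -- definition.
    · have hak : Int.gcd (a * k) q ≠ 1 := by
        intro h
        apply hg
        rw [← Int.isCoprime_iff_gcd_eq_one] at h ⊢
        exact h.of_mul_left_right
      simp only [sievedSum_eq_zero hak, hG, hg, if_false]
      simpa using hbd
  rw [hS, ← mul_sub, Finset.mul_sum, ← Finset.sum_sub_distrib, abs_mul,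
    abs_of_pos (by norm_num : (0 : ℝ) < 4)]
  calc _ ≤ 4 * ∑ k ∈ Finset.Icc 1 K, 3072 * (c * B) * ω2 * (lam k)⁻¹ := by
        gcongr
        exact (Finset.abs_sum_le_sum_abs _ _).trans (Finset.sum_le_sum hk)
    _ = 12288 * (c * B) * ω2 * ∑ k ∈ Finset.Icc 1 K, (lam k)⁻¹ := by
        rw [← Finset.mul_sum]; ring
    _ ≤ 12288 * (c * B) * ω2 * (38 * (D * (L * r))) := by gcongr
    _ = _ := by ring

/-- Replacing the factors of the average by their main terms. -/
lemma abs_product_sub_le {q X L Y c B t φ Φs LI V Q : ℝ} (hq : 0 < q) (hL : 0 < L)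
    (hY : 0 ≤ Y) (hYq : Y ≤ q) (hX : X = L * q) (hYX : Y ≤ X) (hc : 0 ≤ c) (hB : 0 ≤ B)
    (ht : 0 ≤ t) (hφ : |φ| ≤ 1 / q) (hΦs : |Φs - LI| ≤ 6 * B) (hLI : |LI| ≤ L * (2 * B))
    (hQ : |Q| ≤ 2 * c * X * t) (hV : |V - Q| ≤ 20 * c * Y * t) :
    |4 * (φ * Φs * V) - 4 * (φ * LI * Q)| ≤ 688 * (c * B) * t * L := by
  have hX0 : 0 ≤ X := hY.trans hYX
  have hVle : |V| ≤ 22 * c * X * t := by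
    -- Here `22 = 2 + 20`. The final constant is `688 = 4 * 6 * 22 + 4 * 2 * 20`, using `X / q = L`
    -- and `Y ≤ q`.
    have h1 := abs_sub_abs_le_abs_sub V Q
    have h2 : 20 * c * Y * t ≤ 20 * c * X * t := by gcongr
    linarith
  have h2 : |(Φs - LI) * V + LI * (V - Q)|
      ≤ 6 * B * (22 * c * X * t) + L * (2 * B) * (20 * c * Y * t) := by
    refine (abs_add_le _ _).trans ?_
    rw [abs_mul, abs_mul]
    gcongr
  rw [show 4 * (φ * Φs * V) - 4 * (φ * LI * Q) = 4 * (φ * ((Φs - LI) * V + LI * (V - Q))) by ring,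
    abs_mul, abs_mul, abs_of_pos (by norm_num : (0 : ℝ) < 4)]
  calc _ ≤ 4 * (1 / q * (6 * B * (22 * c * X * t) + L * (2 * B) * (20 * c * Y * t))) := by
        gcongr
    _ = (c * B) * t * (528 * (X / q) + 160 * L * (Y / q)) := by ring
    _ ≤ (c * B) * t * (528 * L + 160 * L * 1) := by
        gcongr
        · rw [hX, mul_div_cancel_right₀ _ hq.ne']
        · exact (div_le_one hq).2 hYq
    _ = _ := by ring

/-- The asymptotic formula for `S`, with an explicit error term. -/
theorem abs_S_sub_le (hw : IsLipWeight c X w) (hΦ : IsLipBump B Φ) {q : ℕ} (hq : Odd q) {a : ℤ}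
    (ha : Int.gcd a q = 1) (hL : 1 ≤ L) (hLq : L < q) (hX : X = L * q) (hX4 : 4 ≤ X)
    (hroot : √(√X) ≤ L) {D : ℝ} (hD1 : 1 ≤ D)
    (hD : ∀ n : ℕ, n ≠ 0 → (n : ℝ) ≤ 2 * X → (n.divisors.card : ℝ) ≤ D) :
    |S Φ w L q a - Real.pi * (∫ x, Φ x) * L * ((q.totient : ℝ) / q ^ 2)
        * (∏ p ∈ q.primeFactors, (1 - (ZMod.χ₄ p : ℝ) / p)) * ∫ x, w x|
      ≤ 500000 * (c * B) * 2 ^ q.primeFactors.card * D * (L * √(√X)) := by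
  have hq0 : q ≠ 0 := by rintro rfl; simp at hq
  have hqpos : (0 : ℝ) < q := by exact_mod_cast Nat.pos_of_ne_zero hq0
  have hL0 : 0 < L := by linarith
  have hX0 : 0 < X := by linarith
  have hc := hw.const_nonneg
  have hB := hΦ.const_nonneg
  have hY2 : 2 ≤ √X := Real.le_sqrt_of_sq_le (by linarith)
  have hYsq : √X * √X = X := Real.mul_self_sqrt hX0.le
  have hφ : |(q.totient : ℝ) / q ^ 2| ≤ 1 / q := by
    rw [abs_of_nonneg (by positivity), div_le_div_iff₀ (by positivity) hqpos]
    have : (q.totient : ℝ) ≤ q := by exact_mod_cast Nat.totient_le q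
    nlinarith
  have hYq : √X ≤ q := by
    rw [hX, Real.sqrt_le_left hqpos.le, sq]
    gcongr
  have hQ : |(∫ x, w x) * (Real.pi / 4 * ∏ p ∈ q.primeFactors, (1 - (ZMod.χ₄ p : ℝ) / p))|
      ≤ 2 * c * X * 2 ^ q.primeFactors.card := by
    rw [abs_mul, abs_mul, abs_of_pos (by positivity : 0 < Real.pi / 4)]
    have : Real.pi / 4 ≤ 1 := by linarith [Real.pi_le_four]
    calc _ ≤ 2 * c * X * (1 * 2 ^ q.primeFactors.card) := by
          gcongr
          · exact hw.abs_integral_le hX0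
          · exact abs_prod_one_sub_chi_le _
      _ = _ := by ring
  have hLI : |L * ∫ x, Φ x| ≤ L * (2 * B) := by
    rw [abs_mul, abs_of_pos hL0]
    gcongr
    exact hΦ.abs_integral_le
  have herr1 := abs_S_sub_average_le hw hΦ hq ha hL hLq hX hX4 hroot hD1 hD
  have herr2 := abs_product_sub_le hqpos hL0 (Real.sqrt_nonneg X) hYq hX (by nlinarith) hc hB
    (by positivity) hφ (hΦ.abs_tsum_sub_le hL) hLI hQ (abs_sum_chi_cutoff_sub_le hw hX4 hq0)
  have hr1 : 1 ≤ √(√X) := Real.one_le_sqrt.2 (by linarith)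
  have hfin : 688 * (c * B) * 2 ^ q.primeFactors.card * L
      ≤ 688 * (c * B) * 2 ^ q.primeFactors.card * (D * (L * √(√X))) := by
    gcongr
    calc L = 1 * (L * 1) := by ring
      _ ≤ D * (L * √(√X)) := by gcongr
  have htot := (abs_sub_le _ _ _).trans (add_le_add herr1 (herr2.trans hfin))
  have hnn : 0 ≤ (c * B) * 2 ^ q.primeFactors.card * (D * (L * √(√X))) := by positivity
  have heq : ∀ I W P : ℝ, Real.pi * I * L * ((q.totient : ℝ) / q ^ 2) * P * W
      = 4 * ((q.totient : ℝ) / q ^ 2 * (L * I) * (W * (Real.pi / 4 * P))) := fun I W P => by ring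
  rw [heq]
  linarith

end Core


/-! ### The main term -/

open MeasureTheory

lemma isLipBump_of_contDiff {Φ : ℝ → ℝ} (hs : ContDiff ℝ ∞ Φ)
    (hsupp : tsupport Φ ⊆ Set.Icc (-1) 1) : ∃ B, IsLipBump B Φ := by
  have hcs : HasCompactSupport Φ := isCompact_Icc.of_isClosed_subset (isClosed_tsupport Φ) hsupp
  obtain ⟨K, hK⟩ := hs.lipschitzWith_of_hasCompactSupport hcs (by simp)
  obtain ⟨M, hM⟩ := hcs.exists_bound_of_continuous hs.continuous
  refine ⟨max M K, fun x hx => abs_le.2 (hsupp (subset_tsupport _ hx)),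
    fun x => (hM x).trans (le_max_left _ _), fun x y => ?_⟩
  have := hK.dist_le_mul x y
  rw [Real.dist_eq, Real.dist_eq] at this
  exact this.trans (mul_le_mul_of_nonneg_right (le_max_right _ _) (abs_nonneg _))

section Weight

variable {C : ℕ → ℝ} {X : ℝ} {w : ℝ → ℝ}

lemma IsWeight.isLipWeight (hw : IsWeight C X w) (hX : 0 < X) : IsLipWeight |C 1| X w := by
  have hsupp : ∀ x, w x ≠ 0 → X ≤ x ∧ x ≤ 2 * X := fun x hx =>
    hw.support_subset (subset_tsupport _ hx)
  have hlip : ∀ x y, |w x - w y| ≤ |C 1| / X * |x - y| := by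
    intro x y
    have hd : ∀ z ∈ (Set.univ : Set ℝ), ‖deriv w z‖ ≤ |C 1| / X := by
      intro z _
      have := hw.deriv_bound 1 le_rfl z
      rw [iteratedDeriv_one, pow_one, ← div_eq_mul_inv] at this
      exact this.trans (by gcongr; exact le_abs_self _)
    exact Convex.norm_image_sub_le_of_norm_deriv_le
      (fun z _ => (hw.smooth.differentiable (by simp)).differentiableAt) hd convex_univ
      (Set.mem_univ y) (Set.mem_univ x)
  refine ⟨hsupp, fun x => ?_, hlip⟩
  by_cases hx : w x = 0
  · rw [hx, abs_zero]; positivity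
  -- Since `w` vanishes at `0`, the Lipschitz bound over a distance at most `2 X` already gives `|w|
  -- ≤ 2 |C 1|`; only the first derivative bound is needed.
  · have h0 : w 0 = 0 := by
      by_contra h
      linarith [(hsupp 0 h).1]
    have h1 := hlip x 0
    obtain ⟨h2, h3⟩ := hsupp x hx
    rw [h0, sub_zero, sub_zero, abs_of_pos (by linarith : 0 < x)] at h1
    calc |w x| ≤ |C 1| / X * x := h1
      _ ≤ |C 1| / X * (2 * X) := by gcongr
      _ = 2 * |C 1| := by field_simp

lemma IsWeight.half_le_integral (hw : IsWeight C X w) (hX : 0 < X) : X / 2 ≤ ∫ x, w x := by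
  have hcs : HasCompactSupport w :=
    isCompact_Icc.of_isClosed_subset (isClosed_tsupport w) hw.support_subset
  have hintegral : Integrable w := hw.smooth.continuous.integrable_of_hasCompactSupport hcs
  calc X / 2 = ∫ x in Set.Icc (5 * X / 4) (7 * X / 4), (1 : ℝ) := by
        rw [setIntegral_const, Measure.real, Real.volume_Icc,
          ENNReal.toReal_ofReal (by linarith), smul_eq_mul]
        ring
    _ = ∫ x in Set.Icc (5 * X / 4) (7 * X / 4), w x :=
        setIntegral_congr_fun measurableSet_Icc fun x hx => (hw.eq_one x hx).symm
    _ ≤ ∫ x, w x := setIntegral_le_integral hintegral (Filter.Eventually.of_forall hw.nonneg)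

lemma IsWeight.setIntegral_Ioi (hw : IsWeight C X w) (hX : 0 < X) :
    ∫ x in Set.Ioi (0 : ℝ), w x = ∫ x, w x :=
  setIntegral_eq_integral_of_forall_compl_eq_zero fun x hx => by
    by_contra h
    exact hx (hX.trans_le (hw.support_subset (subset_tsupport _ h)).1)

end Weight

/-- The product over primes in the main term. -/
noncomputable def chiProd (q : ℕ) : ℝ := ∏ p ∈ q.primeFactors, (1 - (ZMod.χ₄ p : ℝ) / p)

/-- The main term as a real number. -/
noncomputable def realMainTerm (I W L : ℝ) (q : ℕ) : ℝ :=
  Real.pi * I * L * ((q.totient : ℝ) / q ^ 2) * chiProd q * W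

lemma mainTerm_eq {C : ℕ → ℝ} {X L : ℝ} {Φ w : ℝ → ℝ} (hw : IsWeight C X w) (hX : 0 < X) {q : ℕ}
    (hq : Odd q) :
    mainTerm Φ w L q = (realMainTerm (∫ x, Φ x) (∫ x, w x) L q : ℂ) := by
  have h1 : 𝓕 (fun x : ℝ => (Φ x : ℂ)) 0 = ((∫ x, Φ x : ℝ) : ℂ) := by
    rw [Real.fourier_eq']
    simp only [inner_zero_right, mul_zero, Complex.ofReal_zero, zero_mul, Complex.exp_zero,
      one_smul]
    exact integral_ofReal
  have h2 : ∏ p ∈ q.primeFactors, (1 - gaussSumQ p 1 / (p : ℂ) ^ 2) = (chiProd q : ℂ) := by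
    rw [chiProd]
    push_cast
    refine Finset.prod_congr rfl fun p hp => ?_
    have hpp := Nat.prime_of_mem_primeFactors hp
    have hp2 : p ≠ 2 := by
      rintro rfl
      exact (Nat.not_even_iff_odd.2 hq) (even_iff_two_dvd.2 (Nat.dvd_of_mem_primeFactors hp))
    rw [gaussSumQ_prime hpp hp2]
    have : (p : ℂ) ≠ 0 := by exact_mod_cast hpp.ne_zero
    field_simp
  rw [mainTerm, h1, h2, hw.setIntegral_Ioi hX, realMainTerm]
  push_cast
  ring

lemma chi_div_le (p : ℕ) : (ZMod.χ₄ p : ℝ) / p ≤ 1 / p := by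
  gcongr
  exact (abs_le.1 (abs_chi_le_one p)).2

lemma neg_one_div_le_chi_div (p : ℕ) : -(1 / (p : ℝ)) ≤ (ZMod.χ₄ p : ℝ) / p := by
  rw [← neg_div]
  gcongr
  exact (abs_le.1 (abs_chi_le_one p)).1

lemma one_div_le_one_of_mem_primeFactors {p q : ℕ} (hp : p ∈ q.primeFactors) : 1 / (p : ℝ) ≤ 1 := by
  have : (1 : ℝ) ≤ p := by exact_mod_cast (Nat.prime_of_mem_primeFactors hp).one_lt.le
  exact div_le_one_of_le₀ this (by positivity)

lemma inv_le_chiProd (q : ℕ) : ((q.primeFactors.card : ℝ) + 1)⁻¹ ≤ chiProd q := by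
  refine (inv_card_add_one_le_prod _ fun p hp => (Nat.prime_of_mem_primeFactors hp).two_le).trans ?_
  refine Finset.prod_le_prod (fun p hp => ?_) fun p _ => ?_
  · linarith [one_div_le_one_of_mem_primeFactors hp]
  · linarith [chi_div_le p]

lemma inv_le_totient_div {q : ℕ} (hq : q ≠ 0) :
    ((q.primeFactors.card : ℝ) + 1)⁻¹ ≤ (q.totient : ℝ) / q := by
  rw [← prod_primeFactors_one_sub_inv hq]
  exact inv_card_add_one_le_prod _ fun p hp => (Nat.prime_of_mem_primeFactors hp).two_le

/-- `chiProd q` alone is unbounded, because of primes with `χ₄(p) = -1`. Paired with `φ(q) / q`,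
each factor is at most `(1 - 1/p)(1 + 1/p) ≤ 1`. -/
lemma totient_div_mul_chiProd_le_one {q : ℕ} (hq : q ≠ 0) :
    (q.totient : ℝ) / q * chiProd q ≤ 1 := by
  rw [← prod_primeFactors_one_sub_inv hq, chiProd, ← Finset.prod_mul_distrib]
  refine Finset.prod_le_one (fun p hp => ?_) fun p hp => ?_
  · have h1 := one_div_le_one_of_mem_primeFactors hp
    have h2 := chi_div_le p
    exact mul_nonneg (by linarith) (by linarith)
  · have h1 := one_div_le_one_of_mem_primeFactors hp
    have h2 := neg_one_div_le_chi_div p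
    have h3 : 0 ≤ 1 / (p : ℝ) := by positivity
    nlinarith

/-! ### Size of the main term -/

section MainTermBounds

variable {I W L X : ℝ} {q : ℕ}

/-- As `X / q = L`, the main term is of order `L²` times `φ(q) / q` and `chiProd q`, each at least
`1 / (ω(q) + 1)`. -/
lemma le_realMainTerm (hI : 0 ≤ I) (hL : 0 ≤ L) (hq : q ≠ 0) (hX : X = L * q) (hW : X / 2 ≤ W) :
    Real.pi / 2 * I * L ^ 2 * (((q.primeFactors.card : ℝ) + 1)⁻¹) ^ 2 ≤ realMainTerm I W L q := by
  have hq0 : (0 : ℝ) < q := by exact_mod_cast Nat.pos_of_ne_zero hq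
  have h1 := inv_le_totient_div hq
  have h2 := inv_le_chiProd q
  set v := ((q.primeFactors.card : ℝ) + 1)⁻¹ with hv
  have hv0 : 0 ≤ v := by positivity
  have hXn : 0 ≤ X := by rw [hX]; positivity
  calc Real.pi / 2 * I * L ^ 2 * v ^ 2 = Real.pi * I * L / q * (v * v * (X / 2)) := by
        rw [hX]; field_simp
    _ ≤ Real.pi * I * L / q * ((q.totient : ℝ) / q * chiProd q * W) := by
        have := Real.pi_pos
        have h4 : v * v ≤ (q.totient : ℝ) / q * chiProd q := mul_le_mul h1 h2 hv0 (hv0.trans h1)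
        have h5 := (mul_nonneg hv0 hv0).trans h4
        exact mul_le_mul_of_nonneg_left (mul_le_mul h4 hW (by positivity) h5) (by positivity)
    _ = realMainTerm I W L q := by
        rw [realMainTerm]; field_simp

lemma realMainTerm_le {c : ℝ} (hI : 0 ≤ I) (hL : 0 ≤ L) (hq : q ≠ 0) (hW0 : 0 ≤ W)
    (hW : W ≤ 2 * c * X) : realMainTerm I W L q ≤ 2 * Real.pi * I * c * (X * L / q) := by
  have hq0 : (0 : ℝ) < q := by exact_mod_cast Nat.pos_of_ne_zero hq
  have := Real.pi_pos
  calc realMainTerm I W L q = Real.pi * I * L / q * ((q.totient : ℝ) / q * chiProd q * W) := by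
        rw [realMainTerm]; field_simp
    _ ≤ Real.pi * I * L / q * (1 * (2 * c * X)) := by
        gcongr
        exact totient_div_mul_chiProd_le_one hq
    _ = _ := by ring

end MainTermBounds

lemma card_primeFactors_add_one_le_log {q : ℕ} (hq : 3 ≤ q) :
    (q.primeFactors.card : ℝ) + 1 ≤ 3 * Real.log q := by
  have h1 : 2 ^ q.primeFactors.card ≤ q :=
    (two_pow_card_primeFactors_le (by omega)).trans (Nat.card_divisors_le_self q)
  have h2 : (2 : ℝ) ^ q.primeFactors.card ≤ q := by exact_mod_cast h1
  have h3 := Real.log_le_log (by positivity) h2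
  rw [Real.log_pow] at h3
  have h4 : 1 ≤ Real.log q := by
    rw [Real.le_log_iff_exp_le (by positivity)]
    have : (3 : ℝ) ≤ q := by exact_mod_cast hq
    linarith [Real.exp_one_lt_d9]
  have h5 := Real.log_two_gt_d9
  have h6 : (0 : ℝ) ≤ q.primeFactors.card := by positivity
  nlinarith

/-! ### The uniform asymptotic formula -/

/-- The error is at most a constant times `D² L X^(1/4)`, since `2 ^ ω(q) ≤ D`, while the main term
is at least a constant times `L² / D²`. Their ratio is at most a constant times `D⁴ X^(1/4) / L`, a
negative power of `q` uniformly in `β`. -/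
lemma abs_S_sub_realMainTerm_le {ε : ℝ} (hε : 0 < ε) {C : ℕ → ℝ} {Φ : ℝ → ℝ} {B : ℝ}
    (hΦ : IsLipBump B Φ) (hI : 0 < ∫ x, Φ x) {δ : ℝ} (hδ : 0 < δ) :
    ∃ q₀ : ℕ, 4 ≤ q₀ ∧ ∀ q : ℕ, q₀ ≤ q → ∀ a : ℤ, Int.gcd (2 * a) q = 1 →
      ∀ β : ℝ, 1 / 3 + 6 * ε < β → β < 1 →
      ∀ L X : ℝ, L = (q : ℝ) ^ β → X = (q : ℝ) ^ (1 + β) →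
      ∀ w : ℝ → ℝ, IsWeight C X w →
        |S Φ w L q a - realMainTerm (∫ x, Φ x) (∫ x, w x) L q|
          ≤ δ * realMainTerm (∫ x, Φ x) (∫ x, w x) L q := by
  set I := ∫ x, Φ x with hIdef
  -- For `n ≤ 2 X ≤ q³` the exponent `ε / 12` becomes `q ^ (ε / 4)`, so the four factors `D` cost `q
  -- ^ ε` in total.
  obtain ⟨C₀, hC₀, hdiv⟩ := exists_card_divisors_le (by positivity : 0 < ε / 12)
  have hB := hΦ.const_nonneg
  set A := 500000 * (|C 1| * B) * C₀ ^ 4 with hA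
  have hlim : Filter.Tendsto (fun q : ℕ => A * (q : ℝ) ^ (-(3 * ε))) Filter.atTop (nhds (A * 0)) :=
    ((tendsto_rpow_neg_atTop (by positivity : 0 < 3 * ε)).comp
      tendsto_natCast_atTop_atTop).const_mul A
  rw [mul_zero] at hlim
  obtain ⟨q₁, hq₁⟩ := Filter.eventually_atTop.1
    (hlim.eventually (gt_mem_nhds (by positivity : 0 < δ * I)))
  refine ⟨max q₁ 4, le_max_right _ _, ?_⟩
  intro q hq a ha β hβ1 hβ2 L X hL hX w hw
  have hq4 : 4 ≤ q := (le_max_right _ _).trans hq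
  have hq4' : (4 : ℝ) ≤ q := by exact_mod_cast hq4
  have hq0 : q ≠ 0 := by omega
  have hqpos : (0 : ℝ) < q := by linarith
  have hq1 : (1 : ℝ) ≤ q := by linarith
  have hsmall := hq₁ q ((le_max_left _ _).trans hq)
  have hcop : IsCoprime (2 * a) (q : ℤ) := Int.isCoprime_iff_gcd_eq_one.2 ha
  have ha' : Int.gcd a q = 1 := Int.isCoprime_iff_gcd_eq_one.1 hcop.of_mul_left_right
  have hodd : Odd q := by
    rw [← Nat.coprime_two_left]
    exact Nat.isCoprime_iff_coprime.1 (by exact_mod_cast hcop.of_mul_left_left)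
  have hXL : X = L * q := by
    rw [hX, hL, Real.rpow_add hqpos, Real.rpow_one, mul_comm]
  have hL1 : 1 ≤ L := by
    rw [hL]; exact Real.one_le_rpow hq1 (by linarith)
  have hL0 : 0 < L := by linarith
  have hLq : L < q := by
    rw [hL]
    calc (q : ℝ) ^ β < (q : ℝ) ^ (1 : ℝ) := Real.rpow_lt_rpow_of_exponent_lt (by linarith) hβ2
      _ = q := Real.rpow_one _
  have hX4 : 4 ≤ X := by rw [hXL]; nlinarith
  have hX0 : 0 < X := by linarith
  have hroot : √(√X) = (q : ℝ) ^ ((1 + β) / 4) := by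
    rw [hX, Real.sqrt_eq_rpow, Real.sqrt_eq_rpow, ← Real.rpow_mul hqpos.le,
      ← Real.rpow_mul hqpos.le]
    congr 1
    ring
  have hrootL : √(√X) ≤ L := by
    rw [hroot, hL]
    exact Real.rpow_le_rpow_of_exponent_le hq1 (by linarith)
  set D : ℝ := C₀ * (q : ℝ) ^ (ε / 4) with hD
  have hD1 : 1 ≤ D := by
    rw [hD]
    exact one_le_mul_of_one_le_of_one_le hC₀ (Real.one_le_rpow hq1 (by positivity))
  have hDn : ∀ n : ℕ, n ≠ 0 → (n : ℝ) ≤ 2 * X → (n.divisors.card : ℝ) ≤ D := by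
    intro n hn hnX
    refine (hdiv n hn).trans ?_
    rw [hD]
    gcongr
    have hnq : (n : ℝ) ≤ (q : ℝ) ^ (3 : ℝ) := by
      rw [show (3 : ℝ) = ((3 : ℕ) : ℝ) by norm_num, Real.rpow_natCast]
      rw [hXL] at hnX
      have h1 : L * q ≤ q * q := by gcongr
      have h2 : 0 < (q : ℝ) * q := by positivity
      nlinarith
    calc (n : ℝ) ^ (ε / 12) ≤ ((q : ℝ) ^ (3 : ℝ)) ^ (ε / 12) := by gcongr
      _ = (q : ℝ) ^ (ε / 4) := by
          rw [← Real.rpow_mul hqpos.le]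
          congr 1
          ring
  have hlw := hw.isLipWeight hX0
  have hc := hlw.const_nonneg
  have herr := abs_S_sub_le hlw hΦ hodd ha' hL1 hLq hXL hX4 hrootL hD1 hDn
  have hmain := le_realMainTerm hI.le hL0.le hq0 hXL (hw.half_le_integral hX0)
  have h2D : (2 : ℝ) ^ q.primeFactors.card ≤ D := by
    refine le_trans ?_ (hDn q hq0 (by rw [hXL]; nlinarith))
    exact_mod_cast two_pow_card_primeFactors_le hq0
  have hωD : (q.primeFactors.card : ℝ) + 1 ≤ D := by
    refine le_trans ?_ h2D
    exact_mod_cast Nat.lt_two_pow_self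
  have hlow : I * L ^ 2 / D ^ 2 ≤ realMainTerm I (∫ x, w x) L q := by
    refine le_trans ?_ hmain
    have h1 : D⁻¹ ≤ ((q.primeFactors.card : ℝ) + 1)⁻¹ := inv_anti₀ (by positivity) hωD
    have h2 : 1 ≤ Real.pi / 2 := by linarith [Real.pi_gt_three]
    calc I * L ^ 2 / D ^ 2 = 1 * I * L ^ 2 * (D⁻¹) ^ 2 := by rw [inv_pow]; ring
      _ ≤ _ := by gcongr
  -- The exponents compare as `ε + (1 + β) / 4 ≤ β - 3 ε`, i.e. `β ≥ 1/3 + 16 ε / 3`, which `β > 1/3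
  -- + 6 ε` ensures.
  have hexp : D ^ 4 * √(√X) ≤ C₀ ^ 4 * (q : ℝ) ^ (-(3 * ε)) * L := by
    rw [hD, hroot, hL, mul_pow, ← Real.rpow_natCast ((q : ℝ) ^ (ε / 4)), ← Real.rpow_mul hqpos.le,
      mul_assoc, mul_assoc, ← Real.rpow_add hqpos, ← Real.rpow_add hqpos]
    refine mul_le_mul_of_nonneg_left (Real.rpow_le_rpow_of_exponent_le hq1 ?_) (by positivity)
    push_cast
    linarith
  have hkey : 500000 * (|C 1| * B) * 2 ^ q.primeFactors.card * D * (L * √(√X))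
      ≤ δ * (I * L ^ 2 / D ^ 2) := by
    rw [← mul_div_assoc, le_div_iff₀ (by positivity)]
    calc 500000 * (|C 1| * B) * 2 ^ q.primeFactors.card * D * (L * √(√X)) * D ^ 2
        ≤ 500000 * (|C 1| * B) * D * D * (L * √(√X)) * D ^ 2 := by gcongr
      _ = 500000 * (|C 1| * B) * L * (D ^ 4 * √(√X)) := by ring
      _ ≤ 500000 * (|C 1| * B) * L * (C₀ ^ 4 * (q : ℝ) ^ (-(3 * ε)) * L) := by gcongr
      _ = (A * (q : ℝ) ^ (-(3 * ε))) * L ^ 2 := by rw [hA]; ring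
      _ ≤ δ * I * L ^ 2 := by gcongr
      _ = δ * (I * L ^ 2) := by ring
  have hδm := mul_le_mul_of_nonneg_left hlow hδ.le
  exact herr.trans (hkey.trans hδm)

end TwoSquares

/-! ### The asymptotic formula and the order of magnitude -/

theorem theorem3 (ε : ℝ) (hε : 0 < ε) (C : ℕ → ℝ) (Φ : ℝ → ℝ)
    (hΦ_smooth : ContDiff ℝ ∞ Φ) (hΦ_nonneg : ∀ x, 0 ≤ Φ x)
    (hΦ_ne : Φ ≠ 0) (hΦ_supp : tsupport Φ ⊆ Set.Icc (-1) 1) :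
    (∀ δ : ℝ, 0 < δ → ∃ q₀ : ℕ, ∀ q : ℕ, q₀ ≤ q → ∀ a : ℤ, Int.gcd (2 * a) q = 1 →
      ∀ β : ℝ, 1 / 3 + 6 * ε < β → β < 1 →
      ∀ L X : ℝ, L = (q : ℝ) ^ β → X = (q : ℝ) ^ (1 + β) →
      ∀ w : ℝ → ℝ, TwoSquares.IsWeight C X w →
        ‖(TwoSquares.S Φ w L q a : ℂ) - TwoSquares.mainTerm Φ w L q‖
          ≤ δ * ‖TwoSquares.mainTerm Φ w L q‖) ∧
    (∃ c₁ c₂ : ℝ, 0 < c₁ ∧ 0 < c₂ ∧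
      ∃ q₀ : ℕ, ∀ q : ℕ, q₀ ≤ q → ∀ a : ℤ, Int.gcd (2 * a) q = 1 →
      ∀ β : ℝ, 1 / 3 + 6 * ε < β → β < 1 →
      ∀ L X : ℝ, L = (q : ℝ) ^ β → X = (q : ℝ) ^ (1 + β) →
      ∀ w : ℝ → ℝ, TwoSquares.IsWeight C X w →
        c₁ * (X * L / (q * Real.log q ^ 2)) ≤ TwoSquares.S Φ w L q a ∧
        TwoSquares.S Φ w L q a ≤ c₂ * (X * L / q)) := by
  obtain ⟨B, hΦ⟩ := TwoSquares.isLipBump_of_contDiff hΦ_smooth hΦ_supp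
  have hcs : HasCompactSupport Φ :=
    isCompact_Icc.of_isClosed_subset (isClosed_tsupport Φ) hΦ_supp
  obtain ⟨x₀, hx₀⟩ := Function.ne_iff.1 hΦ_ne
  have hI : 0 < ∫ x, Φ x :=
    hΦ_smooth.continuous.integral_pos_of_hasCompactSupport_nonneg_nonzero hcs hΦ_nonneg hx₀
  refine ⟨fun δ hδ => ?_, ?_⟩
  · obtain ⟨q₀, hq₀, h⟩ := TwoSquares.abs_S_sub_realMainTerm_le hε (C := C) hΦ hI hδ
    refine ⟨q₀, fun q hq a ha β hβ1 hβ2 L X hL hX w hw => ?_⟩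
    have hqpos : (0 : ℝ) < q := by exact_mod_cast (by omega : 0 < q)
    have hX0 : 0 < X := by rw [hX]; positivity
    have hodd : Odd q := by
      have hcop : IsCoprime (2 * a) (q : ℤ) := Int.isCoprime_iff_gcd_eq_one.2 ha
      rw [← Nat.coprime_two_left]
      exact Nat.isCoprime_iff_coprime.1 (by exact_mod_cast hcop.of_mul_left_left)
    have hb := h q hq a ha β hβ1 hβ2 L X hL hX w hw
    rw [TwoSquares.mainTerm_eq hw hX0 hodd, ← Complex.ofReal_sub, Complex.norm_real,
      Complex.norm_real, Real.norm_eq_abs, Real.norm_eq_abs]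
    exact hb.trans (mul_le_mul_of_nonneg_left (le_abs_self _) hδ.le)
  · obtain ⟨q₀, hq₀, h⟩ := TwoSquares.abs_S_sub_realMainTerm_le hε (C := C) hΦ hI
      (by norm_num : (0 : ℝ) < 1 / 2)
    have hπ := Real.pi_pos
    -- With relative error `1 / 2`, the lower constant is `1/2 * π/2 * 1/9`, the `9` coming from
    -- `ω(q) + 1 ≤ 3 log q` squared; the upper one is `3/2` times `2 π |C 1|`, each times the
    -- integral of `Φ`. The `+ 1` keeps the upper constant positive even if `C 1 = 0`.
    refine ⟨Real.pi * (∫ x, Φ x) / 36, 3 * Real.pi * (∫ x, Φ x) * |C 1| + 1, by positivity,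
      by positivity, q₀, fun q hq a ha β hβ1 hβ2 L X hL hX w hw => ?_⟩
    have hqpos : (0 : ℝ) < q := by exact_mod_cast (by omega : 0 < q)
    have hL0 : 0 < L := by rw [hL]; positivity
    have hX0 : 0 < X := by rw [hX]; positivity
    have hXL : X = L * q := by
      rw [hX, hL, Real.rpow_add hqpos, Real.rpow_one, mul_comm]
    have hb := abs_le.1 (h q hq a ha β hβ1 hβ2 L X hL hX w hw)
    have hlow := TwoSquares.le_realMainTerm hI.le hL0.le (by omega : q ≠ 0) hXL
      (hw.half_le_integral hX0)
    have hup := TwoSquares.realMainTerm_le (X := X) (c := |C 1|) hI.le hL0.le (by omega : q ≠ 0)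
      (le_trans (by positivity) (hw.half_le_integral hX0))
      ((le_abs_self _).trans ((hw.isLipWeight hX0).abs_integral_le hX0))
    constructor
    · have hlog := TwoSquares.card_primeFactors_add_one_le_log (q := q) (by omega)
      have hpos : (0 : ℝ) < (q.primeFactors.card : ℝ) + 1 := by positivity
      have hlogpos : 0 < Real.log q := by linarith
      have hinv : (3 * Real.log q)⁻¹ ≤ ((q.primeFactors.card : ℝ) + 1)⁻¹ := inv_anti₀ hpos hlog
      have hstep : Real.pi / 2 * (∫ x, Φ x) * L ^ 2 * ((3 * Real.log q)⁻¹) ^ 2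
          ≤ Real.pi / 2 * (∫ x, Φ x) * L ^ 2 * (((q.primeFactors.card : ℝ) + 1)⁻¹) ^ 2 := by
        gcongr
      have heq : Real.pi * (∫ x, Φ x) / 36 * (X * L / (q * Real.log q ^ 2))
          = 1 / 2 * (Real.pi / 2 * (∫ x, Φ x) * L ^ 2 * ((3 * Real.log q)⁻¹) ^ 2) := by
        rw [hXL]
        field_simp
        norm_num
      rw [heq]
      linarith [hb.1]
    · have hXLq : 0 ≤ X * L / q := by positivity
      nlinarith [hb.2]
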